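/- Let $n\ge 0$, let $W=\mathfrak S_{n+1}$ be the symmetric group on $\{1,\dots,n+1\}$ (permutations are composed as functions, from right to left), $S=\{s_1,\dots,s_n\}$ with $s_i=(i,i+1)$, $\ell$ the length function with respect to $S$, $T$ the set of transpositions and $\ell_T$ the length function with respect to $T$. Let $c=s_{a_1}s_{a_2}\cdots s_{a_n}$ be the product of all the elements of $S$ in some order (a standard Coxeter element), and let ${\sf NC}(\mathfrak S_{n+1},c)$ be the set of all $x\in W$ with $\ell_T(x)+\ell_T(x^{-1}c)=\ell_T(c)$. **Sortable elements and the map Read.** The $c$-sorting word of $w\in W$ is the subword of $c^\infty=s_{a_1}\cdots s_{a_n}|s_{a_1}\cdots s_{a_n}|\cdots$ which is a reduced expression of $w$ and whose sequence of positions in $c^\infty$ is lexicographically first. Let $w_k\subseteq S$ be the set of its letters coming from the $k$-th copy of $s_{a_1}\cdots s_{a_n}$. The element $w$ is $c$-sortable if $w_{k+1}\subseteq w_k$ for all $k\geq 1$; let ${\sf Sort}_c$ be the set of $c$-sortable elements. Let $s_{i_1}\cdots s_{i_m}$ be the $c$-sorting word of $w$, and order the set of left inversions of $w$ as $r_1,\dots,r_m$,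 where $r_j=s_{i_1}\cdots s_{i_{j-1}}s_{i_j}s_{i_{j-1}}\cdots s_{i_1}$. The cover reflections of $w$ are the elements $wsw^{-1}$ with $s\in S$ and $\ell(ws)<\ell(w)$. Then ${\sf Read}(w)$ is the product $t_1t_2\cdots t_k$ of the cover reflections of $w$, taken in the order in which they appear in $r_1,\dots,r_m$. **The diagram of $x$.** The element $c$ is an $(n+1)$-cycle $(i_1,i_2,\dots,i_{n+1})$ with $i_1=1$; let $i_k=n+1$. Place the labels $1,\dots,n+1$ on a circle at equally spaced heights, $1$ at the top, $n+1$ at the bottom, and $i$ higher than $j$ whenever $i<j$; the labels $i_1,\dots,i_k$ lie on the right and the other ones on the left. The polygons of $x\in{\sf NC}(\mathfrak S_{n+1},c)$ are the convex hulls of the supports of the cycles of $x$ (fixed points included). A polygon $Q$ lies strictly at the right of a polygon $P$ if some horizontal line $L$ meets both of them and $L\cap P$ is at the left of $L\cap Q$. **The permutation $S_c(x)$.** Order the polygons of $x$ as follows: among the polygons that have no polygon strictly at their right take the one whose biggest label is minimal, remove it, and repeat this with the remaining polygons until none is left. Write the polygons one after the other in this order, the labels of each polygon in decreasing order; $S_c(x)$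 is the permutation with this line notation. **Theorem.** For every $x\in{\sf NC}(\mathfrak S_{n+1},c)$ the above procedure determines a unique total order on the polygons of $x$ and hence a permutation $S_c(x)$, the permutation $S_c(x)$ is $c$-sortable, and ${\sf Read}(S_c(x))=x$. Moreover, ${\sf Read}$ is a bijection from ${\sf Sort}_c$ onto ${\sf NC}(\mathfrak S_{n+1},c)$, and its inverse is $S_c$, that is, $S_c={\sf Read}^{-1}$. -/

import Mathlib

noncomputable section

namespace CoxeterSortable

section General

variable {W ι : Type*} [Group W]

/-- Length of `g` with respect to a set `A` of group elements: the least length of a word in the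
elements of `A` with product `g`. -/
def wordLength (A : Set W) (g : W) : ℕ :=
  sInf {k | ∃ l : List W, (∀ t ∈ l, t ∈ A) ∧ l.prod = g ∧ l.length = k}

/- From here on, `s` is the family of simple reflections of `W`. -/

/-- The length function with respect to the simple reflections. -/
def length (s : ι → W) (w : W) : ℕ := wordLength (Set.range s) w

/-- The set of reflections: all conjugates of simple reflections. -/
def reflections (s : ι → W) : Set W := {t | ∃ (w : W) (i : ι), t = w * s i * w⁻¹}

/-- Reflection length. -/
def reflLength (s : ι → W) (w : W) : ℕ := wordLength (reflections s) w

/-- The absolute order. -/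
def AbsLE (s : ι → W) (u v : W) : Prop :=
  reflLength s u + reflLength s (u⁻¹ * v) = reflLength s v

/-- The noncrossing partitions attached to `c`. -/
def NC (s : ι → W) (c : W) : Set W := {x | AbsLE s x c}

/-- The element of `W` represented by a word in the simple reflections. -/
def wordProd (s : ι → W) (ω : List ι) : W := (ω.map s).prod

/-- `ω` is a reduced expression of `w`. -/
def IsReducedWord (s : ι → W) (w : W) (ω : List ι) : Prop :=
  wordProd s ω = w ∧ ω.length = length s w

/-- The standard Coxeter element `s (a 0) * s (a 1) * ⋯ * s (a (n - 1))`: the product of all simple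
reflections in the order `a`. -/
def coxeterElement {n : ℕ} (s : ι → W) (a : Fin n ≃ ι) : W := wordProd s (List.ofFn a)

/-- A position in the half-infinite word `a | a | a | ⋯`: the pair `(k, j)` is the `j`-th letter of
the `k`-th copy of `a`. The positions are ordered lexicographically, that is, from left to right. -/
abbrev Position (n : ℕ) : Type := ℕ ×ₗ Fin n

/-- The letters that stand at the positions of the list `p`. -/
def letters {n : ℕ} (a : Fin n ≃ ι) (p : List (Position n)) : List ι :=
  p.map fun q => a (ofLex q).2

/-- `p` is the list of the positions, from left to right, of a subword of `a | a | a | ⋯` which is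
a reduced expression of `w`. -/
def IsReducedSubword {n : ℕ} (s : ι → W) (a : Fin n ≃ ι) (w : W) (p : List (Position n)) : Prop :=
  p.Pairwise (· < ·) ∧ IsReducedWord s w (letters a p)

/-- `p` is the list of positions of the sorting word of `w`: the lexicographically first subword
of `a | a | a | ⋯` which is a reduced expression of `w`. -/
def IsSortingWord {n : ℕ} (s : ι → W) (a : Fin n ≃ ι) (w : W) (p : List (Position n)) : Prop :=
  IsReducedSubword s a w p ∧ ∀ q, IsReducedSubword s a w q → p ≤ q

/-- The list of positions of the sorting word of `w`. -/
def sortingWord {n : ℕ} (s : ι → W) (a : Fin n ≃ ι) (w : W) : List (Position n) :=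
  Classical.epsilon (IsSortingWord s a w)

/-- The set of letters of the sorting word of `w` that come from the `k`-th copy of `a`. -/
def block {n : ℕ} (s : ι → W) (a : Fin n ≃ ι) (w : W) (k : ℕ) : Set ι :=
  {i | ∃ q ∈ sortingWord s a w, (ofLex q).1 = k ∧ a (ofLex q).2 = i}

/-- The `c`-sortable elements of `W`, where `c` is the Coxeter element with reduced word `a`. -/
def SortableElements {n : ℕ} (s : ι → W) (a : Fin n ≃ ι) : Set W :=
  {w | ∀ k, block s a w (k + 1) ⊆ block s a w k}

/-- For the word `s₁ s₂ ⋯ s_ℓ`, the list whose `j`-th entry is `s₁ s₂ ⋯ s_j s_(j-1) ⋯ s₁`. -/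
def inversionList (s : ι → W) (ω : List ι) : List W :=
  (List.range ω.length).map fun j => wordProd s (ω.take (j + 1)) * wordProd s (ω.take j).reverse

/-- The cover reflections of `w`: the `w s w⁻¹` for the right descents `s` of `w`. -/
def Cov (s : ι → W) (w : W) : Set W :=
  {t | ∃ i, length s (w * s i) < length s w ∧ t = w * s i * w⁻¹}

open Classical in
/-- Reading's map: the product of the cover reflections of `w`, in the order in which they appear
in the inversion list of the sorting word of `w`. -/
def Read {n : ℕ} (s : ι → W) (a : Fin n ≃ ι) (w : W) : W :=
  ((inversionList s (letters a (sortingWord s a w))).filter fun t => t ∈ Cov s w).prod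

/-- The sorting word exists for every element of a group generated as a monoid by the `s i`. -/
theorem sortingWord_spec {n : ℕ} (s : ι → W) (a : Fin n ≃ ι)
    (hs : Submonoid.closure (Set.range s) = ⊤) (w : W) :
    IsSortingWord s a w (sortingWord s a w) := by
  have key : ∀ (k : ℕ) (S : Set (List (Position n))), S.Nonempty → (∀ p ∈ S, p.length = k) →
      ∃ p ∈ S, ∀ q ∈ S, p ≤ q := by
    intro k
    induction k with
    | zero =>
      rintro S ⟨p, hp⟩ hS
      refine ⟨p, hp, fun q hq => ?_⟩
      rw [List.length_eq_zero_iff.1 (hS p hp), List.length_eq_zero_iff.1 (hS q hq)]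
    | succ k ih =>
      rintro S ⟨p, hp⟩ hS
      have hne : {x : Position n | ∃ t, x :: t ∈ S}.Nonempty := by
        cases p with
        | nil => simpa using hS _ hp
        | cons x t => exact ⟨x, t, hp⟩
      obtain ⟨x, ⟨t₀, ht₀⟩, hx⟩ := (wellFounded_lt (α := Position n)).has_min _ hne
      obtain ⟨t, ht, hmin⟩ := ih {t | x :: t ∈ S} ⟨t₀, ht₀⟩ fun t ht => by
        simpa using hS _ ht
      refine ⟨x :: t, ht, fun q hq => ?_⟩
      cases q with
      | nil => simpa using hS _ hq
      | cons y u =>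
        rcases lt_or_eq_of_le (not_lt.1 (hx y ⟨u, hq⟩)) with h | h
        · exact le_of_lt (List.Lex.rel h)
        · subst h
          rcases lt_or_eq_of_le (hmin u hq) with h | h
          · exact le_of_lt (List.Lex.cons h)
          · rw [h]
  have hne : {p | IsReducedSubword s a w p}.Nonempty := by
    have hw : {k | ∃ l : List W, (∀ t ∈ l, t ∈ Set.range s) ∧ l.prod = w ∧ l.length = k}.Nonempty := by
      obtain ⟨l, hl, hl'⟩ := Submonoid.exists_list_of_mem_closure
        (show w ∈ Submonoid.closure (Set.range s) by rw [hs]; trivial)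
      exact ⟨_, l, hl, hl', rfl⟩
    obtain ⟨l, hl, hl', hlen⟩ := Nat.sInf_mem hw
    obtain ⟨ω, rfl⟩ : ∃ ω : List ι, ω.map s = l := by
      have h : l ∈ Set.range (List.map s) := by rw [Set.range_list_map]; exact hl
      exact h
    refine ⟨(ω.zipIdx).map fun z => toLex (z.2, a.symm z.1), ?_, ?_, ?_⟩
    · rw [List.pairwise_iff_getElem]
      intro i j hi hj hij
      simp only [List.getElem_map, List.getElem_zipIdx]
      exact Prod.Lex.toLex_lt_toLex.2 (Or.inl (by simpa using hij))
    · have : letters a ((ω.zipIdx).map fun z => toLex (z.2, a.symm z.1)) = ω := by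
        simp [letters, Function.comp_def]
      rw [this]; exact hl'
    · rw [letters, List.length_map, List.length_map, List.length_zipIdx, length, wordLength, ← hlen,
        List.length_map]
  obtain ⟨p, hp, hmin⟩ := key (length s w) {p | IsReducedSubword s a w p} hne
    fun p hp => by simpa [letters] using hp.2.2
  exact Classical.epsilon_spec (p := IsSortingWord s a w) ⟨p, hp, hmin⟩

end General

/- Type `A_n`: the group is the symmetric group on `Fin (n + 1)`; the element `i` of `Fin (n + 1)`
stands for the label `i + 1`. -/

/-- The simple transpositions `(i, i+1)`. -/
def simpleA (n : ℕ) (i : Fin n) : Equiv.Perm (Fin (n + 1)) := Equiv.swap i.castSucc i.succ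

/-- The labels on the right: if `c = (i₁, …, i_(n+1))` with `i₁` the smallest label and `i_k` the
biggest one, this is the set `{i₁, …, i_k}`. -/
def rightLabels {n : ℕ} (c : Equiv.Perm (Fin (n + 1))) : Set (Fin (n + 1)) :=
  {i | ∃ m : ℕ, (c ^ m) 0 = i ∧ ∀ m' < m, (c ^ m') 0 ≠ Fin.last n}

open Classical in
/-- The point of the unit circle labeled `i`: the heights of the points are equally spaced and
decrease from `1` to `-1`, and the point lies on the right or on the left of the circle. -/
def point {n : ℕ} (c : Equiv.Perm (Fin (n + 1))) (i : Fin (n + 1)) : ℝ × ℝ :=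
  let y : ℝ := 1 - 2 * (i : ℝ) / n
  (if i ∈ rightLabels c then √(1 - y ^ 2) else -√(1 - y ^ 2), y)

/-- The region of the plane which is the polygon with vertex set `P`. -/
def region {n : ℕ} (c : Equiv.Perm (Fin (n + 1))) (P : Finset (Fin (n + 1))) : Set (ℝ × ℝ) :=
  convexHull ℝ (point c '' P)

/-- `Q` lies strictly at the right of `P`: some horizontal line meets both polygons, and its
intersection with `P` is at the left of its intersection with `Q`. -/
def StrictlyRight {n : ℕ} (c : Equiv.Perm (Fin (n + 1))) (Q P : Finset (Fin (n + 1))) : Prop :=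
  ∃ h : ℝ, (∃ u, (u, h) ∈ region c P) ∧ (∃ v, (v, h) ∈ region c Q) ∧
    ∀ u v, (u, h) ∈ region c P → (v, h) ∈ region c Q → u < v

/-- The (vertex sets of the) polygons of `x`: the supports of its cycles, fixed points included. -/
def Pol {n : ℕ} (x : Equiv.Perm (Fin (n + 1))) : Finset (Finset (Fin (n + 1))) :=
  Finset.univ.image fun i => Finset.univ.filter fun j => x.SameCycle i j

/-- Among the polygons in `A`, no one lies strictly at the right of `P`. -/
def Free {n : ℕ} (c : Equiv.Perm (Fin (n + 1))) (A : Finset (Finset (Fin (n + 1))))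
    (P : Finset (Fin (n + 1))) : Prop :=
  P ∈ A ∧ ∀ Q ∈ A, Q ≠ P → ¬ StrictlyRight c Q P

/-- `P` is the polygon of `A` to be taken first. -/
def IsFirst {n : ℕ} (c : Equiv.Perm (Fin (n + 1))) (A : Finset (Finset (Fin (n + 1))))
    (P : Finset (Fin (n + 1))) : Prop :=
  Free c A P ∧ ∀ Q, Free c A Q → P.max ≤ Q.max

/-- The list is obtained by repeatedly taking the first polygon and removing it. -/
inductive IsPolygonOrder {n : ℕ} (c : Equiv.Perm (Fin (n + 1))) :
    Finset (Finset (Fin (n + 1))) → List (Finset (Fin (n + 1))) → Prop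
  | nil : IsPolygonOrder c ∅ []
  | cons {A : Finset (Finset (Fin (n + 1)))} {P : Finset (Fin (n + 1))}
      {l : List (Finset (Fin (n + 1)))} :
      IsFirst c A P → IsPolygonOrder c (A.erase P) l → IsPolygonOrder c A (P :: l)

/-- The line notation of `w` is obtained by writing the polygons of `x` one after the other in
their order, the vertices of each polygon being written in decreasing order. -/
def IsSc {n : ℕ} (c x w : Equiv.Perm (Fin (n + 1))) : Prop :=
  ∃ l : List (Finset (Fin (n + 1))), IsPolygonOrder c (Pol x) l ∧
    List.ofFn w = l.flatMap fun P => P.sort (· ≥ ·)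

/-- The permutation `S_c(x)`. -/
def Sc {n : ℕ} (c x : Equiv.Perm (Fin (n + 1))) : Equiv.Perm (Fin (n + 1)) :=
  Classical.epsilon (IsSc c x)

end CoxeterSortable

end

/-!
Everything is governed by the set `R` of the labels on the right side of the circle. Traversing the
circle clockwise orders the labels cyclically (`key`, `Arc`), and `c` is the rotation which sends
each label to the next one (`IsSide.isRotation`). Write the letter `s_k` for the transposition of
the labels `k` and `k + 1`. Apart from the smallest and the biggest label, `k` lies on the right
exactly if `s_(k-1)` comes before `s_k` in the word of `c`.

*Sortable elements.* They are the permutations `w` avoiding, in line notation, each pattern `312`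
whose `2` is on the right and each pattern `231` whose `2` is on the left (`Aligned`). Moreover
`Read w` is then the permutation which rotates each descending run of `w` clockwise (`Rotates`).
Both facts are proved together by removing the first letter `s` from the infinite word
(`sortable_iff_aligned_and_rotates`). If `s` is a left descent of `w`, it is the first letter of the
sorting word and one passes to `s w`. Otherwise it is skipped; then `w` is sortable only if it lies
in the parabolic subgroup without `s`, and this is also what being aligned forces. In both cases
removing `s` exchanges the sides of the two labels that `s` transposes (`Flip`).

*Noncrossing partitions.* Multiplication by a transposition merges or splits cycles, so `ℓ_T` is
`n + 1` minus the number of cycles (`reflLength_add_cycleCount`). Hence `x` belongs to `NC` exactly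
if its cycles are traversed clockwise and do not cross (`noncrossing_of_mem_NC`,
`mem_NC_of_noncrossing`).

*Polygons.* For noncrossing polygons, being strictly at the right can be read off the heights and
the sides of the vertices (`strictlyRight_iff`), since the line through two neighbouring vertices of
one polygon separates it from the other one. Some polygon always has nothing at its right
(`exists_free`), hence the order exists and is unique. A polygon taken later than `P` is never at
the right of `P`, and of two consecutive polygons the first one ends with a label smaller than the
one the second one begins with. Hence the descending runs of `S_c(x)` are the polygons of `x`
(`IsSc.runRel_iff`) and `S_c(x)` is aligned (`IsSc.aligned`). As `x` rotates its polygons,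
`Read (S_c(x)) = x`.

*The bijection.* The runs of an aligned permutation do not cross, so `Read` maps into `NC`
(`Aligned.noncrossing`). An aligned permutation is determined by its descending runs
(`Aligned.eq`), which are the cycles of `Read w`; therefore `S_c (Read w) = w`.
-/

noncomputable section

namespace CoxeterSortable

/-! ### Word lengths -/

section WordLength

variable {W : Type*} [Group W] {A : Set W}

theorem wordLength_prod_le {l : List W} (hl : ∀ t ∈ l, t ∈ A) :
    wordLength A l.prod ≤ l.length :=
  Nat.sInf_le ⟨l, hl, rfl, rfl⟩

theorem exists_word_of_potential {f : W → ℕ} (hA : ∀ t ∈ A, t * t = 1)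
    (hdesc : ∀ w, w ≠ 1 → ∃ t ∈ A, f (t * w) + 1 = f w) (h1 : f 1 = 0) (w : W) :
    ∃ l : List W, (∀ t ∈ l, t ∈ A) ∧ l.prod = w ∧ l.length = f w := by
  induction hk : f w generalizing w with
  | zero =>
    by_cases hw : w = 1
    · exact ⟨[], by simp, by simp [hw], rfl⟩
    · obtain ⟨t, -, ht⟩ := hdesc w hw
      omega
  | succ k ih =>
    have hw : w ≠ 1 := by rintro rfl; omega
    obtain ⟨t, htA, ht⟩ := hdesc w hw
    obtain ⟨l, hl, hp, hlen⟩ := ih (t * w) (by omega)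
    refine ⟨t :: l, ?_, ?_, by simp [hlen]⟩
    · rintro u hu
      rcases List.mem_cons.1 hu with rfl | hu
      exacts [htA, hl u hu]
    · rw [List.prod_cons, hp, ← mul_assoc, hA t htA, one_mul]

/-- A function `f` with `f 1 = 0` which grows by at most one under multiplication by a generator,
and which some generator lowers by one at every `w ≠ 1`, is the word length. -/
theorem wordLength_eq_of_potential {f : W → ℕ} (hA : ∀ t ∈ A, t * t = 1)
    (hdesc : ∀ w, w ≠ 1 → ∃ t ∈ A, f (t * w) + 1 = f w) (h1 : f 1 = 0)
    (hle : ∀ t ∈ A, ∀ w, f (t * w) ≤ f w + 1) (w : W) : wordLength A w = f w := by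
  obtain ⟨l, hl, hp, hlen⟩ := exists_word_of_potential hA hdesc h1 w
  refine le_antisymm ?_ ?_
  · rw [← hlen, ← hp]; exact wordLength_prod_le hl
  · refine le_csInf ⟨_, l, hl, hp, rfl⟩ ?_
    rintro k ⟨l', hl', rfl, rfl⟩
    clear hp hlen
    induction l' with
    | nil => simp [h1]
    | cons t l' ih =>
      have := hle t (hl' t (by simp)) l'.prod
      have := ih fun u hu => hl' u (by simp [hu])
      simp only [List.prod_cons, List.length_cons]
      omega

end WordLength

/-! ### The length function of the symmetric group -/

variable {n : ℕ}

theorem simpleA_mul_self (i : Fin n) : simpleA n i * simpleA n i = 1 :=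
  Equiv.swap_mul_self _ _

theorem simpleA_mul_cancel (i : Fin n) (w : Equiv.Perm (Fin (n + 1))) :
    simpleA n i * (simpleA n i * w) = w := by
  rw [← mul_assoc, simpleA_mul_self, one_mul]

theorem simpleA_inv (i : Fin n) : (simpleA n i)⁻¹ = simpleA n i := Equiv.swap_inv _ _

@[simp] theorem simpleA_castSucc (i : Fin n) : simpleA n i i.castSucc = i.succ :=
  Equiv.swap_apply_left _ _

@[simp] theorem simpleA_succ (i : Fin n) : simpleA n i i.succ = i.castSucc :=
  Equiv.swap_apply_right _ _

theorem simpleA_of_ne {i : Fin n} {x : Fin (n + 1)} (h : x ≠ i.castSucc) (h' : x ≠ i.succ) :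
    simpleA n i x = x := Equiv.swap_apply_of_ne_of_ne h h'

theorem simpleA_invol (i : Fin n) (x : Fin (n + 1)) : simpleA n i (simpleA n i x) = x :=
  Equiv.swap_apply_self _ _ _

/-- A simple transposition keeps the order of all pairs but one. -/
theorem simpleA_lt_iff (i : Fin n) {x y : Fin (n + 1)}
    (h : ¬(x = i.castSucc ∧ y = i.succ)) (h' : ¬(x = i.succ ∧ y = i.castSucc)) :
    simpleA n i x < simpleA n i y ↔ x < y := by
  have key : ∀ z : Fin (n + 1), (z = i.castSucc ∧ simpleA n i z = i.succ) ∨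
      (z = i.succ ∧ simpleA n i z = i.castSucc) ∨
      (z ≠ i.castSucc ∧ z ≠ i.succ ∧ simpleA n i z = z) := by
    intro z
    by_cases h1 : z = i.castSucc
    · exact Or.inl ⟨h1, by rw [h1]; simp⟩
    · by_cases h2 : z = i.succ
      · exact Or.inr (Or.inl ⟨h2, by rw [h2]; simp⟩)
      · exact Or.inr (Or.inr ⟨h1, h2, simpleA_of_ne h1 h2⟩)
  rcases key x with ⟨hx, hx'⟩ | ⟨hx, hx'⟩ | ⟨hx, hx1, hx'⟩ <;>
  rcases key y with ⟨hy, hy'⟩ | ⟨hy, hy'⟩ | ⟨hy, hy1, hy'⟩ <;>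
  simp only [hx', hy', Fin.lt_def, Fin.ext_iff, Fin.val_castSucc, Fin.val_succ, ne_eq] at * <;>
  omega

/-- The inversions of `w`, as pairs of positions. -/
def inversions (w : Equiv.Perm (Fin (n + 1))) : Finset (Fin (n + 1) × Fin (n + 1)) :=
  Finset.univ.filter fun z => z.1 < z.2 ∧ w z.2 < w z.1

theorem mem_inversions {w : Equiv.Perm (Fin (n + 1))} {p q : Fin (n + 1)} :
    (p, q) ∈ inversions w ↔ p < q ∧ w q < w p := by
  simp [inversions]

theorem card_inversions_mul_simpleA {w : Equiv.Perm (Fin (n + 1))} {i : Fin n}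
    (h : w i.castSucc < w i.succ) :
    (inversions (w * simpleA n i)).card = (inversions w).card + 1 := by
  have h0 : (i.castSucc, i.succ) ∉ (inversions w).image
      (fun z => (simpleA n i z.1, simpleA n i z.2)) := by
    simp only [Finset.mem_image, Prod.exists, mem_inversions, Prod.mk.injEq, not_exists, not_and]
    rintro p q ⟨h1, -⟩ hp hq
    have hp' : p = i.succ := by rw [← simpleA_invol i p, hp]; simp
    have hq' : q = i.castSucc := by rw [← simpleA_invol i q, hq]; simp
    subst hp' hq'
    exact absurd h1 (not_lt.2 i.castSucc_lt_succ.le)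
  have key : inversions (w * simpleA n i) = insert (i.castSucc, i.succ)
      ((inversions w).image fun z => (simpleA n i z.1, simpleA n i z.2)) := by
    ext ⟨p, q⟩
    simp only [Finset.mem_insert, Finset.mem_image, Prod.mk.injEq, Prod.exists, mem_inversions,
      Equiv.Perm.mul_apply]
    by_cases hpq : p = i.castSucc ∧ q = i.succ
    · obtain ⟨rfl, rfl⟩ := hpq
      simp [h, i.castSucc_lt_succ]
    · simp only [hpq, false_or]
      constructor
      · rintro ⟨h1, h2⟩
        refine ⟨simpleA n i p, simpleA n i q, ⟨?_, h2⟩, simpleA_invol i p, simpleA_invol i q⟩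
        rwa [simpleA_lt_iff i hpq]
        rintro ⟨rfl, rfl⟩
        exact absurd h1 (not_lt.2 i.castSucc_lt_succ.le)
      · rintro ⟨a, b, ⟨h1, h2⟩, rfl, rfl⟩
        rw [simpleA_invol, simpleA_invol]
        refine ⟨?_, h2⟩
        rwa [simpleA_lt_iff i]
        · rintro ⟨rfl, rfl⟩
          exact absurd h2 (not_lt.2 h.le)
        · rintro ⟨rfl, rfl⟩
          exact absurd h1 (not_lt.2 i.castSucc_lt_succ.le)
  rw [key, Finset.card_insert_of_notMem h0, Finset.card_image_of_injective]
  rintro ⟨a, b⟩ ⟨a', b'⟩ hab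
  simpa using hab

theorem card_inversions_mul_simpleA' {w : Equiv.Perm (Fin (n + 1))} {i : Fin n}
    (h : w i.succ < w i.castSucc) :
    (inversions (w * simpleA n i)).card + 1 = (inversions w).card := by
  have := card_inversions_mul_simpleA (w := w * simpleA n i) (i := i) (by simpa using h)
  rw [mul_assoc, simpleA_mul_self, mul_one] at this
  exact this.symm

theorem card_inversions_inv (w : Equiv.Perm (Fin (n + 1))) :
    (inversions w⁻¹).card = (inversions w).card := by
  refine Finset.card_bij' (fun z _ => (w⁻¹ z.2, w⁻¹ z.1)) (fun z _ => (w z.2, w z.1)) ?_ ?_ ?_ ?_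
    <;> simp +contextual [inversions]

theorem simpleA_mul_eq (w : Equiv.Perm (Fin (n + 1))) (i : Fin n) :
    simpleA n i * w = (w⁻¹ * simpleA n i)⁻¹ := by
  rw [mul_inv_rev, inv_inv, simpleA_inv]

theorem castSucc_lt_or_succ_lt (w : Equiv.Perm (Fin (n + 1))) (i : Fin n) :
    w i.castSucc < w i.succ ∨ w i.succ < w i.castSucc :=
  lt_or_gt_of_ne fun h => i.castSucc_lt_succ.ne (w.injective h)

theorem exists_descent {w : Equiv.Perm (Fin (n + 1))} (hw : w ≠ 1) :
    ∃ i : Fin n, w i.succ < w i.castSucc := by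
  by_contra! h
  apply hw
  have hmono : StrictMono w := Fin.strictMono_iff_lt_succ.2 fun i =>
    (castSucc_lt_or_succ_lt w i).resolve_right (not_lt.2 (h i))
  ext x
  have h2 : (hmono.orderIsoOfSurjective w w.surjective) = OrderIso.refl _ := Subsingleton.elim _ _
  have h3 := congrArg (fun e => (e x : Fin (n + 1))) h2
  simpa using congrArg Fin.val h3

theorem length_eq_card_inversions (w : Equiv.Perm (Fin (n + 1))) :
    length (simpleA n) w = (inversions w).card := by
  refine wordLength_eq_of_potential (f := fun w => (inversions w).card) ?_ ?_ ?_ ?_ w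
  · rintro _ ⟨i, rfl⟩; exact simpleA_mul_self i
  · intro w hw
    obtain ⟨i, hi⟩ := exists_descent (w := w⁻¹) (by simpa using hw)
    refine ⟨_, ⟨i, rfl⟩, ?_⟩
    simp only [simpleA_mul_eq, card_inversions_inv]
    rw [card_inversions_mul_simpleA' hi, card_inversions_inv]
  · simp only [inversions, Finset.card_eq_zero, Finset.filter_eq_empty_iff]
    intro z _ h
    exact lt_asymm h.1 h.2
  · rintro _ ⟨i, rfl⟩ w
    simp only [simpleA_mul_eq, card_inversions_inv]
    rcases castSucc_lt_or_succ_lt w⁻¹ i with h | h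
    · rw [card_inversions_mul_simpleA h, card_inversions_inv]
    · have := card_inversions_mul_simpleA' h
      rw [card_inversions_inv] at this
      omega

theorem length_mul_simpleA_lt_iff {w : Equiv.Perm (Fin (n + 1))} {i : Fin n} :
    length (simpleA n) (w * simpleA n i) < length (simpleA n) w ↔ w i.succ < w i.castSucc := by
  rw [length_eq_card_inversions, length_eq_card_inversions]
  rcases castSucc_lt_or_succ_lt w i with h | h
  · rw [card_inversions_mul_simpleA h]
    simp [h.le]
  · rw [← card_inversions_mul_simpleA' h]
    simp [h]

theorem length_simpleA_mul_of_lt {w : Equiv.Perm (Fin (n + 1))} {i : Fin n}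
    (h : w⁻¹ i.castSucc < w⁻¹ i.succ) :
    length (simpleA n) (simpleA n i * w) = length (simpleA n) w + 1 := by
  rw [length_eq_card_inversions, length_eq_card_inversions, simpleA_mul_eq, card_inversions_inv,
    card_inversions_mul_simpleA h, card_inversions_inv]

theorem length_simpleA_mul_of_gt {w : Equiv.Perm (Fin (n + 1))} {i : Fin n}
    (h : w⁻¹ i.succ < w⁻¹ i.castSucc) :
    length (simpleA n) (simpleA n i * w) + 1 = length (simpleA n) w := by
  rw [length_eq_card_inversions, length_eq_card_inversions, simpleA_mul_eq, card_inversions_inv,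
    card_inversions_mul_simpleA' h, card_inversions_inv]

theorem length_simpleA_mul_le (w : Equiv.Perm (Fin (n + 1))) (i : Fin n) :
    length (simpleA n) (simpleA n i * w) ≤ length (simpleA n) w + 1 := by
  rcases castSucc_lt_or_succ_lt w⁻¹ i with h | h
  · exact (length_simpleA_mul_of_lt h).le
  · have := length_simpleA_mul_of_gt h
    omega

theorem length_one : length (simpleA n) 1 = 0 := by
  have := wordLength_prod_le (A := Set.range (simpleA n)) (l := []) (by simp)
  simpa [length] using this

theorem closure_range_simpleA : Submonoid.closure (Set.range (simpleA n)) = ⊤ := by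
  refine eq_top_iff.2 fun w _ => ?_
  have hdesc : ∀ w, w ≠ 1 → ∃ t ∈ Set.range (simpleA n),
      length (simpleA n) (t * w) + 1 = length (simpleA n) w := by
    intro w hw
    obtain ⟨i, hi⟩ := exists_descent (w := w⁻¹) (by simpa using hw)
    exact ⟨_, ⟨i, rfl⟩, length_simpleA_mul_of_gt hi⟩
  obtain ⟨l, hl, hp, -⟩ := exists_word_of_potential
    (by rintro _ ⟨i, rfl⟩; exact simpleA_mul_self i) hdesc length_one w
  rw [← hp]
  exact Submonoid.list_prod_mem _ fun t ht => Submonoid.subset_closure (hl t ht)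

/-- The line notation of `w` has a descent at position `i` exactly if the corresponding
transposition of values is a cover reflection. -/
theorem mem_Cov_iff {w t : Equiv.Perm (Fin (n + 1))} :
    t ∈ Cov (simpleA n) w ↔
      ∃ i : Fin n, w i.succ < w i.castSucc ∧ t = Equiv.swap (w i.castSucc) (w i.succ) := by
  simp only [Cov, Set.mem_ofPred_eq, length_mul_simpleA_lt_iff, Equiv.swap_apply_apply]
  rfl

/-! ### Sorting words -/

theorem list_cons_le_cons_iff {α : Type*} [LinearOrder α] {a b : α} {l₁ l₂ : List α} :
    a :: l₁ ≤ b :: l₂ ↔ a < b ∨ a = b ∧ l₁ ≤ l₂ := by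
  rw [← not_lt, ← not_lt, List.cons_lt_cons_iff]
  rcases lt_trichotomy a b with h | h | h
  · simp [h, h.not_gt, h.ne']
  · simp [h]
  · simp [h, h.not_gt, h.ne']

theorem list_map_le_map {α β : Type*} [LinearOrder α] [LinearOrder β] {l₁ l₂ : List α}
    {f : α → β} (hf : ∀ x y, x < y → f x < f y) (h : l₁ ≤ l₂) : l₁.map f ≤ l₂.map f := by
  rcases h.eq_or_lt with rfl | h
  · exact le_rfl
  · exact le_of_lt (List.map_lt hf h)

theorem perm_apply_inv_apply {α : Type*} (w : Equiv.Perm α) (x : α) : w (w⁻¹ x) = x :=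
  Equiv.apply_symm_apply w x

theorem perm_inv_apply_apply {α : Type*} (w : Equiv.Perm α) (x : α) : w⁻¹ (w x) = x :=
  Equiv.symm_apply_apply w x

/-- `P` is the list of positions of the lexicographically first subword of the infinite word
`b t, b (t + 1), …` which is a reduced expression of `w`. -/
structure IsMinWord (b : ℕ → Fin n) (t : ℕ) (w : Equiv.Perm (Fin (n + 1))) (P : List ℕ) :
    Prop where
  sorted : P.Pairwise (· < ·)
  ge : ∀ m ∈ P, t ≤ m
  reduced : IsReducedWord (simpleA n) w (P.map b)
  min : ∀ Q : List ℕ, Q.Pairwise (· < ·) → (∀ m ∈ Q, t ≤ m) →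
    IsReducedWord (simpleA n) w (Q.map b) → P ≤ Q

theorem wordProd_cons (i : Fin n) (ω : List (Fin n)) :
    wordProd (simpleA n) (i :: ω) = simpleA n i * wordProd (simpleA n) ω := by
  simp [wordProd]

theorem length_wordProd_le (ω : List (Fin n)) :
    length (simpleA n) (wordProd (simpleA n) ω) ≤ ω.length := by
  have := wordLength_prod_le (A := Set.range (simpleA n)) (l := ω.map (simpleA n))
    (by rintro t ht; obtain ⟨i, -, rfl⟩ := List.mem_map.1 ht; exact ⟨i, rfl⟩)
  simpa [wordProd, length] using this

theorem isReducedWord_cons_iff {w : Equiv.Perm (Fin (n + 1))} {i : Fin n} {ω : List (Fin n)} :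
    IsReducedWord (simpleA n) w (i :: ω) ↔
      w⁻¹ i.succ < w⁻¹ i.castSucc ∧ IsReducedWord (simpleA n) (simpleA n i * w) ω := by
  constructor
  · rintro ⟨h1, h2⟩
    have h3 : wordProd (simpleA n) ω = simpleA n i * w := by
      rw [← h1, wordProd_cons, simpleA_mul_cancel]
    have h4 := length_wordProd_le ω
    rw [h3] at h4
    rw [List.length_cons] at h2
    rcases castSucc_lt_or_succ_lt w⁻¹ i with h | h
    · have := length_simpleA_mul_of_lt h
      omega
    · have := length_simpleA_mul_of_gt h
      exact ⟨h, h3, by omega⟩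
  · rintro ⟨h, h1, h2⟩
    refine ⟨by rw [wordProd_cons, h1, simpleA_mul_cancel], ?_⟩
    rw [List.length_cons, h2, length_simpleA_mul_of_gt h]

theorem exists_isReducedWord (w : Equiv.Perm (Fin (n + 1))) :
    ∃ ω, IsReducedWord (simpleA n) w ω := by
  induction hk : length (simpleA n) w generalizing w with
  | zero =>
    refine ⟨[], ?_, by simp [hk]⟩
    by_contra h
    obtain ⟨i, hi⟩ := exists_descent (w := w⁻¹) (by simpa [wordProd, eq_comm] using h)
    have := length_simpleA_mul_of_gt hi
    omega
  | succ k ih =>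
    have hw : w ≠ 1 := by rintro rfl; simp [length_one] at hk
    obtain ⟨i, hi⟩ := exists_descent (w := w⁻¹) (by simpa using hw)
    obtain ⟨ω, hω⟩ := ih (simpleA n i * w) (by have := length_simpleA_mul_of_gt hi; omega)
    exact ⟨i :: ω, isReducedWord_cons_iff.2 ⟨hi, hω⟩⟩

theorem exists_positions {b : ℕ → Fin n} (hb : ∀ t i, ∃ m, t ≤ m ∧ b m = i) (ω : List (Fin n))
    (t : ℕ) : ∃ Q : List ℕ, Q.Pairwise (· < ·) ∧ (∀ m ∈ Q, t ≤ m) ∧ Q.map b = ω := by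
  induction ω generalizing t with
  | nil => exact ⟨[], by simp⟩
  | cons i ω ih =>
    obtain ⟨m, hm, hi⟩ := hb t i
    obtain ⟨Q, h1, h2, h3⟩ := ih (m + 1)
    refine ⟨m :: Q, List.pairwise_cons.2 ⟨fun k hk => h2 k hk, h1⟩, ?_, by simp [hi, h3]⟩
    intro k hk
    rcases List.mem_cons.1 hk with rfl | hk
    exacts [hm, by have := h2 k hk; omega]

/-- If the letter at time `t` is a left descent of `w`, the first reduced subword uses it. -/
theorem IsMinWord.eq_cons {b : ℕ → Fin n} (hb : ∀ t i, ∃ m, t ≤ m ∧ b m = i) {t : ℕ}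
    {w : Equiv.Perm (Fin (n + 1))} {P : List ℕ} (hP : IsMinWord b t w P)
    (h : w⁻¹ (b t).succ < w⁻¹ (b t).castSucc) :
    ∃ P', P = t :: P' ∧ IsMinWord b (t + 1) (simpleA n (b t) * w) P' := by
  have hcons : ∀ Q : List ℕ, Q.Pairwise (· < ·) → (∀ m ∈ Q, t + 1 ≤ m) →
      IsReducedWord (simpleA n) (simpleA n (b t) * w) (Q.map b) → P ≤ t :: Q := by
    intro Q h1 h2 h3
    refine hP.min _ (List.pairwise_cons.2 ⟨h2, h1⟩) ?_ ?_
    · intro m hm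
      rcases List.mem_cons.1 hm with rfl | hm
      exacts [le_rfl, (Nat.le_succ t).trans (h2 m hm)]
    · rw [List.map_cons]
      exact isReducedWord_cons_iff.2 ⟨h, h3⟩
  obtain ⟨ω, hω⟩ := exists_isReducedWord (simpleA n (b t) * w)
  obtain ⟨Q, hQ1, hQ2, hQ3⟩ := exists_positions hb ω (t + 1)
  have hle := hcons Q hQ1 hQ2 (by rwa [hQ3])
  have hpos := length_simpleA_mul_of_gt h
  have hlen := hP.reduced.2
  rw [List.length_map] at hlen
  cases P with
  | nil => rw [List.length_nil] at hlen; omega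
  | cons m P' =>
    have hm : m = t := by
      rcases list_cons_le_cons_iff.1 hle with h' | h'
      · have := hP.ge m (by simp)
        omega
      · exact h'.1
    subst hm
    have hs := List.pairwise_cons.1 hP.sorted
    refine ⟨P', rfl, hs.2, hs.1, ?_, ?_⟩
    · have := hP.reduced
      rw [List.map_cons, isReducedWord_cons_iff] at this
      exact this.2
    · intro Q h1 h2 h3
      rcases list_cons_le_cons_iff.1 (hcons Q h1 h2 h3) with h' | h'
      · exact absurd h' (lt_irrefl _)
      · exact h'.2

/-- If the letter at time `t` is not a left descent of `w`, no reduced subword uses it. -/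
theorem IsMinWord.succ {b : ℕ → Fin n} {t : ℕ}
    {w : Equiv.Perm (Fin (n + 1))} {P : List ℕ} (hP : IsMinWord b t w P)
    (h : w⁻¹ (b t).castSucc < w⁻¹ (b t).succ) : t ∉ P ∧ IsMinWord b (t + 1) w P := by
  have ht : t ∉ P := by
    intro ht
    cases P with
    | nil => simp at ht
    | cons m P' =>
      have hs := List.pairwise_cons.1 hP.sorted
      have hm : m = t := by
        rcases List.mem_cons.1 ht with h' | h'
        · exact h'.symm
        · have := hs.1 t h'
          have := hP.ge m (by simp)
          omega
      subst hm
      have := hP.reduced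
      rw [List.map_cons, isReducedWord_cons_iff] at this
      exact lt_asymm h this.1
  refine ⟨ht, hP.sorted, fun m hm => ?_, hP.reduced, fun Q h1 h2 => hP.min Q h1 fun m hm => ?_⟩
  · rcases (hP.ge m hm).eq_or_lt with rfl | h'
    exacts [absurd hm ht, h']
  · exact (Nat.le_succ t).trans (h2 m hm)

/-- A reduced word of a permutation which preserves the labels up to `i` does not contain `i`. -/
theorem notMem_of_preserves {i : Fin n} {ω : List (Fin n)} {w : Equiv.Perm (Fin (n + 1))}
    (hω : IsReducedWord (simpleA n) w ω) (hw : ∀ p, w p ≤ i.castSucc ↔ p ≤ i.castSucc) :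
    i ∉ ω := by
  induction ω generalizing w with
  | nil => simp
  | cons k ω ih =>
    rw [isReducedWord_cons_iff] at hω
    have hki : i ≠ k := by
      rintro rfl
      have h1 := hw (w⁻¹ i.castSucc)
      have h2 := hw (w⁻¹ i.succ)
      simp only [perm_apply_inv_apply, le_refl, true_iff] at h1 h2
      exact absurd (h2.2 (hω.1.le.trans h1)) (not_le.2 i.castSucc_lt_succ)
    rw [List.mem_cons, not_or]
    refine ⟨hki, ih hω.2 fun p => ?_⟩
    rw [← hw p, Equiv.Perm.mul_apply]
    have hki' : (i : ℕ) ≠ k := fun h => hki (Fin.ext h)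
    by_cases h1 : w p = k.castSucc
    · rw [h1, simpleA_castSucc]
      simp only [Fin.le_def, Fin.val_castSucc, Fin.val_succ]
      omega
    · by_cases h2 : w p = k.succ
      · rw [h2, simpleA_succ]
        simp only [Fin.le_def, Fin.val_castSucc, Fin.val_succ]
        omega
      · rw [simpleA_of_ne h1 h2]

theorem preserves_of_notMem {i : Fin n} {ω : List (Fin n)} (hi : i ∉ ω) (p : Fin (n + 1)) :
    wordProd (simpleA n) ω p ≤ i.castSucc ↔ p ≤ i.castSucc := by
  induction ω generalizing p with
  | nil => simp [wordProd]
  | cons k ω ih =>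
    rw [List.mem_cons, not_or] at hi
    rw [← ih hi.2 p, wordProd_cons, Equiv.Perm.mul_apply]
    have hki' : (i : ℕ) ≠ k := fun h => hi.1 (Fin.ext h)
    by_cases h1 : wordProd (simpleA n) ω p = k.castSucc
    · rw [h1, simpleA_castSucc]
      simp only [Fin.le_def, Fin.val_castSucc, Fin.val_succ]
      omega
    · by_cases h2 : wordProd (simpleA n) ω p = k.succ
      · rw [h2, simpleA_succ]
        simp only [Fin.le_def, Fin.val_castSucc, Fin.val_succ]
        omega
      · rw [simpleA_of_ne h1 h2]

/-! ### Inversion lists and cover reflections -/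

theorem inversionList_cons (i : Fin n) (ω : List (Fin n)) :
    inversionList (simpleA n) (i :: ω) = simpleA n i ::
      (inversionList (simpleA n) ω).map fun t => simpleA n i * t * simpleA n i := by
  simp only [inversionList, List.length_cons, List.range_succ_eq_map, List.map_cons, List.map_map]
  refine congrArg₂ _ (by simp [wordProd]) (List.map_congr_left fun j _ => ?_)
  simp [wordProd, mul_assoc]

theorem length_mul_lt_of_mem_inversionList {ω : List (Fin n)} {w t : Equiv.Perm (Fin (n + 1))}
    (hω : IsReducedWord (simpleA n) w ω) (ht : t ∈ inversionList (simpleA n) ω) :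
    length (simpleA n) (t * w) < length (simpleA n) w := by
  induction ω generalizing w t with
  | nil => simp [inversionList] at ht
  | cons i ω ih =>
    rw [isReducedWord_cons_iff] at hω
    have h1 := length_simpleA_mul_of_gt hω.1
    rw [inversionList_cons, List.mem_cons, List.mem_map] at ht
    rcases ht with rfl | ⟨t, ht, rfl⟩
    · omega
    · have h2 := ih hω.2 ht
      have h3 := length_simpleA_mul_le (t * (simpleA n i * w)) i
      rw [mul_assoc, mul_assoc]
      omega

open Classical in
/-- The product of the cover reflections of `w`, in the order in which they appear in the inversion
list of the word `ω`. -/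
def readProd (w : Equiv.Perm (Fin (n + 1))) (ω : List (Fin n)) : Equiv.Perm (Fin (n + 1)) :=
  ((inversionList (simpleA n) ω).filter fun t => t ∈ Cov (simpleA n) w).prod

theorem swap_conj (i : Fin n) (x y : Fin (n + 1)) :
    simpleA n i * Equiv.swap x y * simpleA n i =
      Equiv.swap (simpleA n i x) (simpleA n i y) := by
  rw [Equiv.swap_apply_apply, simpleA_inv]

/-- With `s` the first letter of a reduced word of `w`, conjugation by `s` carries the cover
reflections of `s w` which are inversions of `s w` to the cover reflections of `w` other than `s`.
-/
theorem conj_mem_Cov_iff {w t : Equiv.Perm (Fin (n + 1))} {i : Fin n} {ω : List (Fin n)}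
    (hω : IsReducedWord (simpleA n) w (i :: ω)) (ht : t ∈ inversionList (simpleA n) ω) :
    simpleA n i * t * simpleA n i ∈ Cov (simpleA n) w ↔
      t ∈ Cov (simpleA n) (simpleA n i * w) := by
  rw [isReducedWord_cons_iff] at hω
  have hne : t ≠ simpleA n i := by
    rintro rfl
    have h1 := length_mul_lt_of_mem_inversionList hω.2 ht
    have h2 := length_simpleA_mul_of_gt hω.1
    rw [simpleA_mul_cancel] at h1
    omega
  rw [mem_Cov_iff, mem_Cov_iff]
  refine exists_congr fun k => ?_
  simp only [Equiv.Perm.mul_apply]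
  have e : simpleA n i * t * simpleA n i = Equiv.swap (w k.castSucc) (w k.succ) ↔
      t = Equiv.swap (simpleA n i (w k.castSucc)) (simpleA n i (w k.succ)) := by
    rw [← swap_conj]
    constructor
    · rintro h
      rw [← h]
      simp [mul_assoc, simpleA_mul_cancel, simpleA_mul_self]
    · rintro rfl
      simp [mul_assoc, simpleA_mul_cancel, simpleA_mul_self]
  rw [e]
  refine and_congr_left fun h => ?_
  refine (simpleA_lt_iff i ?_ ?_).symm
  · rintro ⟨h1, h2⟩
    apply hne
    rw [h, h1, h2, simpleA_castSucc, simpleA_succ]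
    rfl
  · rintro ⟨h1, h2⟩
    have h1 := w.eq_symm_apply.2 h1
    have h2 := w.eq_symm_apply.2 h2
    have := hω.1
    change w.symm _ < w.symm _ at this
    rw [← h1, ← h2] at this
    exact absurd this (not_lt.2 k.castSucc_lt_succ.le)

/-- With `s` the first letter of a reduced word of `w` and `y` the product for `s w`, the product
for `w` is `s y s` or, if `s` itself is a cover reflection of `w`, it is `s (s y s) = y s`. -/
theorem readProd_cons {w : Equiv.Perm (Fin (n + 1))} {i : Fin n} {ω : List (Fin n)}
    (hω : IsReducedWord (simpleA n) w (i :: ω)) :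
    readProd w (i :: ω) = (open Classical in if simpleA n i ∈ Cov (simpleA n) w then
      readProd (simpleA n i * w) ω * simpleA n i else
      simpleA n i * readProd (simpleA n i * w) ω * simpleA n i) := by
  classical
  have h : (((inversionList (simpleA n) ω).map fun t => simpleA n i * t * simpleA n i).filter
      fun t => t ∈ Cov (simpleA n) w).prod =
      simpleA n i * readProd (simpleA n i * w) ω * simpleA n i := by
    rw [List.filter_map, readProd]
    have : (inversionList (simpleA n) ω).filter ((fun t => decide (t ∈ Cov (simpleA n) w)) ∘
        fun t => simpleA n i * t * simpleA n i) = (inversionList (simpleA n) ω).filter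
          fun t => t ∈ Cov (simpleA n) (simpleA n i * w) := by
      refine List.filter_congr fun t ht => ?_
      simpa using conj_mem_Cov_iff hω ht
    rw [this]
    have hc := (MulAut.conj (simpleA n i)).toMonoidHom.map_list_prod
      ((inversionList (simpleA n) ω).filter fun t => t ∈ Cov (simpleA n) (simpleA n i * w))
    simp only [MulEquiv.toMonoidHom_eq_coe, MonoidHom.coe_coe] at hc
    rw [MulAut.conj_apply, simpleA_inv] at hc
    rw [hc]
    refine congrArg _ (List.map_congr_left fun t _ => ?_)
    rw [MulAut.conj_apply, simpleA_inv]
  rw [readProd, inversionList_cons, List.filter_cons]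
  split_ifs with h1 h2 h2
  · rw [List.prod_cons, h, mul_assoc, simpleA_mul_cancel]
  · simp_all
  · simp_all
  · rw [h]

/-! ### The infinite word indexed by natural numbers -/

/-- The infinite word `a | a | a | ⋯`. -/
def infiniteWord (a : Equiv.Perm (Fin n)) (hn : 0 < n) (m : ℕ) : Fin n :=
  a ⟨m % n, Nat.mod_lt m hn⟩

/-- The number of letters to the left of a position of `a | a | a | ⋯`. -/
def positionIndex (q : Position n) : ℕ := n * (ofLex q).1 + (ofLex q).2

/-- The position of `a | a | a | ⋯` with exactly `m` letters to its left. -/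
def indexPosition (hn : 0 < n) (m : ℕ) : Position n := toLex (m / n, ⟨m % n, Nat.mod_lt m hn⟩)

theorem positionIndex_indexPosition (hn : 0 < n) (m : ℕ) :
    positionIndex (indexPosition hn m) = m := Nat.div_add_mod m n

theorem positionIndex_lt {p q : Position n} (h : p < q) : positionIndex p < positionIndex q := by
  have h1 := (ofLex p).2.is_lt
  have h2 := (ofLex q).2.is_lt
  rcases Prod.Lex.lt_iff.1 h with h | ⟨h, h'⟩
  · have : n * ((ofLex p).1 + 1) ≤ n * (ofLex q).1 := Nat.mul_le_mul_left n h
    unfold positionIndex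
    rw [Nat.mul_add] at this
    omega
  · unfold positionIndex
    rw [h]
    exact Nat.add_lt_add_left h' _

theorem indexPosition_lt (hn : 0 < n) {m k : ℕ} (h : m < k) :
    indexPosition hn m < indexPosition hn k := by
  rcases lt_trichotomy (indexPosition hn m) (indexPosition hn k) with h' | h' | h'
  · exact h'
  · have := congrArg positionIndex h'
    simp only [positionIndex_indexPosition] at this
    omega
  · have := positionIndex_lt h'
    simp only [positionIndex_indexPosition] at this
    omega

theorem infiniteWord_positionIndex (a : Equiv.Perm (Fin n)) (hn : 0 < n) (q : Position n) :
    infiniteWord a hn (positionIndex q) = a (ofLex q).2 := by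
  refine congrArg a (Fin.ext ?_)
  simp only [positionIndex]
  rw [Nat.mul_add_mod, Nat.mod_eq_of_lt (ofLex q).2.is_lt]

theorem map_infiniteWord (a : Equiv.Perm (Fin n)) (hn : 0 < n) (p : List (Position n)) :
    (p.map positionIndex).map (infiniteWord a hn) = letters a p := by
  rw [List.map_map, letters]
  exact List.map_congr_left fun q _ => infiniteWord_positionIndex a hn q

theorem isMinWord_sortingWord (a : Equiv.Perm (Fin n)) (hn : 0 < n)
    (w : Equiv.Perm (Fin (n + 1))) :
    IsMinWord (infiniteWord a hn) 0 w ((sortingWord (simpleA n) a w).map positionIndex) := by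
  obtain ⟨⟨h1, h2⟩, h3⟩ := sortingWord_spec (simpleA n) a closure_range_simpleA w
  refine ⟨h1.map _ fun _ _ => positionIndex_lt, fun _ _ => Nat.zero_le _,
    by rwa [map_infiniteWord], fun Q hQ1 _ hQ2 => ?_⟩
  have e : (Q.map (indexPosition hn)).map positionIndex = Q := by
    rw [List.map_map]
    exact (List.map_congr_left fun m _ => positionIndex_indexPosition hn m).trans (List.map_id _)
  rw [← e]
  refine list_map_le_map (fun _ _ => positionIndex_lt)
    (h3 (Q.map (indexPosition hn)) ⟨hQ1.map _ fun _ _ => indexPosition_lt hn, ?_⟩)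
  rwa [← map_infiniteWord a hn, e]

theorem Read_eq_readProd (a : Equiv.Perm (Fin n)) (hn : 0 < n) (w : Equiv.Perm (Fin (n + 1))) :
    Read (simpleA n) a w = readProd w
      (((sortingWord (simpleA n) a w).map positionIndex).map (infiniteWord a hn)) := by
  rw [map_infiniteWord]
  rfl

/-- Sortability says that a letter which the sorting word uses was also used one period earlier. -/
theorem mem_SortableElements_iff (a : Equiv.Perm (Fin n)) (hn : 0 < n)
    (w : Equiv.Perm (Fin (n + 1))) :
    w ∈ SortableElements (simpleA n) a ↔
      ∀ m, m + n ∈ (sortingWord (simpleA n) a w).map positionIndex →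
        m ∈ (sortingWord (simpleA n) a w).map positionIndex := by
  have hinj : Function.Injective (positionIndex (n := n)) := by
    intro p q h
    rcases lt_trichotomy p q with h' | h' | h'
    · exact absurd h (positionIndex_lt h').ne
    · exact h'
    · exact absurd h (positionIndex_lt h').ne'
  have hmem : ∀ k (j : Fin n), n * k + j ∈ (sortingWord (simpleA n) a w).map positionIndex ↔
      toLex (k, j) ∈ sortingWord (simpleA n) a w := by
    intro k j
    rw [show n * k + j = positionIndex (toLex (k, j)) from rfl, List.mem_map_of_injective hinj]
  have hblock : ∀ k (j : Fin n), a j ∈ block (simpleA n) a w k ↔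
      toLex (k, j) ∈ sortingWord (simpleA n) a w := by
    intro k j
    constructor
    · rintro ⟨q, hq, h1, h2⟩
      rwa [← h1, ← a.injective h2]
    · intro h
      exact ⟨_, h, rfl, rfl⟩
  constructor
  · intro h m hm
    have e : m = n * (m / n) + (⟨m % n, Nat.mod_lt m hn⟩ : Fin n) := (Nat.div_add_mod m n).symm
    have e' : m + n = n * (m / n + 1) + (⟨m % n, Nat.mod_lt m hn⟩ : Fin n) := by
      rw [Nat.mul_add]; omega
    rw [e', hmem, ← hblock] at hm
    rw [e, hmem, ← hblock]
    exact h _ hm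
  · intro h k i hi
    obtain ⟨j, rfl⟩ := a.surjective i
    rw [hblock, ← hmem] at hi
    rw [hblock, ← hmem]
    apply h
    rwa [show n * k + j + n = n * (k + 1) + j by rw [Nat.mul_add]; omega]

/-! ### The circular order of the labels -/

open Classical in
/-- The place of the label `i` when the circle is traversed clockwise from its top; `R` is the set
of the labels on the right. The labels on the right are met in increasing order, then those on the
left in decreasing order. -/
def key (R : Set (Fin (n + 1))) (i : Fin (n + 1)) : ℕ := if i ∈ R then i else 2 * n - i

/-- `j` lies strictly inside the clockwise arc from `i` to `k`. The arc from `i` to `i` is the whole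
circle without `i`. -/
def Arc (R : Set (Fin (n + 1))) (i j k : Fin (n + 1)) : Prop :=
  (key R i < key R j ∧ key R j < key R k) ∨ (key R k ≤ key R i ∧ key R i < key R j) ∨
    (key R j < key R k ∧ key R k ≤ key R i)

/-- The label `0` has to be on the right: it is the top of the circle, where the traversal begins.
-/
theorem key_cases {R : Set (Fin (n + 1))} (h0 : 0 ∈ R) (i : Fin (n + 1)) :
    (i ∈ R ∧ key R i = i ∧ (i : ℕ) ≤ n) ∨
      (i ∉ R ∧ key R i + i = 2 * n ∧ 0 < (i : ℕ) ∧ (i : ℕ) ≤ n) := by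
  have hi := i.is_lt
  by_cases h : i ∈ R
  · exact Or.inl ⟨h, by simp [key, h], by omega⟩
  · refine Or.inr ⟨h, by simp only [key, h, if_false]; omega, Nat.pos_of_ne_zero ?_, by omega⟩
    intro hz
    exact h (by rwa [show i = 0 from Fin.ext hz])

theorem key_injective {R : Set (Fin (n + 1))} (h0 : 0 ∈ R) : Function.Injective (key R) := by
  intro i j h
  have h1 := key_cases h0 i
  have h2 := key_cases h0 j
  refine Fin.ext ?_
  omega

/-- `R'` arises from `R` by conjugating with the simple transposition `i`, which is initial for
`R`: the label `i` moves from the left to the right and the label `i + 1` from the right to the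
left. As exceptions, the smallest label is always on the right, and the side of the biggest label,
which is at the bottom of the circle, is irrelevant. -/
structure Flip (R R' : Set (Fin (n + 1))) (i : Fin n) : Prop where
  zero : 0 ∈ R
  zero' : 0 ∈ R'
  left : i.castSucc ∉ R ∨ (i : ℕ) = 0
  right : i.succ ∈ R ∨ (i : ℕ) + 1 = n
  left' : i.castSucc ∈ R'
  right' : i.succ ∉ R' ∨ (i : ℕ) + 1 = n
  other : ∀ j, j ≠ i.castSucc → j ≠ i.succ → (j ∈ R ↔ j ∈ R')

theorem simpleA_cases (i : Fin n) (x : Fin (n + 1)) :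
    (x = i.castSucc ∧ simpleA n i x = i.succ) ∨ (x = i.succ ∧ simpleA n i x = i.castSucc) ∨
      (x ≠ i.castSucc ∧ x ≠ i.succ ∧ simpleA n i x = x) := by
  by_cases h1 : x = i.castSucc
  · exact Or.inl ⟨h1, by rw [h1]; simp⟩
  · by_cases h2 : x = i.succ
    · exact Or.inr (Or.inl ⟨h2, by rw [h2]; simp⟩)
    · exact Or.inr (Or.inr ⟨h1, h2, simpleA_of_ne h1 h2⟩)

/-- The transposition of `i` and `i + 1` carries the clockwise order for `R'` to that for `R`,
except that for `i = 0` the last label becomes the first one. -/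
theorem Flip.key_cases {R R' : Set (Fin (n + 1))} {i : Fin n} (h : Flip R R' i)
    (x : Fin (n + 1)) :
    (key R (simpleA n i x) = i + 1 ∧ key R' x = i) ∨
    (0 < (i : ℕ) ∧ key R (simpleA n i x) + i = 2 * n ∧ key R' x + i + 1 = 2 * n) ∨
    ((i : ℕ) = 0 ∧ key R (simpleA n i x) = 0 ∧ key R' x + 1 = 2 * n) ∨
    (key R (simpleA n i x) = key R' x ∧ key R' x ≠ i ∧ key R' x ≠ i + 1 ∧ key R' x < 2 * n ∧
      key R' x + i ≠ 2 * n ∧ key R' x + i + 1 ≠ 2 * n) := by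
  have hi := i.is_lt
  have h1 := CoxeterSortable.key_cases h.zero (simpleA n i x)
  have h2 := CoxeterSortable.key_cases h.zero' x
  rcases simpleA_cases i x with ⟨rfl, e⟩ | ⟨rfl, e⟩ | ⟨e1, e2, e⟩
  · left
    rw [e, Fin.val_succ] at h1
    rw [Fin.val_castSucc] at h2
    rw [e]
    refine ⟨?_, ?_⟩
    · have := h.right
      rcases this with h3 | h3
      · simp only [h3, true_and, not_true, false_and, or_false] at h1
        omega
      · omega
    · simp only [h.left', true_and, not_true, false_and, or_false] at h2
      omega
  · right
    rw [e, Fin.val_castSucc] at h1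
    rw [Fin.val_succ] at h2
    rw [e]
    have h3 : key R' i.succ + i + 1 = 2 * n := by
      rcases h.right' with h3 | h3
      · simp only [h3, false_and, not_false_iff, true_and, false_or] at h2
        omega
      · omega
    rcases h.left with h4 | h4
    · simp only [h4, false_and, not_false_iff, true_and, false_or] at h1
      omega
    · omega
  · right; right; right
    rw [e] at h1 ⊢
    have h3 := h.other x e1 e2
    have e1 : (x : ℕ) ≠ i := fun h => e1 (Fin.ext h)
    have e2 : (x : ℕ) ≠ i + 1 := fun h => e2 (Fin.ext h)
    rw [h3] at h1
    by_cases h4 : x ∈ R'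
    · simp only [h4, true_and, not_true, false_and, or_false] at h1 h2
      omega
    · simp only [h4, false_and, not_false_iff, true_and, false_or] at h1 h2
      omega

/-- The transposition of `i` and `i + 1` carries the circle for `R'` to the circle for `R`. -/
theorem Flip.arc_iff {R R' : Set (Fin (n + 1))} {i : Fin n} (h : Flip R R' i)
    (x y z : Fin (n + 1)) :
    Arc R (simpleA n i x) (simpleA n i y) (simpleA n i z) ↔ Arc R' x y z := by
  have hi := i.is_lt
  have hx := h.key_cases x
  have hy := h.key_cases y
  have hz := h.key_cases z
  unfold Arc
  generalize key R (simpleA n i x) = a at *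
  generalize key R (simpleA n i y) = b at *
  generalize key R (simpleA n i z) = c at *
  generalize key R' x = a' at *
  generalize key R' y = b' at *
  generalize key R' z = c' at *
  generalize (i : ℕ) = m at *
  clear h
  rcases hx with hx | hx | hx | hx <;> rcases hy with hy | hy | hy | hy <;>
    rcases hz with hz | hz | hz | hz <;> omega

/-! ### Aligned permutations -/

/-- The pattern condition which turns out to characterize sortable permutations: no `312` whose `2`
is on the right, no `231` whose `2` is on the left. -/
def Aligned (R : Set (Fin (n + 1))) (w : Equiv.Perm (Fin (n + 1))) : Prop :=
  ∀ p q r : Fin (n + 1), p < q → q < r →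
    (w q < w r → w r < w p → w r ∉ R) ∧ (w r < w p → w p < w q → w p ∈ R)

/-- Three labels in which `i` does not precede `i + 1` form a forbidden pattern for `R` exactly if
their images under the transposition of `i` and `i + 1` form one for `R'`. -/
theorem Flip.pattern_iff {R R' : Set (Fin (n + 1))} {i : Fin n} (h : Flip R R' i)
    {x y z : Fin (n + 1)} (hxy : ¬(x = i.castSucc ∧ y = i.succ))
    (hxz : ¬(x = i.castSucc ∧ z = i.succ)) (hyz : ¬(y = i.castSucc ∧ z = i.succ)) :
    ((y < z → z < x → z ∉ R) ↔ (simpleA n i y < simpleA n i z → simpleA n i z < simpleA n i x →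
      simpleA n i z ∉ R')) ∧
    ((z < x → x < y → x ∈ R) ↔ (simpleA n i z < simpleA n i x → simpleA n i x < simpleA n i y →
      simpleA n i x ∈ R')) := by
  obtain ⟨-, -, h1, h2, h3, h4, h5⟩ := h
  have h5x := h5 x
  have h5z := h5 z
  clear h5
  have hx := x.is_lt
  have hy := y.is_lt
  have hz := z.is_lt
  rcases simpleA_cases i x with ⟨rfl, e⟩ | ⟨rfl, e⟩ | ⟨e1, e2, e⟩ <;>
  rcases simpleA_cases i y with ⟨rfl, f⟩ | ⟨rfl, f⟩ | ⟨f1, f2, f⟩ <;>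
  rcases simpleA_cases i z with ⟨rfl, g⟩ | ⟨rfl, g⟩ | ⟨g1, g2, g⟩ <;>
  simp only [e, f, g, Fin.lt_def, Fin.ext_iff, Fin.val_castSucc, Fin.val_succ] at * <;>
  grind

theorem Flip.aligned_iff_of_gt {R R' : Set (Fin (n + 1))} {i : Fin n} (h : Flip R R' i)
    {w : Equiv.Perm (Fin (n + 1))} (hw : w⁻¹ i.succ < w⁻¹ i.castSucc) :
    Aligned R w ↔ Aligned R' (simpleA n i * w) := by
  have key : ∀ p q : Fin (n + 1), p < q → ¬(w p = i.castSucc ∧ w q = i.succ) := by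
    rintro p q hpq ⟨h1, h2⟩
    rw [← h1, ← h2, perm_inv_apply_apply, perm_inv_apply_apply] at hw
    exact lt_asymm hw hpq
  unfold Aligned
  refine forall₅_congr fun p q r hpq hqr => ?_
  have := h.pattern_iff (key p q hpq) (key p r (hpq.trans hqr)) (key q r hqr)
  exact and_congr this.1 this.2

/-- If `i` precedes `i + 1` in an aligned permutation, where the transposition `i` is initial for
`R`, then the permutation lies in the parabolic subgroup without this transposition. -/
theorem Flip.preserves {R R' : Set (Fin (n + 1))} {i : Fin n} (h : Flip R R' i)
    {w : Equiv.Perm (Fin (n + 1))} (hw : w⁻¹ i.castSucc < w⁻¹ i.succ) (ha : Aligned R w) :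
    ∀ p, w p ≤ i.castSucc ↔ p ≤ i.castSucc := by
  -- the labels up to `i` precede the labels above `i`
  have key : ∀ p q : Fin (n + 1), w p ≤ i.castSucc → ¬ w q ≤ i.castSucc → p < q := by
    intro p q hp hq
    by_contra hpq
    have hne : p ≠ q := by rintro rfl; exact hq hp
    have hqp : q < p := lt_of_le_of_ne (not_lt.1 hpq) hne.symm
    obtain ⟨u, hu⟩ := w.surjective i.castSucc
    obtain ⟨v, hv⟩ := w.surjective i.succ
    rw [← hu, ← hv, perm_inv_apply_apply, perm_inv_apply_apply] at hw
    rw [Fin.le_def, Fin.val_castSucc] at hp hq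
    have hul : (w u : ℕ) = i := by rw [hu]; simp
    have hvl : (w v : ℕ) = i + 1 := by rw [hv]; simp
    have hpn := (w p).is_lt
    have hqn := (w q).is_lt
    -- the label `i + 1` precedes `w p`
    have hvp : v < p := by
      by_contra hc
      have hpv : p < v := lt_of_le_of_ne (not_lt.1 hc) (by rintro rfl; omega)
      have hqv : (w q : ℕ) ≠ i + 1 := by
        intro h'
        have : q = v := w.injective (Fin.ext (by omega))
        exact lt_asymm hqp (this ▸ hpv)
      have := (ha q p v hqp hpv).1 (Fin.lt_def.2 (by omega)) (Fin.lt_def.2 (by omega))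
      rw [hv] at this
      rcases h.right with h' | h'
      · exact this h'
      · omega
    have hup : (w p : ℕ) ≠ i := by
      intro h'
      have : p = u := w.injective (Fin.ext (by omega))
      exact lt_asymm hw (this ▸ hvp)
    have := (ha u v p hw hvp).2 (Fin.lt_def.2 (by omega)) (Fin.lt_def.2 (by omega))
    rw [hu] at this
    rcases h.left with h' | h'
    · exact h' this
    · omega
  -- hence the labels up to `i` fill an initial segment, which has `i + 1` elements
  have hcard : (Finset.univ.filter fun p => w p ≤ i.castSucc).card = (i : ℕ) + 1 := by
    have : (Finset.univ.filter fun p => w p ≤ i.castSucc) =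
        (Finset.Iic i.castSucc).map w.symm.toEmbedding := by
      ext p
      simp
    rw [this, Finset.card_map, Fin.card_Iic, Fin.val_castSucc]
  intro p
  constructor
  · intro hp
    have hsub : Finset.Iic p ⊆ Finset.univ.filter fun p => w p ≤ i.castSucc := by
      intro q hq
      rw [Finset.mem_filter]
      refine ⟨Finset.mem_univ _, ?_⟩
      by_contra hc
      exact absurd (key p q hp hc) (not_lt.2 (Finset.mem_Iic.1 hq))
    have := Finset.card_le_card hsub
    rw [hcard, Fin.card_Iic] at this
    rw [Fin.le_def, Fin.val_castSucc]
    omega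
  · intro hp
    by_contra hc
    have hsub : (Finset.univ.filter fun p => w p ≤ i.castSucc) ⊆ Finset.Iio p := by
      intro q hq
      rw [Finset.mem_filter] at hq
      exact Finset.mem_Iio.2 (key q p hq.2 hc)
    have := Finset.card_le_card hsub
    rw [hcard, Fin.card_Iio] at this
    rw [Fin.le_def, Fin.val_castSucc] at hp
    omega

theorem Flip.aligned_iff_of_preserves {R R' : Set (Fin (n + 1))} {i : Fin n} (h : Flip R R' i)
    {w : Equiv.Perm (Fin (n + 1))} (hw : ∀ p, w p ≤ i.castSucc ↔ p ≤ i.castSucc) :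
    Aligned R w ↔ Aligned R' w := by
  unfold Aligned
  refine forall₅_congr fun p q r hpq hqr => ?_
  have hp := hw p
  have hq := hw q
  have hr := hw r
  have hop := h.other (w p)
  have hor := h.other (w r)
  simp only [Fin.lt_def, Fin.le_def, Fin.ext_iff, Fin.val_castSucc, Fin.val_succ, ne_eq] at *
  -- the labels `i` and `i + 1` are extreme in their parts, so they are in no pattern as the `2`
  refine and_congr ?_ ?_
  · refine forall₂_congr fun h1 h2 => not_congr (hor ?_ ?_) <;> omega
  · refine forall₂_congr fun h1 h2 => hop ?_ ?_ <;> omega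

/-! ### Descending runs and the permutations that rotate them -/

/-- The labels `i` and `j` belong to the same descending run of the line notation of `w`: there is
a descent at each position between them. -/
def RunRel (w : Equiv.Perm (Fin (n + 1))) (i j : Fin (n + 1)) : Prop :=
  ∀ k : Fin n, (w⁻¹ i ≤ k.castSucc ∧ k.succ ≤ w⁻¹ j) ∨ (w⁻¹ j ≤ k.castSucc ∧ k.succ ≤ w⁻¹ i) →
    w k.succ < w k.castSucc

theorem RunRel.refl (w : Equiv.Perm (Fin (n + 1))) (i : Fin (n + 1)) : RunRel w i i := by
  rintro k (⟨h1, h2⟩ | ⟨h1, h2⟩) <;>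
  exact absurd (h2.trans h1) (not_le.2 k.castSucc_lt_succ)

theorem RunRel.symm {w : Equiv.Perm (Fin (n + 1))} {i j : Fin (n + 1)} (h : RunRel w i j) :
    RunRel w j i := fun k hk => h k hk.symm

theorem RunRel.trans {w : Equiv.Perm (Fin (n + 1))} {i j k : Fin (n + 1)} (h : RunRel w i j)
    (h' : RunRel w j k) : RunRel w i k := by
  intro m hm
  have h1 := h m
  have h2 := h' m
  simp only [Fin.le_def, Fin.val_castSucc, Fin.val_succ] at hm h1 h2
  by_cases hc : ((w⁻¹ i : ℕ) ≤ m ∧ (m : ℕ) + 1 ≤ w⁻¹ j) ∨ ((w⁻¹ j : ℕ) ≤ m ∧ (m : ℕ) + 1 ≤ w⁻¹ i)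
  · exact h1 hc
  · exact h2 (by omega)

theorem lt_of_forall_descent {w : Equiv.Perm (Fin (n + 1))} {p q : Fin (n + 1)} (hpq : p < q)
    (h : ∀ k : Fin n, p ≤ k.castSucc → k.succ ≤ q → w k.succ < w k.castSucc) : w q < w p := by
  induction q using Fin.induction with
  | zero => exact absurd hpq (Fin.not_lt_zero p)
  | succ q ih =>
    have hq := h q (Fin.le_castSucc_iff.2 hpq) le_rfl
    rcases (Fin.le_castSucc_iff.2 hpq).eq_or_lt with h' | h'
    · rwa [h']
    · exact hq.trans (ih h' fun k hk hk' => h k hk (hk'.trans q.castSucc_lt_succ.le))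

theorem RunRel.lt {w : Equiv.Perm (Fin (n + 1))} {i j : Fin (n + 1)} (h : RunRel w i j)
    (hij : w⁻¹ i < w⁻¹ j) : j < i := by
  have := lt_of_forall_descent (w := w) hij fun k h1 h2 => h k (Or.inl ⟨h1, h2⟩)
  rwa [perm_apply_inv_apply, perm_apply_inv_apply] at this

/-- `y` rotates the descending runs of `w`: it sends each label to the next label of its run in
clockwise order. -/
def Rotates (R : Set (Fin (n + 1))) (w y : Equiv.Perm (Fin (n + 1))) : Prop :=
  ∀ i, RunRel w i (y i) ∧ ∀ j, RunRel w i j → ¬ Arc R i j (y i)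

theorem Rotates.eq {R : Set (Fin (n + 1))} (h0 : 0 ∈ R) {w w' y y' : Equiv.Perm (Fin (n + 1))}
    (hw : ∀ i j, RunRel w i j ↔ RunRel w' i j) (hy : Rotates R w y) (hy' : Rotates R w' y') :
    y = y' := by
  ext i
  have h1 := (hy i).2 _ ((hw _ _).2 (hy' i).1)
  have h2 := (hy' i).2 _ ((hw _ _).1 (hy i).1)
  by_contra hne
  have h3 : key R (y i) ≠ key R (y' i) := fun h => hne (congrArg Fin.val (key_injective h0 h))
  unfold Arc at h1 h2
  omega

theorem inv_simpleA_mul_apply (w : Equiv.Perm (Fin (n + 1))) (i : Fin n) (x : Fin (n + 1)) :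
    (simpleA n i * w)⁻¹ (simpleA n i x) = w⁻¹ x := by
  rw [mul_inv_rev, simpleA_inv, Equiv.Perm.mul_apply, simpleA_invol]

theorem not_consecutive_of_gt {w : Equiv.Perm (Fin (n + 1))} {i : Fin n}
    (hw : w⁻¹ i.succ < w⁻¹ i.castSucc) (k : Fin n) :
    ¬(w k.succ = i.succ ∧ w k.castSucc = i.castSucc) := by
  rintro ⟨h1, h2⟩
  rw [← h1, ← h2, perm_inv_apply_apply, perm_inv_apply_apply] at hw
  exact lt_asymm hw k.castSucc_lt_succ

theorem simpleA_mem_Cov_iff {w : Equiv.Perm (Fin (n + 1))} {i : Fin n} :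
    simpleA n i ∈ Cov (simpleA n) w ↔
      ∃ k : Fin n, w k.castSucc = i.succ ∧ w k.succ = i.castSucc := by
  rw [mem_Cov_iff]
  constructor
  · rintro ⟨k, hk, h⟩
    have h1 : Equiv.swap (w k.castSucc) (w k.succ) i.succ = i.castSucc := by rw [← h]; simp
    have hne := i.castSucc_lt_succ.ne
    rcases eq_or_ne i.succ (w k.castSucc) with e | e
    · refine ⟨k, e.symm, ?_⟩
      rw [← h1, e, Equiv.swap_apply_left]
    · rcases eq_or_ne i.succ (w k.succ) with e' | e'
      · rw [e', Equiv.swap_apply_right] at h1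
        rw [h1, ← e'] at hk
        exact absurd hk (not_lt.2 i.castSucc_lt_succ.le)
      · rw [Equiv.swap_apply_of_ne_of_ne e e'] at h1
        exact absurd h1.symm hne
  · rintro ⟨k, h1, h2⟩
    refine ⟨k, by rw [h1, h2]; exact i.castSucc_lt_succ, ?_⟩
    rw [h1, h2, Equiv.swap_comm]
    rfl

/-- If the label `i + 1` precedes `i` in `w` but is not adjacent to it, transposing them only
renames the labels of the descending runs. -/
theorem Flip.rotates_of_notMem_Cov {R R' : Set (Fin (n + 1))} {i : Fin n} (h : Flip R R' i)
    {w y : Equiv.Perm (Fin (n + 1))} (hw : w⁻¹ i.succ < w⁻¹ i.castSucc)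
    (hc : simpleA n i ∉ Cov (simpleA n) w) (hy : Rotates R' (simpleA n i * w) y) :
    Rotates R w (simpleA n i * y * simpleA n i) := by
  have hrun : ∀ a b, RunRel (simpleA n i * w) (simpleA n i a) (simpleA n i b) ↔ RunRel w a b := by
    intro a b
    unfold RunRel
    simp only [inv_simpleA_mul_apply, Equiv.Perm.mul_apply]
    refine forall_congr' fun k => imp_congr_right fun _ => simpleA_lt_iff i ?_ ?_
    · rintro ⟨h1, h2⟩
      exact hc (simpleA_mem_Cov_iff.2 ⟨k, h2, h1⟩)
    · exact not_consecutive_of_gt hw k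
  intro a
  have ha := hy (simpleA n i a)
  constructor
  · rw [← hrun]
    simpa [simpleA_invol] using ha.1
  · intro b hb hab
    refine ha.2 _ ((hrun a b).2 hb) ?_
    rw [← h.arc_iff, simpleA_invol, simpleA_invol]
    exact hab

/-- In the parabolic subgroup without the transposition `i`, a run is contained in the labels up to
`i` or in the labels above `i`, and neither of these has its cyclic order changed by the flip. -/
theorem Flip.rotates_of_preserves {R R' : Set (Fin (n + 1))} {i : Fin n} (h : Flip R R' i)
    {w y : Equiv.Perm (Fin (n + 1))} (hw : ∀ p, w p ≤ i.castSucc ↔ p ≤ i.castSucc)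
    (hy : Rotates R' w y) : Rotates R w y := by
  have hside : ∀ a b, RunRel w a b → ((a : ℕ) ≤ i ↔ (b : ℕ) ≤ i) := by
    intro a b hab
    have h1 := (hw i.castSucc).2 le_rfl
    have h2 := (hw i.succ).not.2 (not_le.2 i.castSucc_lt_succ)
    have h3 := mt (hab i) (not_lt.2 (h1.trans (not_le.1 h2).le))
    have h4 := hw (w⁻¹ a)
    have h5 := hw (w⁻¹ b)
    rw [perm_apply_inv_apply] at h4 h5
    simp only [Fin.le_def, Fin.val_castSucc, Fin.val_succ] at h3 h4 h5
    omega
  intro a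
  refine ⟨(hy a).1, fun b hab hArc => (hy a).2 b hab ?_⟩
  have hb := hside _ _ hab
  have hc := hside _ _ (hy a).1
  have hkey : ∀ x : Fin (n + 1),
      ((x : ℕ) < i ∧ key R x = key R' x ∧ (key R x < i ∨ 2 * n < key R x + i)) ∨
      ((x : ℕ) = i ∧ key R' x = i ∧ ((i : ℕ) = 0 ∧ key R x = 0 ∨ 0 < (i : ℕ) ∧ key R x + i = 2 * n)) ∨
      ((x : ℕ) = i + 1 ∧ key R x = i + 1 ∧ key R' x + i + 1 = 2 * n) ∨
      ((i : ℕ) + 1 < x ∧ key R x = key R' x ∧ i + 1 < key R x ∧ key R x + i + 1 < 2 * n) := by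
    intro x
    have k1 := CoxeterSortable.key_cases h.zero x
    have k2 := CoxeterSortable.key_cases h.zero' x
    obtain ⟨-, -, h1, h2, h3, h4, h5⟩ := h
    have h5 := h5 x
    have hi := i.is_lt
    rcases simpleA_cases i x with ⟨rfl, -⟩ | ⟨rfl, -⟩ | ⟨e1, e2, -⟩
    · simp only [Fin.val_castSucc, h3, true_and, not_true, false_and, or_false] at *
      grind
    · simp only [Fin.val_succ] at *
      grind
    · simp only [ne_eq, Fin.ext_iff, Fin.val_castSucc, Fin.val_succ] at *
      grind
  have ka := hkey a
  have kb := hkey b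
  have kc := hkey (y a)
  have hi := i.is_lt
  clear hkey hside h hw hy
  unfold Arc at *
  generalize key R a = A at *
  generalize key R b = B at *
  generalize key R (y a) = C at *
  generalize key R' a = A' at *
  generalize key R' b = B' at *
  generalize key R' (y a) = C' at *
  generalize (a : ℕ) = va at *
  generalize (b : ℕ) = vb at *
  generalize (y a : ℕ) = vc at *
  rcases ka with ka | ka | ka | ka <;> rcases kb with kb | kb | kb | kb <;>
    rcases kc with kc | kc | kc | kc <;> omega

/-- If the labels `i + 1` and `i` are adjacent in `w`, transposing them cuts their run into two: the
labels from `i + 1` on and the labels up to `i`. The conjugate `s y s` rotates the two parts, and `y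
s = s (s y s)` joins these cycles at the cut. -/
theorem Flip.rotates_of_mem_Cov {R R' : Set (Fin (n + 1))} {i : Fin n} (h : Flip R R' i)
    {w y : Equiv.Perm (Fin (n + 1))} (hw : w⁻¹ i.succ < w⁻¹ i.castSucc)
    (hc : simpleA n i ∈ Cov (simpleA n) w) (hy : Rotates R' (simpleA n i * w) y) :
    Rotates R w (y * simpleA n i) := by
  obtain ⟨k₀, hk1, hk2⟩ := simpleA_mem_Cov_iff.1 hc
  have hp1 : w⁻¹ i.succ = k₀.castSucc := by rw [← hk1, perm_inv_apply_apply]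
  have hp2 : w⁻¹ i.castSucc = k₀.succ := by rw [← hk2, perm_inv_apply_apply]
  -- `r` holds for two labels which remain in one run when the run of `i + 1, i` is cut between them
  set r : Fin (n + 1) → Fin (n + 1) → Prop :=
    fun a b => RunRel (simpleA n i * w) (simpleA n i a) (simpleA n i b) with hr
  have hdesc : ∀ k : Fin n, (simpleA n i * w) k.succ < (simpleA n i * w) k.castSucc ↔
      w k.succ < w k.castSucc ∧ k ≠ k₀ := by
    intro k
    simp only [Equiv.Perm.mul_apply]
    by_cases hk : k = k₀
    · subst hk
      simp [hk1, hk2, i.castSucc_lt_succ.le]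
    · rw [simpleA_lt_iff i]
      · simp [hk]
      · rintro ⟨-, h2⟩
        rw [← hk1] at h2
        exact hk (Fin.castSucc_injective _ (w.injective h2))
      · exact not_consecutive_of_gt hw k
  have hr' : ∀ a b, r a b ↔ ∀ k : Fin n, (w⁻¹ a ≤ k.castSucc ∧ k.succ ≤ w⁻¹ b) ∨
      (w⁻¹ b ≤ k.castSucc ∧ k.succ ≤ w⁻¹ a) → w k.succ < w k.castSucc ∧ k ≠ k₀ := by
    intro a b
    simp only [hr, RunRel, inv_simpleA_mul_apply, hdesc]
  have f1 : ∀ a b, r a b → RunRel w a b := fun a b hab k hk => ((hr' a b).1 hab k hk).1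
  have hcut : ∀ a b, RunRel w a b → (w⁻¹ a ≤ k₀.castSucc ↔ w⁻¹ b ≤ k₀.castSucc) → r a b := by
    intro a b hab hk
    refine (hr' a b).2 fun k hk' => ⟨hab k hk', ?_⟩
    rintro rfl
    simp only [Fin.le_def, Fin.val_castSucc, Fin.val_succ] at hk hk'
    omega
  have hcut' : ∀ a b, r a b → (w⁻¹ a ≤ k₀.castSucc ↔ w⁻¹ b ≤ k₀.castSucc) := by
    intro a b hab
    by_contra hk
    refine ((hr' a b).1 hab k₀ ?_).2 rfl
    simp only [Fin.le_def, Fin.val_castSucc, Fin.val_succ] at hk ⊢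
    omega
  have f3 : RunRel w i.succ i.castSucc := by
    intro k hk
    rw [hp1, hp2] at hk
    have : k = k₀ := by
      simp only [Fin.le_def, Fin.val_castSucc, Fin.val_succ] at hk
      exact Fin.ext (by omega)
    rw [this, hk1, hk2]
    exact i.castSucc_lt_succ
  have hα : ∀ a, RunRel w a i.succ → w⁻¹ a ≤ k₀.castSucc → (i : ℕ) + 1 ≤ a := by
    intro a ha hk
    rcases hk.eq_or_lt with e | e
    · rw [← hp1] at e
      rw [w⁻¹.injective e]
      simp
    · rw [← hp1] at e
      have := Fin.lt_def.1 (ha.lt e)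
      rw [Fin.val_succ] at this
      omega
  have hβ : ∀ a, RunRel w a i.succ → ¬ w⁻¹ a ≤ k₀.castSucc → (a : ℕ) ≤ i := by
    intro a ha hk
    have ha := ha.trans f3
    have hk : w⁻¹ i.castSucc ≤ w⁻¹ a := by
      rw [hp2]
      simp only [Fin.le_def, Fin.val_castSucc, Fin.val_succ] at hk ⊢
      omega
    rcases hk.eq_or_lt with e | e
    · rw [← w⁻¹.injective e]
      simp
    · have := Fin.lt_def.1 (ha.symm.lt e)
      rw [Fin.val_castSucc] at this
      omega
  intro a
  -- `c` is the clockwise next label of `a` in the cut run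
  obtain ⟨c, hcdef⟩ : ∃ c, c = simpleA n i (y (simpleA n i a)) := ⟨_, rfl⟩
  have hac : r a c := by
    have := (hy (simpleA n i a)).1
    rw [hcdef, hr]
    simpa [simpleA_invol] using this
  have hArc : ∀ b, r a b → ¬ Arc R a b c := by
    intro b hb hab
    refine (hy (simpleA n i a)).2 _ hb ?_
    rw [← h.arc_iff, simpleA_invol, simpleA_invol]
    rwa [← hcdef]
  have hgoal : (y * simpleA n i) a = simpleA n i c := by
    rw [hcdef, simpleA_invol, Equiv.Perm.mul_apply]
  rw [hgoal]
  have hkα : key R i.succ = i + 1 := by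
    have := CoxeterSortable.key_cases h.zero i.succ
    have := h.right
    rw [Fin.val_succ] at *
    grind
  have hkβ : (i : ℕ) = 0 ∧ key R i.castSucc = 0 ∨ 0 < (i : ℕ) ∧ key R i.castSucc + i = 2 * n := by
    have := CoxeterSortable.key_cases h.zero i.castSucc
    have := h.left
    rw [Fin.val_castSucc] at *
    grind
  have hi := i.is_lt
  have hcα : r a i.succ → w⁻¹ a ≤ k₀.castSucc := fun h' => (hcut' _ _ h').2 hp1.le
  have hkey := CoxeterSortable.key_cases h.zero
  have hinj := @key_injective n R h.zero
  have hrefl : w⁻¹ i.succ ≤ k₀.castSucc := hp1.le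
  have hreflβ : ¬ w⁻¹ i.castSucc ≤ k₀.castSucc := by
    rw [hp2]; exact not_le.2 k₀.castSucc_lt_succ
  by_cases ha : RunRel w a i.succ
  · have hcr : RunRel w c i.succ := (f1 _ _ hac).symm.trans ha
    have hck := hcut' _ _ hac
    have ka := hkey a
    have kc := hkey c
    have hab : ∀ b, RunRel w a b → ¬ Arc R a b (simpleA n i c) := by
      intro b hb
      have hbr : RunRel w b i.succ := hb.symm.trans ha
      have kb := hkey b
      by_cases hka : w⁻¹ a ≤ k₀.castSucc
      · have ga := hα a ha hka
        have gc := hα c hcr (hck.1 hka)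
        have hA1 := hArc i.succ (hcut _ _ ha (iff_of_true hka hrefl))
        rcases simpleA_cases i c with ⟨rfl, e⟩ | ⟨rfl, e⟩ | ⟨e1, e2, e⟩
        · simp at gc
        · rw [e]
          by_cases hkb : w⁻¹ b ≤ k₀.castSucc
          · have gb := hα b hbr hkb
            have hA2 := hArc b (hcut _ _ hb (iff_of_true hka hkb))
            unfold Arc at *
            omega
          · have gb := hβ b hbr hkb
            unfold Arc at *
            omega
        · rw [e]
          have e2 : key R c ≠ key R i.succ := fun h' => e2 (hinj h')
          by_cases hkb : w⁻¹ b ≤ k₀.castSucc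
          · exact hArc b (hcut _ _ hb (iff_of_true hka hkb))
          · have gb := hβ b hbr hkb
            unfold Arc at *
            omega
      · have ga := hβ a ha hka
        have gc := hβ c hcr (mt hck.2 hka)
        have hA1 := hArc i.castSucc (hcut _ _ (ha.trans f3) (iff_of_false hka hreflβ))
        rcases simpleA_cases i c with ⟨rfl, e⟩ | ⟨rfl, e⟩ | ⟨e1, e2, e⟩
        · rw [e]
          by_cases hkb : w⁻¹ b ≤ k₀.castSucc
          · have gb := hα b hbr hkb
            unfold Arc at *
            omega
          · have gb := hβ b hbr hkb
            have hA2 := hArc b (hcut _ _ hb (iff_of_false hka hkb))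
            unfold Arc at *
            omega
        · simp at gc
        · rw [e]
          have e1 : key R c ≠ key R i.castSucc := fun h' => e1 (hinj h')
          by_cases hkb : w⁻¹ b ≤ k₀.castSucc
          · have gb := hα b hbr hkb
            unfold Arc at *
            omega
          · exact hArc b (hcut _ _ hb (iff_of_false hka hkb))
    refine ⟨?_, hab⟩
    rcases simpleA_cases i c with ⟨rfl, e⟩ | ⟨rfl, e⟩ | ⟨e1, e2, e⟩
    · rwa [e]
    · rw [e]
      exact ha.trans f3
    · rw [e]
      exact f1 _ _ hac
  · have e : simpleA n i c = c := by
      refine simpleA_of_ne ?_ ?_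
      · rintro rfl
        exact ha ((f1 _ _ hac).trans f3.symm)
      · rintro rfl
        exact ha (f1 _ _ hac)
    rw [e]
    refine ⟨f1 _ _ hac, fun b hb => hArc b (hcut _ _ hb ?_)⟩
    -- the run of `a` is not the one that is cut
    by_contra hk
    apply ha
    have hb' := hb k₀
    intro k hk'
    rw [hp1] at hk'
    refine hb k ?_
    simp only [Fin.le_def, Fin.val_castSucc, Fin.val_succ] at hk hk' ⊢
    omega

/-! ### Sortable permutations are the aligned ones, and `Read` rotates their runs -/

theorem infiniteWord_eq_iff (a : Equiv.Perm (Fin n)) (hn : 0 < n) (m m' : ℕ) :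
    infiniteWord a hn m = infiniteWord a hn m' ↔ m % n = m' % n := by
  simp [infiniteWord]

theorem exists_infiniteWord_eq (a : Equiv.Perm (Fin n)) (hn : 0 < n) (t : ℕ) (i : Fin n) :
    ∃ m, t ≤ m ∧ m < t + n ∧ infiniteWord a hn m = i := by
  obtain ⟨j, rfl⟩ := a.surjective i
  have hj := j.is_lt
  have ht := Nat.mod_lt t hn
  have ht' := Nat.div_add_mod t n
  by_cases h : t % n ≤ j
  · refine ⟨n * (t / n) + j, by omega, by omega, congrArg a (Fin.ext ?_)⟩
    simp [Nat.mod_eq_of_lt hj]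
  · refine ⟨n * (t / n + 1) + j, by rw [Nat.mul_add]; omega, by rw [Nat.mul_add]; omega,
      congrArg a (Fin.ext ?_)⟩
    simp only [Nat.mul_add_mod]
    exact Nat.mod_eq_of_lt hj

/-- The labels `j` such that, from time `t` on, the letter `(j - 1, j)` occurs before the letter
`(j, j + 1)` in the infinite word `b`; the smallest and the biggest label are included. -/
def sideAt (b : ℕ → Fin n) (t : ℕ) : Set (Fin (n + 1)) :=
  {j | j = 0 ∨ j = Fin.last n ∨ ∃ i i' : Fin n, j = i.succ ∧ j = i'.castSucc ∧
    ∃ m, t ≤ m ∧ b m = i ∧ ∀ m', t ≤ m' → m' ≤ m → b m' ≠ i'}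

theorem succ_mem_sideAt_iff {b : ℕ → Fin n} {t : ℕ} {i i' : Fin n}
    (h : (i : ℕ) + 1 = i') : i.succ ∈ sideAt b t ↔
      ∃ m, t ≤ m ∧ b m = i ∧ ∀ m', t ≤ m' → m' ≤ m → b m' ≠ i' := by
  constructor
  · rintro (h1 | h1 | ⟨k, k', h1, h2, h3⟩)
    · simp at h1
    · have := congrArg Fin.val h1
      rw [Fin.val_succ, Fin.val_last] at this
      have := i'.is_lt
      omega
    · have e : i = k := Fin.succ_injective _ h1
      have e' : i' = k' := by
        have := congrArg Fin.val h2
        rw [Fin.val_succ, Fin.val_castSucc] at this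
        exact Fin.ext (by omega)
      rw [e, e']
      exact h3
  · intro h3
    exact Or.inr (Or.inr ⟨i, i', rfl, Fin.ext (by simp [h]), h3⟩)

/-- After the letter `i` has been passed, it comes after its neighbours instead of before them. -/
theorem flip_sideAt (a : Equiv.Perm (Fin n)) (hn : 0 < n) (t : ℕ) :
    Flip (sideAt (infiniteWord a hn) t) (sideAt (infiniteWord a hn) (t + 1))
      (infiniteWord a hn t) := by
  set b := infiniteWord a hn with hbdef
  have hb := infiniteWord_eq_iff a hn
  have hex := exists_infiniteWord_eq a hn
  rw [← hbdef] at hb hex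
  -- a letter does not occur again within the next `n - 1` steps
  have hper : ∀ m, t < m → b m = b t → t + n ≤ m := by
    intro m hm h
    have h1 : m ≡ t [MOD n] := (hb m t).1 h
    have h2 := (Nat.modEq_iff_dvd' hm.le).1 h1.symm
    have := Nat.le_of_dvd (by omega) h2
    omega
  have hbi := (b t).is_lt
  refine ⟨Or.inl rfl, Or.inl rfl, ?_, ?_, ?_, ?_, ?_⟩
  · by_cases h0 : (b t : ℕ) = 0
    · exact Or.inr h0
    · left
      obtain ⟨i, hi⟩ : ∃ i : Fin n, (i : ℕ) + 1 = b t := ⟨⟨(b t : ℕ) - 1, by omega⟩, by simp; omega⟩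
      have e : (b t).castSucc = i.succ := Fin.ext (by simp [hi])
      rw [e, succ_mem_sideAt_iff hi]
      rintro ⟨m, h1, -, h3⟩
      exact h3 t le_rfl h1 rfl
  · by_cases h0 : (b t : ℕ) + 1 = n
    · exact Or.inr h0
    · left
      rw [succ_mem_sideAt_iff (i' := ⟨(b t : ℕ) + 1, by omega⟩) rfl]
      refine ⟨t, le_rfl, rfl, fun m' h1 h2 h3 => ?_⟩
      rw [le_antisymm h2 h1, Fin.ext_iff] at h3
      simp at h3
  · by_cases h0 : (b t : ℕ) = 0
    · exact Or.inl (Fin.ext (by simp [h0]))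
    · obtain ⟨i, hi⟩ : ∃ i : Fin n, (i : ℕ) + 1 = b t := ⟨⟨(b t : ℕ) - 1, by omega⟩, by simp; omega⟩
      have e : (b t).castSucc = i.succ := Fin.ext (by simp [hi])
      rw [e, succ_mem_sideAt_iff hi]
      obtain ⟨m, h1, h2, h3⟩ := hex t i
      have hmt : t ≠ m := by
        rintro rfl
        rw [h3] at hi
        omega
      refine ⟨m, by omega, h3, fun m' h4 h5 h6 => ?_⟩
      have := hper m' (by omega) h6
      omega
  · by_cases h0 : (b t : ℕ) + 1 = n
    · exact Or.inr h0
    · left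
      rw [succ_mem_sideAt_iff (i' := ⟨(b t : ℕ) + 1, by omega⟩) rfl]
      rintro ⟨m, h1, h2, h3⟩
      have := hper m (by omega) h2
      obtain ⟨m', h4, h5, h6⟩ := hex (t + 1) ⟨(b t : ℕ) + 1, by omega⟩
      exact h3 m' h4 (by omega) h6
  · intro j hj1 hj2
    rcases eq_or_ne j 0 with rfl | hj0
    · exact ⟨fun _ => Or.inl rfl, fun _ => Or.inl rfl⟩
    obtain ⟨i, rfl⟩ := Fin.exists_succ_eq.2 hj0
    by_cases hl : (i : ℕ) + 1 = n
    · have : i.succ = Fin.last n := Fin.ext (by simp [hl])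
      exact ⟨fun _ => Or.inr (Or.inl this), fun _ => Or.inr (Or.inl this)⟩
    have hil := i.is_lt
    rw [succ_mem_sideAt_iff (i' := ⟨(i : ℕ) + 1, by omega⟩) rfl,
      succ_mem_sideAt_iff (i' := ⟨(i : ℕ) + 1, by omega⟩) rfl]
    constructor
    · rintro ⟨m, h1, h2, h3⟩
      refine ⟨m, ?_, h2, fun m' h4 h5 => h3 m' (by omega) h5⟩
      rcases h1.eq_or_lt with rfl | h1
      · exact absurd (congrArg Fin.succ h2.symm) hj2
      · exact h1
    · rintro ⟨m, h1, h2, h3⟩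
      refine ⟨m, by omega, h2, fun m' h4 h5 => ?_⟩
      rcases h4.eq_or_lt with rfl | h4
      · intro h6
        apply hj1
        rw [h6]
        exact Fin.ext (by simp)
      · exact h3 m' h4 h5

theorem runRel_one {i j : Fin (n + 1)} (h : RunRel (1 : Equiv.Perm (Fin (n + 1))) i j) : i = j := by
  rcases lt_trichotomy i j with h' | h' | h'
  · exact absurd (h.lt (by simpa using h')) (lt_asymm h')
  · exact h'
  · exact absurd (h.symm.lt (by simpa using h')) (lt_asymm h')

/-- The recursion which removes the first letter `s` from the infinite word, for all three notions:
sortable, aligned, and the product of the cover reflections. If `s` is used, `w` is replaced by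
`s w`. If it is not used, then both sortable and aligned permutations lie in the parabolic subgroup
without `s`. The number `N` bounds the length of the part of the word which is used. -/
theorem sortable_iff_aligned_and_rotates (a : Equiv.Perm (Fin n)) (hn : 0 < n) (N : ℕ) :
    ∀ (t : ℕ) (w : Equiv.Perm (Fin (n + 1))) (P : List ℕ),
      IsMinWord (infiniteWord a hn) t w P → (∀ m ∈ P, m < t + N) →
      ((∀ m, t ≤ m → m + n ∈ P → m ∈ P) ↔ Aligned (sideAt (infiniteWord a hn) t) w) ∧
      (Aligned (sideAt (infiniteWord a hn) t) w →
        Rotates (sideAt (infiniteWord a hn) t) w (readProd w (P.map (infiniteWord a hn)))) := by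
  set b := infiniteWord a hn with hbdef
  have hb := infiniteWord_eq_iff a hn
  rw [← hbdef] at hb
  have hb' : ∀ t i, ∃ m, t ≤ m ∧ b m = i := fun t i => by
    obtain ⟨m, h1, -, h3⟩ := exists_infiniteWord_eq a hn t i
    exact ⟨m, h1, h3⟩
  induction N with
  | zero =>
    intro t w P hP hN
    have hnil : P = [] := by
      refine List.eq_nil_iff_forall_not_mem.2 fun m hm => ?_
      have := hN m hm
      have := hP.ge m hm
      omega
    subst hnil
    have hw : w = 1 := hP.reduced.1.symm
    subst hw
    refine ⟨iff_of_true (by simp) ?_, fun _ i => ?_⟩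
    · intro p q r hpq hqr
      simp only [Equiv.Perm.one_apply]
      exact ⟨fun _ h => absurd h (lt_asymm (hpq.trans hqr)),
        fun h => absurd h (lt_asymm (hpq.trans hqr))⟩
    · have e : readProd (1 : Equiv.Perm (Fin (n + 1))) (List.map b []) = 1 := by
        simp [readProd, inversionList]
      rw [e]
      refine ⟨RunRel.refl _ _, fun j hj => ?_⟩
      rw [runRel_one hj]
      unfold Arc
      simp only [Equiv.Perm.one_apply]
      omega
  | succ N ih =>
    intro t w P hP hN
    have hflip := flip_sideAt a hn t
    rw [← hbdef] at hflip
    rcases castSucc_lt_or_succ_lt w⁻¹ (b t) with hw | hw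
    · -- the first letter is not used
      obtain ⟨ht, hP'⟩ := hP.succ hw
      obtain ⟨ih1, ih2⟩ := ih (t + 1) w P hP' fun m hm => by have := hN m hm; omega
      have hal : Aligned (sideAt b t) w →
          (∀ p, w p ≤ (b t).castSucc ↔ p ≤ (b t).castSucc) := hflip.preserves hw
      refine ⟨⟨fun h => ?_, fun h => ?_⟩, fun h => ?_⟩
      · have h1 := ih1.1 fun m hm => h m (by omega)
        have hk : ∀ k, t + k * n ∉ P := by
          intro k
          induction k with
          | zero => simpa using ht
          | succ k ihk =>
            intro hk
            apply ihk
            exact h _ (Nat.le_add_right _ _) (by rwa [Nat.add_assoc, ← Nat.succ_mul])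
        have hnot : b t ∉ P.map b := by
          intro hmem
          obtain ⟨m, hm, hmt⟩ := List.mem_map.1 hmem
          have h2 := hP.ge m hm
          have h3 : t ≡ m [MOD n] := ((hb m t).1 hmt).symm
          obtain ⟨k, hk'⟩ := (Nat.modEq_iff_dvd' h2).1 h3
          apply hk k
          rwa [Nat.mul_comm, ← hk', Nat.add_sub_cancel' h2]
        have hpres := preserves_of_notMem hnot
        rw [hP.reduced.1] at hpres
        exact (hflip.aligned_iff_of_preserves hpres).2 h1
      · have hpres := hal h
        have hnot := notMem_of_preserves hP.reduced hpres
        have h1 := ih1.2 ((hflip.aligned_iff_of_preserves hpres).1 h)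
        intro m hm hmem
        rcases hm.eq_or_lt with rfl | hm
        · refine absurd (List.mem_map.2 ⟨_, hmem, ?_⟩) hnot
          rw [hb]
          simp
        · exact h1 m hm hmem
      · have hpres := hal h
        exact hflip.rotates_of_preserves hpres
          (ih2 ((hflip.aligned_iff_of_preserves hpres).1 h))
    · -- the first letter is used
      have hPred := hP.reduced
      have hge := hP.ge
      obtain ⟨P', rfl, hP'⟩ := hP.eq_cons hb' hw
      obtain ⟨ih1, ih2⟩ := ih (t + 1) _ P' hP' fun m hm => by
        have := hN m (List.mem_cons_of_mem _ hm)
        omega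
      rw [← hflip.aligned_iff_of_gt hw] at ih1 ih2
      refine ⟨?_, fun h => ?_⟩
      · rw [← ih1]
        constructor
        · intro h m hm hmem
          rcases List.mem_cons.1 (h m (by omega) (List.mem_cons_of_mem _ hmem)) with h' | h'
          · omega
          · exact h'
        · intro h m hm hmem
          rcases hm.eq_or_lt with rfl | hm
          · exact List.mem_cons_self
          · rcases List.mem_cons.1 hmem with h' | h'
            · omega
            · exact List.mem_cons_of_mem _ (h m hm h')
      · have hy := ih2 h
        rw [List.map_cons] at hPred ⊢
        rw [readProd_cons hPred]
        split_ifs with hc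
        · exact hflip.rotates_of_mem_Cov hw hc hy
        · exact hflip.rotates_of_notMem_Cov hw hc hy

theorem exists_bound (P : List ℕ) : ∃ N, ∀ m ∈ P, m < 0 + N := by
  refine ⟨P.sum + 1, fun m hm => ?_⟩
  have := List.le_sum_of_mem hm
  omega

theorem mem_SortableElements_iff_aligned (a : Equiv.Perm (Fin n)) (hn : 0 < n)
    (w : Equiv.Perm (Fin (n + 1))) :
    w ∈ SortableElements (simpleA n) a ↔ Aligned (sideAt (infiniteWord a hn) 0) w := by
  have hP := isMinWord_sortingWord a hn w
  obtain ⟨N, hN⟩ := exists_bound ((sortingWord (simpleA n) a w).map positionIndex)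
  rw [mem_SortableElements_iff a hn,
    ← (sortable_iff_aligned_and_rotates a hn N 0 w _ hP hN).1]
  simp

theorem rotates_Read (a : Equiv.Perm (Fin n)) (hn : 0 < n) {w : Equiv.Perm (Fin (n + 1))}
    (h : Aligned (sideAt (infiniteWord a hn) 0) w) :
    Rotates (sideAt (infiniteWord a hn) 0) w (Read (simpleA n) a w) := by
  have hP := isMinWord_sortingWord a hn w
  obtain ⟨N, hN⟩ := exists_bound ((sortingWord (simpleA n) a w).map positionIndex)
  rw [Read_eq_readProd a hn]
  exact (sortable_iff_aligned_and_rotates a hn N 0 w _ hP hN).2 h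

/-! ### Cycles of a permutation multiplied by a transposition -/

section Cycles

variable {α : Type*}

theorem exists_first_return [Fintype α] (x : Equiv.Perm α) (i j : α) :
    ∃ m, 0 < m ∧ ((x ^ m) j = i ∨ (x ^ m) j = j) ∧
      ∀ l, 0 < l → l < m → (x ^ l) j ≠ i ∧ (x ^ l) j ≠ j := by
  classical
  have hex : ∃ m, 0 < m ∧ ((x ^ m) j = i ∨ (x ^ m) j = j) :=
    ⟨orderOf x, orderOf_pos x, Or.inr (by rw [pow_orderOf_eq_one]; rfl)⟩
  refine ⟨Nat.find hex, (Nat.find_spec hex).1, (Nat.find_spec hex).2, fun l hl hlm => ?_⟩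
  have := Nat.find_min hex hlm
  tauto

theorem not_sameCycle_of_return [Fintype α] {x : Equiv.Perm α} {i j : α} (hij : j ≠ i) {m : ℕ}
    (hm : 0 < m)
    (hj : (x ^ m) j = j) (h : ∀ l, 0 < l → l < m → (x ^ l) j ≠ i) : ¬ x.SameCycle j i := by
  intro hs
  obtain ⟨k, -, hk⟩ := hs.exists_pow_eq'
  have hper : Function.IsPeriodicPt x m j := by
    rw [Function.IsPeriodicPt, Function.IsFixedPt, Equiv.Perm.iterate_eq_pow, hj]
  have h1 := hper.iterate_mod_apply k
  rw [Equiv.Perm.iterate_eq_pow, Equiv.Perm.iterate_eq_pow, hk] at h1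
  rcases Nat.eq_zero_or_pos (k % m) with h0 | h0
  · rw [h0] at h1
    exact hij h1
  · exact h _ h0 (Nat.mod_lt _ hm) h1

/-- Until the orbit of `j` under `x` first returns to `{i, j}`, it is also the orbit under `(i j)
x`. -/
theorem swap_mul_pow_apply [DecidableEq α] {x : Equiv.Perm α} {i j : α} {m : ℕ}
    (h : ∀ l, 0 < l → l < m → (x ^ l) j ≠ i ∧ (x ^ l) j ≠ j) :
    ∀ l, l < m → ((Equiv.swap i j * x) ^ l) j = (x ^ l) j := by
  intro l
  induction l with
  | zero => intro _; rfl
  | succ l ih =>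
    intro hl
    have h1 := h (l + 1) (Nat.succ_pos l) hl
    rw [pow_succ', Equiv.Perm.mul_apply] at h1 ⊢
    rw [ih (by omega), Equiv.Perm.mul_apply, Equiv.swap_apply_of_ne_of_ne h1.1 h1.2, pow_succ',
      Equiv.Perm.mul_apply]

theorem swap_mul_pow_return [DecidableEq α] {x : Equiv.Perm α} {i j : α} {m : ℕ} (hm : 0 < m)
    (h : ∀ l, 0 < l → l < m → (x ^ l) j ≠ i ∧ (x ^ l) j ≠ j) :
    ((Equiv.swap i j * x) ^ m) j = Equiv.swap i j ((x ^ m) j) := by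
  obtain ⟨l, rfl⟩ := Nat.exists_eq_succ_of_ne_zero hm.ne'
  rw [Nat.succ_eq_add_one, pow_succ', Equiv.Perm.mul_apply, swap_mul_pow_apply h l (by simp),
    Equiv.Perm.mul_apply, pow_succ', Equiv.Perm.mul_apply]

theorem sameCycle_swap_mul [Fintype α] [DecidableEq α] {x : Equiv.Perm α} {i j : α}
    (h : ¬ x.SameCycle i j) :
    (Equiv.swap i j * x).SameCycle i j := by
  obtain ⟨m, hm, h1, h2⟩ := exists_first_return x i j
  have h3 := swap_mul_pow_return hm h2
  rcases h1 with h1 | h1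
  · exact absurd (Equiv.Perm.SameCycle.symm ⟨m, by simpa using h1⟩) h
  · rw [h1, Equiv.swap_apply_right] at h3
    exact Equiv.Perm.SameCycle.symm ⟨m, by simpa using h3⟩

theorem not_sameCycle_swap_mul [Fintype α] [DecidableEq α] {x : Equiv.Perm α} {i j : α}
    (hij : i ≠ j) (h : x.SameCycle i j) :
    ¬ (Equiv.swap i j * x).SameCycle i j := by
  obtain ⟨m, hm, h1, h2⟩ := exists_first_return x i j
  have h3 := swap_mul_pow_return hm h2
  rcases h1 with h1 | h1
  · rw [h1, Equiv.swap_apply_left] at h3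
    refine fun hs => not_sameCycle_of_return hij.symm hm h3 (fun l hl hlm => ?_) hs.symm
    rw [swap_mul_pow_apply h2 l hlm]
    exact (h2 l hl hlm).1
  · exact absurd h.symm
      (not_sameCycle_of_return hij.symm hm h1 fun l hl hlm => (h2 l hl hlm).1)

/-- The functions which are constant on the cycles of `x`. Their dimension is the number of the
cycles of `x`, fixed points included. -/
def invariants (x : Equiv.Perm α) : Submodule ℚ (α → ℚ) where
  carrier := {f | ∀ k, f (x k) = f k}
  add_mem' hf hg k := by simp only [Pi.add_apply]; rw [hf k, hg k]
  zero_mem' _ := rfl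
  smul_mem' r f hf k := by simp only [Pi.smul_apply]; rw [hf k]

theorem mem_invariants {x : Equiv.Perm α} {f : α → ℚ} :
    f ∈ invariants x ↔ ∀ k, f (x k) = f k := Iff.rfl

theorem eq_of_mem_invariants [Fintype α] {x : Equiv.Perm α} {f : α → ℚ}
    (hf : f ∈ invariants x) {i j : α} (h : x.SameCycle i j) : f i = f j := by
  obtain ⟨k, -, rfl⟩ := h.exists_pow_eq'
  clear h
  induction k with
  | zero => rfl
  | succ k ih => rw [ih, pow_succ', Equiv.Perm.mul_apply, mem_invariants.1 hf]

/-- The number of cycles, fixed points included. -/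
def cycleCount (x : Equiv.Perm α) : ℕ := Module.finrank ℚ (invariants x)

theorem cycleCount_one [Fintype α] : cycleCount (1 : Equiv.Perm α) = Fintype.card α := by
  have : invariants (1 : Equiv.Perm α) = ⊤ := by
    refine eq_top_iff.2 fun f _ => mem_invariants.2 fun k => rfl
  rw [cycleCount, this, finrank_top, Module.finrank_fintype_fun_eq_card]

theorem cycleCount_le [Fintype α] (x : Equiv.Perm α) : cycleCount x ≤ Fintype.card α := by
  rw [← Module.finrank_fintype_fun_eq_card ℚ]
  exact Submodule.finrank_le _

/-- Multiplication by a transposition of elements of two cycles merges these cycles. -/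
theorem cycleCount_swap_mul [Fintype α] [DecidableEq α] {x : Equiv.Perm α} {i j : α}
    (h : ¬ x.SameCycle i j) :
    cycleCount (Equiv.swap i j * x) + 1 = cycleCount x := by
  classical
  have hswap : ∀ f : α → ℚ, f i = f j → ∀ k, f (Equiv.swap i j k) = f k := by
    intro f hf k
    rcases eq_or_ne k i with rfl | h1
    · rw [Equiv.swap_apply_left, hf]
    · rcases eq_or_ne k j with rfl | h2
      · rw [Equiv.swap_apply_right, hf]
      · rw [Equiv.swap_apply_of_ne_of_ne h1 h2]
  let φ : Module.Dual ℚ (invariants x) :=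
    ((LinearMap.proj i : (α → ℚ) →ₗ[ℚ] ℚ) - LinearMap.proj j).comp (invariants x).subtype
  have hφ : ∀ f : invariants x, φ f = f.1 i - f.1 j := fun f => rfl
  have hφ0 : φ ≠ 0 := by
    intro h0
    have hmem : (fun k => if x.SameCycle i k then (1 : ℚ) else 0) ∈ invariants x := by
      intro k
      simp [Equiv.Perm.sameCycle_apply_right]
    have := hφ ⟨_, hmem⟩
    rw [h0] at this
    simp [h, Equiv.Perm.SameCycle.refl] at this
  have hker : (LinearMap.ker φ).map (invariants x).subtype =
      invariants (Equiv.swap i j * x) := by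
    ext f
    simp only [Submodule.mem_map, LinearMap.mem_ker, Subtype.exists, hφ,
      Submodule.subtype_apply, exists_and_right, exists_eq_right]
    constructor
    · rintro ⟨hf, h1⟩ k
      rw [Equiv.Perm.mul_apply, hswap f (sub_eq_zero.1 h1), mem_invariants.1 hf]
    · intro hf
      have h1 := eq_of_mem_invariants hf (sameCycle_swap_mul h)
      refine ⟨fun k => ?_, sub_eq_zero.2 h1⟩
      rw [← hswap f h1, ← Equiv.Perm.mul_apply, mem_invariants.1 hf]
  rw [cycleCount, ← hker, Submodule.finrank_map_subtype_eq,
    Module.Dual.finrank_ker_add_one_of_ne_zero hφ0]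
  rfl

/-- Multiplication by a transposition of elements of one cycle splits this cycle. -/
theorem cycleCount_swap_mul' [Fintype α] [DecidableEq α] {x : Equiv.Perm α} {i j : α}
    (hij : i ≠ j) (h : x.SameCycle i j) :
    cycleCount (Equiv.swap i j * x) = cycleCount x + 1 := by
  have := cycleCount_swap_mul (not_sameCycle_swap_mul hij h)
  rw [Equiv.swap_mul_self_mul] at this
  exact this.symm

end Cycles

/-! ### Reflection length in the symmetric group -/

theorem mem_reflections_iff {t : Equiv.Perm (Fin (n + 1))} :
    t ∈ reflections (simpleA n) ↔ ∃ p q, p ≠ q ∧ t = Equiv.swap p q := by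
  constructor
  · rintro ⟨w, i, rfl⟩
    refine ⟨w i.castSucc, w i.succ, fun h => i.castSucc_lt_succ.ne (w.injective h), ?_⟩
    rw [Equiv.swap_apply_apply]
    rfl
  · rintro ⟨p, q, hpq, rfl⟩
    have hn : 0 < n := by
      rcases Nat.eq_zero_or_pos n with rfl | h
      · exact absurd (Subsingleton.elim (α := Fin 1) p q) hpq
      · exact h
    let i : Fin n := ⟨0, hn⟩
    set w₁ := Equiv.swap i.castSucc p
    have h1 : w₁ i.castSucc = p := Equiv.swap_apply_left _ _
    have h2 : p ≠ w₁ i.succ := by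
      rw [← h1]
      exact fun h => i.castSucc_lt_succ.ne (w₁.injective h)
    refine ⟨Equiv.swap (w₁ i.succ) q * w₁, i, ?_⟩
    have e := Equiv.swap_apply_apply (Equiv.swap (w₁ i.succ) q * w₁) i.castSucc i.succ
    rw [Equiv.Perm.mul_apply, Equiv.Perm.mul_apply, h1, Equiv.swap_apply_left,
      Equiv.swap_apply_of_ne_of_ne h2 hpq] at e
    exact e

theorem reflections_mul_self {t : Equiv.Perm (Fin (n + 1))} (ht : t ∈ reflections (simpleA n)) :
    t * t = 1 := by
  obtain ⟨p, q, -, rfl⟩ := mem_reflections_iff.1 ht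
  exact Equiv.swap_mul_self p q

theorem exists_reflection_lowering {w : Equiv.Perm (Fin (n + 1))} (hw : w ≠ 1) :
    ∃ t ∈ reflections (simpleA n),
      n + 1 - cycleCount (t * w) + 1 = n + 1 - cycleCount w := by
  obtain ⟨i, hi⟩ : ∃ i, w i ≠ i := by
    by_contra! h
    exact hw (Equiv.ext h)
  refine ⟨Equiv.swap i (w i), mem_reflections_iff.2 ⟨_, _, hi.symm, rfl⟩, ?_⟩
  have h1 := cycleCount_swap_mul' hi.symm
    (Equiv.Perm.sameCycle_apply_right.2 (Equiv.Perm.SameCycle.refl w i))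
  have h2 := cycleCount_le (Equiv.swap i (w i) * w)
  rw [Fintype.card_fin] at h2
  omega

/-- The reflection length is the number of labels minus the number of cycles. -/
theorem reflLength_add_cycleCount (x : Equiv.Perm (Fin (n + 1))) :
    reflLength (simpleA n) x + cycleCount x = n + 1 := by
  have h : reflLength (simpleA n) x = n + 1 - cycleCount x := by
    refine wordLength_eq_of_potential (f := fun x => n + 1 - cycleCount x)
      (fun t => reflections_mul_self) (fun w => exists_reflection_lowering)
      (by rw [cycleCount_one]; simp) ?_ x
    intro t ht w
    obtain ⟨p, q, hpq, rfl⟩ := mem_reflections_iff.1 ht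
    by_cases hs : w.SameCycle p q
    · have := cycleCount_swap_mul' hpq hs
      omega
    · have := cycleCount_swap_mul hs
      omega
  have := cycleCount_le x
  rw [Fintype.card_fin] at this
  omega

theorem reflLength_swap_mul {x : Equiv.Perm (Fin (n + 1))} {i j : Fin (n + 1)}
    (h : ¬ x.SameCycle i j) :
    reflLength (simpleA n) (Equiv.swap i j * x) = reflLength (simpleA n) x + 1 := by
  have h1 := cycleCount_swap_mul h
  have h2 := reflLength_add_cycleCount x
  have h3 := reflLength_add_cycleCount (Equiv.swap i j * x)
  omega

theorem reflLength_swap_mul_apply {x : Equiv.Perm (Fin (n + 1))} {i : Fin (n + 1)}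
    (h : x i ≠ i) :
    reflLength (simpleA n) (Equiv.swap i (x i) * x) + 1 = reflLength (simpleA n) x := by
  have h1 := cycleCount_swap_mul' h.symm
    (Equiv.Perm.sameCycle_apply_right.2 (Equiv.Perm.SameCycle.refl x i))
  have h2 := reflLength_add_cycleCount x
  have h3 := reflLength_add_cycleCount (Equiv.swap i (x i) * x)
  omega

theorem reflLength_mul_le (x y : Equiv.Perm (Fin (n + 1))) :
    reflLength (simpleA n) (x * y) ≤ reflLength (simpleA n) x + reflLength (simpleA n) y := by
  have hword : ∀ x : Equiv.Perm (Fin (n + 1)), ∃ l : List (Equiv.Perm (Fin (n + 1))),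
      (∀ t ∈ l, t ∈ reflections (simpleA n)) ∧ l.prod = x ∧
        l.length = reflLength (simpleA n) x := by
    intro x
    obtain ⟨l, h1, h2, h3⟩ := exists_word_of_potential (f := fun x => n + 1 - cycleCount x)
      (fun t => reflections_mul_self) (fun w => exists_reflection_lowering)
      (by rw [cycleCount_one]; simp) x
    have := reflLength_add_cycleCount x
    exact ⟨l, h1, h2, by omega⟩
  obtain ⟨l, h1, rfl, h3⟩ := hword x
  obtain ⟨l', h1', rfl, h3'⟩ := hword y
  rw [← h3, ← h3', ← List.length_append, ← List.prod_append]
  refine wordLength_prod_le fun t ht => ?_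
  rcases List.mem_append.1 ht with ht | ht
  exacts [h1 t ht, h1' t ht]

theorem reflLength_one : reflLength (simpleA n) 1 = 0 := by
  have := reflLength_add_cycleCount (1 : Equiv.Perm (Fin (n + 1)))
  rw [cycleCount_one, Fintype.card_fin] at this
  omega

theorem reflLength_swap_le (i j : Fin (n + 1)) :
    reflLength (simpleA n) (Equiv.swap i j) ≤ 1 := by
  rcases eq_or_ne i j with rfl | h
  · rw [Equiv.swap_self]
    exact (reflLength_one).le.trans zero_le_one
  · have := wordLength_prod_le (A := reflections (simpleA n)) (l := [Equiv.swap i j])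
      (by simpa using mem_reflections_iff.2 ⟨i, j, h, rfl⟩)
    simpa [reflLength] using this

/-! ### Noncrossing permutations -/

/-- `c` rotates the whole circle of labels: no label lies strictly between `i` and `c i`. -/
def IsRotation (R : Set (Fin (n + 1))) (c : Equiv.Perm (Fin (n + 1))) : Prop :=
  ∀ i j, ¬ Arc R i j (c i)

/-- The arcs from `i` to `x i` are stable under `x`. Equivalently, the cycles of `x` are pairwise
noncrossing and each of them is traversed clockwise. -/
def Noncrossing (R : Set (Fin (n + 1))) (x : Equiv.Perm (Fin (n + 1))) : Prop :=
  ∀ i j, Arc R i j (x i) → Arc R i (x j) (x i)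

theorem Noncrossing.sameCycle {R : Set (Fin (n + 1))} {x : Equiv.Perm (Fin (n + 1))}
    (hx : Noncrossing R x) {i j k : Fin (n + 1)} (h : Arc R i j (x i)) (hjk : x.SameCycle j k) :
    Arc R i k (x i) := by
  obtain ⟨m, -, rfl⟩ := hjk.exists_pow_eq'
  clear hjk
  induction m with
  | zero => exact h
  | succ m ih => rw [pow_succ', Equiv.Perm.mul_apply]; exact hx _ _ ih

theorem Noncrossing.not_sameCycle {R : Set (Fin (n + 1))} {x : Equiv.Perm (Fin (n + 1))}
    (hx : Noncrossing R x) {i j : Fin (n + 1)} (h : Arc R i j (x i)) : ¬ x.SameCycle i j := by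
  intro hs
  have := hx.sameCycle h hs.symm
  unfold Arc at this
  omega

/-- The transpositions `(i, x i)` and `(j, x j)` of two crossing arcs could be split off from `x`,
hence from `c`; but splitting `c` by the first one separates the ends of the second one. -/
theorem noncrossing_of_mem_NC {R : Set (Fin (n + 1))} (h0 : 0 ∈ R) {c x : Equiv.Perm (Fin (n + 1))}
    (hc : IsRotation R c) (hx : x ∈ NC (simpleA n) c) : Noncrossing R x := by
  intro i j hij
  by_contra hcr
  have hinj := @key_injective n R h0
  have hji : j ≠ i := by rintro rfl; unfold Arc at hij; omega
  have hxi : x i ≠ i := by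
    intro h
    rw [h] at hcr
    have h1 : x j ≠ i := fun h' => hji (x.injective (h'.trans h.symm))
    have h2 : key R (x j) ≠ key R i := fun h' => h1 (hinj h')
    unfold Arc at hcr
    omega
  have hci : c i ≠ i := by
    intro h
    have h1 := hc i j
    have h2 : key R j ≠ key R i := fun h' => hji (hinj h')
    rw [h] at h1
    unfold Arc at h1
    omega
  -- `z` is `c` with the transposition `(i, x i)` split off; it preserves the arc from `i` to `x i`
  set z := Equiv.swap i (x i) * c with hz
  have hstep : ∀ k, (k = i ∨ Arc R i k (x i)) → (z k = i ∨ Arc R i (z k) (x i)) := by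
    intro k hk
    by_cases e : c k = x i
    · left
      rw [hz, Equiv.Perm.mul_apply, e, Equiv.swap_apply_right]
    · have e' : c k ≠ i := by
        intro e'
        rcases hk with rfl | hk
        · exact hci e'
        · have h1 := hc k (x i)
          have h2 : key R (x i) ≠ key R i := fun h' => hxi (hinj h')
          rw [e'] at h1
          unfold Arc at hk h1
          omega
      right
      rw [hz, Equiv.Perm.mul_apply, Equiv.swap_apply_of_ne_of_ne e' e]
      have h1 := hc k i
      have h2 := hc k (x i)
      have h3 : key R (c k) ≠ key R i := fun h' => e' (hinj h')
      have h4 : key R (c k) ≠ key R (x i) := fun h' => e (hinj h')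
      have h5 : key R (x i) ≠ key R i := fun h' => hxi (hinj h')
      rcases hk with rfl | hk
      · unfold Arc at *
        omega
      · unfold Arc at *
        omega
  set x' := Equiv.swap i (x i) * x with hx'
  have hx'j : ¬ (x' j = i ∨ Arc R i (x' j) (x i)) := by
    have h2 : x j ≠ x i := fun h => hji (x.injective h)
    by_cases e : x j = i
    · rw [hx', Equiv.Perm.mul_apply, e, Equiv.swap_apply_left]
      unfold Arc
      omega
    · rw [hx', Equiv.Perm.mul_apply, Equiv.swap_apply_of_ne_of_ne e h2]
      exact not_or.2 ⟨e, hcr⟩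
  have hns : ¬ z.SameCycle j (x' j) := by
    intro hs
    obtain ⟨m, -, hm⟩ := hs.exists_pow_eq'
    apply hx'j
    rw [← hm]
    clear hm
    induction m with
    | zero => exact Or.inr hij
    | succ m ih => rw [pow_succ', Equiv.Perm.mul_apply]; exact hstep _ ih
  have hjx' : x' j ≠ j := by
    intro h
    rw [h] at hx'j
    exact hx'j (Or.inr hij)
  have l1 := reflLength_swap_mul hns
  have l2 := reflLength_swap_mul_apply hjx'
  have l3 := reflLength_swap_mul_apply hxi
  rw [← hx'] at l3
  have l4 := reflLength_mul_le (Equiv.swap i (x i)) z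
  rw [hz, Equiv.swap_mul_self_mul, ← hz] at l4
  have l5 := reflLength_swap_le i (x i)
  have l6 := reflLength_mul_le (Equiv.swap j (x' j) * x') (x⁻¹ * c)
  have e : Equiv.swap j (x' j) * x' * (x⁻¹ * c) = Equiv.swap j (x' j) * z := by
    rw [hx', hz]
    group
  rw [e] at l6
  have l7 : reflLength (simpleA n) x + reflLength (simpleA n) (x⁻¹ * c) =
    reflLength (simpleA n) c := hx
  omega

set_option maxHeartbeats 600000 in
/-- If `x i ≠ c i`, the cycles of `i` and of `c i` can be merged without creating a crossing. -/
theorem Noncrossing.merge {R : Set (Fin (n + 1))} (h0 : 0 ∈ R) {c x : Equiv.Perm (Fin (n + 1))}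
    (hc : IsRotation R c) (hx : Noncrossing R x) {i : Fin (n + 1)} (hi : x i ≠ c i) :
    ¬ x.SameCycle (x i) (c i) ∧ Noncrossing R (Equiv.swap (x i) (c i) * x) := by
  have hinj := @key_injective n R h0
  have hci : c i ≠ i := by
    intro h
    have h1 := hc i (x i)
    have h2 : key R (x i) ≠ key R i := fun h' => hi ((hinj h').trans h.symm)
    rw [h] at h1
    unfold Arc at h1
    omega
  have hArc : Arc R i (c i) (x i) := by
    have h1 := hc i (x i)
    have h2 : key R (c i) ≠ key R i := fun h' => hci (hinj h')
    have h3 : key R (x i) ≠ key R (c i) := fun h' => hi (hinj h')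
    unfold Arc at *
    omega
  obtain ⟨p, hp⟩ := x.surjective (c i)
  have hpi : p ≠ i := by rintro rfl; exact hi hp
  have hpArc : Arc R i p (x i) := by
    refine hx.sameCycle hArc ?_
    rw [← hp]
    exact Equiv.Perm.sameCycle_apply_left.2 (Equiv.Perm.SameCycle.refl x p)
  refine ⟨fun h => hx.not_sameCycle hArc (Equiv.Perm.sameCycle_apply_left.1 h), ?_⟩
  have hval : ∀ k, (k = i ∧ (Equiv.swap (x i) (c i) * x) k = c i) ∨
      (k = p ∧ (Equiv.swap (x i) (c i) * x) k = x i) ∨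
      (k ≠ i ∧ k ≠ p ∧ (Equiv.swap (x i) (c i) * x) k = x k) := by
    intro k
    rw [Equiv.Perm.mul_apply]
    by_cases h1 : k = i
    · exact Or.inl ⟨h1, by rw [h1, Equiv.swap_apply_left]⟩
    · by_cases h2 : k = p
      · exact Or.inr (Or.inl ⟨h2, by rw [h2, hp, Equiv.swap_apply_right]⟩)
      · refine Or.inr (Or.inr ⟨h1, h2, Equiv.swap_apply_of_ne_of_ne ?_ ?_⟩)
        · exact fun h => h1 (x.injective h)
        · exact fun h => h2 (x.injective (h.trans hp.symm))
  intro a b hab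
  rcases hval a with ⟨rfl, ea⟩ | ⟨rfl, ea⟩ | ⟨ha1, ha2, ea⟩
  · rw [ea] at hab
    exact absurd hab (hc _ _)
  · rw [ea] at hab ⊢
    rcases hval b with ⟨rfl, eb⟩ | ⟨rfl, eb⟩ | ⟨hb1, hb2, eb⟩
    · rw [eb]
      unfold Arc at hab hpArc
      omega
    · unfold Arc at hab
      omega
    · rw [eb]
      have k1 : key R b ≠ key R i := fun h => hb1 (hinj h)
      have k2 : key R a ≠ key R i := fun h => hpi (hinj h)
      have k3 : key R (x b) ≠ key R (c i) := fun h => hb2 (x.injective ((hinj h).trans hp.symm))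
      have h1 : Arc R i (x b) (x i) := by
        refine hx i b ?_
        unfold Arc at *
        omega
      have h2 : Arc R a (x b) (c i) := by
        rw [← hp]
        refine hx a b ?_
        rw [hp]
        have := hc i b
        have := hc i a
        unfold Arc at *
        omega
      have h3 := hc i (x b)
      clear k1 k3 hval ea eb hci hArc hi
      unfold Arc at h1 h2 h3 hpArc ⊢
      generalize key R a = A at *
      generalize key R i = I at *
      generalize key R (x i) = I' at *
      generalize key R (x b) = B at *
      generalize key R (c i) = C at *
      omega
  · rw [ea] at hab ⊢
    have k1 : key R a ≠ key R i := fun h => ha1 (hinj h)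
    have k2 : key R (x a) ≠ key R (c i) := fun h => ha2 (x.injective ((hinj h).trans hp.symm))
    have k3 := hc i a
    have k4 := hc i (x a)
    rcases hval b with ⟨rfl, eb⟩ | ⟨rfl, eb⟩ | ⟨hb1, hb2, eb⟩
    · rw [eb]
      unfold Arc at hab k3 k4 ⊢
      omega
    · rw [eb]
      refine hx a i ?_
      have h1 := hx a b hab
      rw [hp] at h1
      unfold Arc at h1 k3 k4 ⊢
      omega
    · rw [eb]
      exact hx a b hab

/-- Merging cycles one after the other leads from `x` to `c` along a geodesic of the reflection
length. -/
theorem mem_NC_of_noncrossing {R : Set (Fin (n + 1))} (h0 : 0 ∈ R) {c x : Equiv.Perm (Fin (n + 1))}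
    (hc : IsRotation R c) (hx : Noncrossing R x) : x ∈ NC (simpleA n) c := by
  induction hd : cycleCount x using Nat.strong_induction_on generalizing x with
  | _ d ih =>
    by_cases hxc : x = c
    · subst hxc
      change _ + _ = _
      rw [inv_mul_cancel, reflLength_one, add_zero]
    · obtain ⟨i, hi⟩ : ∃ i, x i ≠ c i := by
        by_contra! h
        exact hxc (Equiv.ext h)
      obtain ⟨h1, h2⟩ := hx.merge h0 hc hi
      have h3 := cycleCount_swap_mul h1
      have h4 : reflLength (simpleA n) _ + reflLength (simpleA n) _ = reflLength (simpleA n) c :=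
        ih _ (by omega) h2 rfl
      have h5 := reflLength_swap_mul h1
      have h6 := reflLength_mul_le x (x⁻¹ * c)
      rw [mul_inv_cancel_left] at h6
      have h7 := reflLength_mul_le (Equiv.swap (x⁻¹ (x i)) (x⁻¹ (c i)))
        ((Equiv.swap (x i) (c i) * x)⁻¹ * c)
      have e : Equiv.swap (x⁻¹ (x i)) (x⁻¹ (c i)) * ((Equiv.swap (x i) (c i) * x)⁻¹ * c) =
          x⁻¹ * c := by
        rw [Equiv.swap_apply_apply, mul_inv_rev, Equiv.swap_inv, inv_inv]
        simp only [mul_assoc, mul_inv_cancel_left, Equiv.swap_mul_self_mul]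
      rw [e] at h7
      have h8 := reflLength_swap_le (x⁻¹ (x i)) (x⁻¹ (c i))
      change reflLength (simpleA n) x + reflLength (simpleA n) (x⁻¹ * c) =
        reflLength (simpleA n) c
      omega

/-! ### The Coxeter element as a rotation of the circle -/

theorem simpleA_comm {i k : Fin n} (h : (i : ℕ) + 1 < k) :
    simpleA n i * simpleA n k = simpleA n k * simpleA n i := by
  have h1 : simpleA n k i.castSucc = i.castSucc := by
    refine simpleA_of_ne ?_ ?_ <;> simp only [ne_eq, Fin.ext_iff, Fin.val_castSucc, Fin.val_succ] <;>
      omega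
  have h2 : simpleA n k i.succ = i.succ := by
    refine simpleA_of_ne ?_ ?_ <;> simp only [ne_eq, Fin.ext_iff, Fin.val_castSucc, Fin.val_succ] <;>
      omega
  have h3 := swap_conj k i.castSucc i.succ
  rw [h1, h2] at h3
  change simpleA n k * simpleA n i * simpleA n k = simpleA n i at h3
  calc simpleA n i * simpleA n k = simpleA n k * simpleA n i * simpleA n k * simpleA n k := by
        rw [h3]
    _ = simpleA n k * simpleA n i := by rw [mul_assoc, simpleA_mul_self, mul_one]

theorem wordProd_append (ω ω' : List (Fin n)) :
    wordProd (simpleA n) (ω ++ ω') = wordProd (simpleA n) ω * wordProd (simpleA n) ω' := by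
  simp [wordProd]

theorem wordProd_comm {k : Fin n} {ω : List (Fin n)} (h : ∀ i ∈ ω, (i : ℕ) + 1 < k) :
    wordProd (simpleA n) ω * simpleA n k = simpleA n k * wordProd (simpleA n) ω := by
  induction ω with
  | nil => simp [wordProd]
  | cons i ω ih =>
    rw [wordProd_cons, mul_assoc, ih fun j hj => h j (List.mem_cons_of_mem _ hj), ← mul_assoc,
      simpleA_comm (h i List.mem_cons_self), mul_assoc]

/-- The product, in the order `a`, of the simple transpositions of the labels up to `m`; a standard
Coxeter element of the symmetric group of these labels. -/
def partialCoxeter (a : Equiv.Perm (Fin n)) (m : ℕ) : Equiv.Perm (Fin (n + 1)) :=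
  wordProd (simpleA n) ((List.ofFn a).filter fun i => (i : ℕ) < m)

theorem partialCoxeter_zero (a : Equiv.Perm (Fin n)) : partialCoxeter a 0 = 1 := by
  simp [partialCoxeter, wordProd]

theorem partialCoxeter_self (a : Equiv.Perm (Fin n)) :
    partialCoxeter a n = coxeterElement (simpleA n) a := by
  rw [partialCoxeter, coxeterElement]
  congr 1
  rw [List.filter_eq_self]
  simp

/-- `R` is the set of the labels `k` for which `(k - 1, k)` comes before `(k, k + 1)` in the
order `a`, together with the smallest and the biggest label. -/
structure IsSide (a : Equiv.Perm (Fin n)) (R : Set (Fin (n + 1))) : Prop where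
  zero : 0 ∈ R
  last : Fin.last n ∈ R
  iff : ∀ k' k : Fin n, (k' : ℕ) + 1 = k → (k.castSucc ∈ R ↔ a.symm k' < a.symm k)

/-- The letter `k` commutes with all smaller letters but `k - 1`, so only its place relative to `k -
1` matters. -/
theorem partialCoxeter_succ {a : Equiv.Perm (Fin n)} {R : Set (Fin (n + 1))} (hR : IsSide a R)
    (k : Fin n) :
    (k.castSucc ∈ R → partialCoxeter a (k + 1) = partialCoxeter a k * simpleA n k) ∧
    (k.castSucc ∉ R → partialCoxeter a (k + 1) = simpleA n k * partialCoxeter a k) := by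
  have hk : k ∈ List.ofFn a := by
    rw [List.mem_ofFn]
    exact ⟨a.symm k, by simp⟩
  have hord : (List.ofFn a).Pairwise fun i j => a.symm i < a.symm j := by
    rw [List.pairwise_ofFn]
    intro i j hij
    simpa using hij
  obtain ⟨l₁, l₂, hl⟩ := List.append_of_mem hk
  rw [hl, List.pairwise_append, List.pairwise_cons] at hord
  obtain ⟨-, ⟨h2, -⟩, h1⟩ := hord
  have h1 : ∀ i ∈ l₁, a.symm i < a.symm k := fun i hi => h1 i hi k List.mem_cons_self
  have hf : ∀ l : List (Fin n), k ∉ l → (l.filter fun i : Fin n => (i : ℕ) < (k : ℕ) + 1) =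
      l.filter fun i : Fin n => (i : ℕ) < k := by
    intro l hkl
    refine List.filter_congr fun i hi => ?_
    have : (i : ℕ) ≠ k := fun h => hkl (by rwa [← Fin.ext h])
    simp only [decide_eq_decide]
    omega
  have e1 : partialCoxeter a (k + 1) = wordProd (simpleA n) (l₁.filter fun i => (i : ℕ) < k) *
      (simpleA n k * wordProd (simpleA n) (l₂.filter fun i => (i : ℕ) < k)) := by
    rw [partialCoxeter, hl, List.filter_append, List.filter_cons_of_pos (by simp),
      hf l₁ fun h => lt_irrefl _ (h1 k h), hf l₂ fun h => lt_irrefl _ (h2 k h), wordProd_append,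
      wordProd_cons]
  have e2 : partialCoxeter a k = wordProd (simpleA n) (l₁.filter fun i => (i : ℕ) < k) *
      wordProd (simpleA n) (l₂.filter fun i => (i : ℕ) < k) := by
    rw [partialCoxeter, hl, List.filter_append, List.filter_cons_of_neg (by simp),
      wordProd_append]
  rw [e1, e2]
  constructor
  · intro h
    rw [mul_assoc, wordProd_comm]
    intro i hi
    obtain ⟨hi1, hi2⟩ := List.mem_filter.1 hi
    rw [decide_eq_true_eq] at hi2
    by_contra hc
    exact lt_asymm ((hR.iff i k (by omega)).1 h) (h2 i hi1)
  · intro h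
    rw [← mul_assoc, wordProd_comm, mul_assoc]
    intro i hi
    obtain ⟨hi1, hi2⟩ := List.mem_filter.1 hi
    rw [decide_eq_true_eq] at hi2
    by_contra hc
    exact h ((hR.iff i k (by omega)).2 (h1 i hi1))

theorem key_insert {R : Set (Fin (n + 1))} {m : Fin (n + 1)} (x : Fin (n + 1)) :
    (x = m ∧ key (insert m R) x = x) ∨ (x ≠ m ∧ key (insert m R) x = key R x) := by
  by_cases h : x = m
  · exact Or.inl ⟨h, by simp [key, h]⟩
  · have : x ∈ insert m R ↔ x ∈ R := by simp [h]
    exact Or.inr ⟨h, by unfold key; split_ifs <;> tauto⟩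

/-- The partial products rotate the smaller circles, on which the biggest label `m` counts as a
label on the right. -/
theorem partialCoxeter_rotates {a : Equiv.Perm (Fin n)} {R : Set (Fin (n + 1))} (hR : IsSide a R)
    (m : Fin (n + 1)) :
    (∀ i, m < i → partialCoxeter a m i = i) ∧ (∀ i, i ≤ m → partialCoxeter a m i ≤ m) ∧
      ∀ i j, i ≤ m → j ≤ m → ¬ Arc (insert m R) i j (partialCoxeter a m i) := by
  induction m using Fin.induction with
  | zero =>
    rw [Fin.val_zero, partialCoxeter_zero]
    refine ⟨fun i _ => rfl, fun i hi => hi, fun i j hi hj => ?_⟩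
    rw [Fin.le_zero_iff.1 hi, Fin.le_zero_iff.1 hj, Equiv.Perm.one_apply]
    unfold Arc
    omega
  | succ k ih =>
    obtain ⟨ih1, ih2, ih3⟩ := ih
    rw [Fin.val_castSucc] at ih1 ih2 ih3
    rw [Fin.val_succ]
    obtain ⟨hs1, hs2⟩ := partialCoxeter_succ hR k
    set c := partialCoxeter a k with hc
    have hkn := k.is_lt
    have hfix : c k.succ = k.succ := ih1 _ k.castSucc_lt_succ
    have hkey : ∀ x : Fin (n + 1), x ≤ k.succ →
        (x = k.castSucc ∧ (x : ℕ) = k ∧ key (insert k.castSucc R) x = k ∧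
          (k.castSucc ∈ R ∧ key (insert k.succ R) x = k ∨
            k.castSucc ∉ R ∧ key (insert k.succ R) x + k = 2 * n)) ∨
        (x = k.succ ∧ (x : ℕ) = k + 1 ∧ key (insert k.succ R) x = k + 1) ∨
        (x < k.castSucc ∧ (x : ℕ) < k ∧ key (insert k.succ R) x = key (insert k.castSucc R) x ∧
          (key (insert k.succ R) x < k ∨ 2 * n < key (insert k.succ R) x + k)) := by
      intro x hx
      have h1 := key_insert (R := R) (m := k.castSucc) x
      have h2 := key_insert (R := R) (m := k.succ) x
      have h3 := key_cases hR.zero x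
      simp only [ne_eq, Fin.ext_iff, Fin.le_def, Fin.lt_def, Fin.val_castSucc, Fin.val_succ]
        at h1 h2 hx ⊢
      rcases lt_trichotomy (x : ℕ) k with h | h | h
      · right; right
        omega
      · have : k.castSucc = x := Fin.ext (by simp [h])
        rw [this]
        grind
      · right; left
        omega
    by_cases hkR : k.castSucc ∈ R
    · have hval : ∀ x, x ≤ k.succ → (x = k.castSucc ∧ (c * simpleA n k) x = k.succ) ∨
          (x = k.succ ∧ (c * simpleA n k) x = c k.castSucc) ∨
          (x < k.castSucc ∧ (c * simpleA n k) x = c x) := by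
        intro x hx
        rw [Equiv.Perm.mul_apply]
        rcases simpleA_cases k x with ⟨h, e⟩ | ⟨h, e⟩ | ⟨h, h', e⟩
        · exact Or.inl ⟨h, by rw [e, hfix]⟩
        · exact Or.inr (Or.inl ⟨h, by rw [e]⟩)
        · refine Or.inr (Or.inr ⟨lt_of_le_of_ne ?_ h, by rw [e]⟩)
          exact Fin.le_castSucc_iff.2 (lt_of_le_of_ne hx h')
      rw [hs1 hkR]
      refine ⟨fun i hi => ?_, fun i hi => ?_, fun i j hi hj => ?_⟩
      · rw [Equiv.Perm.mul_apply, simpleA_of_ne (k.castSucc_lt_succ.trans hi).ne' hi.ne',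
          ih1 i (k.castSucc_lt_succ.trans hi)]
      · rcases hval i hi with ⟨-, e⟩ | ⟨-, e⟩ | ⟨h, e⟩
        · rw [e]
        · rw [e]
          exact (ih2 _ le_rfl).trans k.castSucc_lt_succ.le
        · rw [e]
          exact (ih2 _ h.le).trans k.castSucc_lt_succ.le
      · have kj := hkey j hj
        have hjle : j ≤ k.castSucc ∨ j = k.succ := by
          rcases hj.eq_or_lt with h | h
          · exact Or.inr h
          · exact Or.inl (Fin.le_castSucc_iff.2 h)
        have kk := hkey k.castSucc k.castSucc_lt_succ.le
        rcases hval i hi with ⟨rfl, e⟩ | ⟨rfl, e⟩ | ⟨h, e⟩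
        · rw [e]
          have kα := hkey k.succ le_rfl
          have := Fin.val_castSucc k
          have := Fin.val_succ k
          unfold Arc
          simp only [hkR, true_and, not_true, false_and, or_false] at *
          omega
        · rw [e]
          have kα := hkey k.succ le_rfl
          have kc := hkey (c k.castSucc) ((ih2 _ le_rfl).trans k.castSucc_lt_succ.le)
          have hc1 := ih2 _ (le_refl k.castSucc)
          have hA := ih3 k.castSucc j le_rfl
          simp only [hkR, true_and, not_true, false_and, or_false] at *
          simp only [Fin.le_def, Fin.lt_def, Fin.ext_iff, Fin.val_castSucc, Fin.val_succ] at *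
          unfold Arc at *
          omega
        · rw [e]
          have ki := hkey i hi
          have kc := hkey (c i) ((ih2 _ h.le).trans k.castSucc_lt_succ.le)
          have hc1 := ih2 i h.le
          have hA := ih3 i j h.le
          have hA' := ih3 i k.castSucc h.le le_rfl
          simp only [hkR, true_and, not_true, false_and, or_false] at *
          simp only [Fin.le_def, Fin.lt_def, Fin.ext_iff, Fin.val_castSucc, Fin.val_succ] at *
          unfold Arc at *
          omega
    · have hcval : ∀ x, x ≤ k.castSucc → (c x = k.castSucc ∧ (simpleA n k * c) x = k.succ) ∨
          (c x < k.castSucc ∧ (simpleA n k * c) x = c x) := by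
        intro x hx
        have h1 := ih2 x hx
        rw [Equiv.Perm.mul_apply]
        rcases simpleA_cases k (c x) with ⟨h, e⟩ | ⟨h, e⟩ | ⟨h, h', e⟩
        · exact Or.inl ⟨h, e⟩
        · rw [h] at h1
          exact absurd h1 (not_le.2 k.castSucc_lt_succ)
        · exact Or.inr ⟨lt_of_le_of_ne h1 h, e⟩
      have hval : ∀ x, x ≤ k.succ → (x = k.succ ∧ (simpleA n k * c) x = k.castSucc) ∨
          (x ≤ k.castSucc ∧ c x = k.castSucc ∧ (simpleA n k * c) x = k.succ) ∨
          (x ≤ k.castSucc ∧ c x < k.castSucc ∧ (simpleA n k * c) x = c x) := by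
        intro x hx
        rcases hx.eq_or_lt with h | h
        · left
          exact ⟨h, by rw [h, Equiv.Perm.mul_apply, hfix, simpleA_succ]⟩
        · right
          have h := Fin.le_castSucc_iff.2 h
          rcases hcval x h with h' | h'
          exacts [Or.inl ⟨h, h'⟩, Or.inr ⟨h, h'⟩]
      rw [hs2 hkR]
      refine ⟨fun i hi => ?_, fun i hi => ?_, fun i j hi hj => ?_⟩
      · rw [Equiv.Perm.mul_apply, ih1 i (k.castSucc_lt_succ.trans hi),
          simpleA_of_ne (k.castSucc_lt_succ.trans hi).ne' hi.ne']
      · rcases hval i hi with ⟨-, e⟩ | ⟨-, -, e⟩ | ⟨-, h, e⟩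
        · rw [e]
          exact k.castSucc_lt_succ.le
        · rw [e]
        · rw [e]
          exact (h.trans k.castSucc_lt_succ).le
      · have kj := hkey j hj
        rcases hval i hi with ⟨rfl, e⟩ | ⟨h, hci, e⟩ | ⟨h, hci, e⟩
        · rw [e]
          have kα := hkey k.succ le_rfl
          have kk := hkey k.castSucc k.castSucc_lt_succ.le
          simp only [hkR, true_and, not_false_iff, false_and, false_or] at *
          simp only [Fin.le_def, Fin.lt_def, Fin.ext_iff, Fin.val_castSucc, Fin.val_succ] at *
          unfold Arc at *
          omega
        · rw [e]
          have kα := hkey k.succ le_rfl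
          have kk := hkey k.castSucc k.castSucc_lt_succ.le
          have ki := hkey i hi
          have hA := ih3 i j h
          rw [hci] at hA
          simp only [hkR, true_and, not_false_iff, false_and, false_or] at *
          simp only [Fin.le_def, Fin.lt_def, Fin.ext_iff, Fin.val_castSucc, Fin.val_succ] at *
          unfold Arc at *
          omega
        · rw [e]
          have ki := hkey i hi
          have kc := hkey (c i) (hci.trans k.castSucc_lt_succ).le
          have hA := ih3 i j h
          have hA' := ih3 i k.castSucc h le_rfl
          have kk := hkey k.castSucc k.castSucc_lt_succ.le
          simp only [hkR, true_and, not_false_iff, false_and, false_or] at *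
          simp only [Fin.le_def, Fin.lt_def, Fin.ext_iff, Fin.val_castSucc, Fin.val_succ] at *
          unfold Arc at *
          omega

theorem IsSide.isRotation {a : Equiv.Perm (Fin n)} {R : Set (Fin (n + 1))} (hR : IsSide a R) :
    IsRotation R (coxeterElement (simpleA n) a) := by
  intro i j
  have := (partialCoxeter_rotates hR (Fin.last n)).2.2 i j (Fin.le_last i) (Fin.le_last j)
  rwa [Fin.val_last, partialCoxeter_self, Set.insert_eq_of_mem hR.last] at this

theorem IsRotation.apply_mem {R : Set (Fin (n + 1))} (h0 : 0 ∈ R) (hl : Fin.last n ∈ R)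
    {c : Equiv.Perm (Fin (n + 1))} (hc : IsRotation R c) {i : Fin (n + 1)} (hi : i ∈ R)
    (hin : i ≠ Fin.last n) : c i ∈ R := by
  have h1 := hc i (Fin.last n)
  have h2 := key_cases h0 i
  have h3 := key_cases h0 (c i)
  have h4 : key R (Fin.last n) = n := by simp [key, hl]
  have h5 : (i : ℕ) ≠ n := fun h => hin (Fin.ext h)
  by_contra hcR
  have h6 : ((c i : Fin (n + 1)) : ℕ) ≠ n := fun h => hcR (by
    rwa [show c i = Fin.last n from Fin.ext h])
  simp only [hi, true_and, not_true, false_and, or_false] at h2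
  simp only [hcR, false_and, not_false_iff, true_and, false_or] at h3
  unfold Arc at h1
  omega

/-- The labels on the right form an increasing sequence under the rotation `c`. -/
theorem IsRotation.exists_pred {R : Set (Fin (n + 1))} (h0 : 0 ∈ R)
    {c : Equiv.Perm (Fin (n + 1))} (hc : IsRotation R c) {i : Fin (n + 1)} (hi : i ∈ R)
    (hi0 : i ≠ 0) : ∃ j ∈ R, j < i ∧ c j = i := by
  obtain ⟨j, rfl⟩ := c.surjective i
  have h1 := hc j 0
  have h2 := key_cases h0 j
  have h3 := key_cases h0 (c j)
  have h4 : key R 0 = 0 := by simp [key, h0]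
  have h5 : ((c j : Fin (n + 1)) : ℕ) ≠ 0 := fun h => hi0 (Fin.ext h)
  simp only [hi, true_and, not_true, false_and, or_false] at h3
  refine ⟨j, ?_, ?_, rfl⟩
  · by_contra hcR
    simp only [hcR, false_and, not_false_iff, true_and, false_or] at h2
    unfold Arc at h1
    omega
  · rw [Fin.lt_def]
    unfold Arc at h1
    omega

/-- The labels on the right as defined by the cycle `c` are those given by the word of `c`. -/
theorem IsRotation.rightLabels_eq {R : Set (Fin (n + 1))} (h0 : 0 ∈ R) (hl : Fin.last n ∈ R)
    {c : Equiv.Perm (Fin (n + 1))} (hc : IsRotation R c) : rightLabels c = R := by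
  ext i
  constructor
  · rintro ⟨m, rfl, hm⟩
    induction m with
    | zero => exact h0
    | succ m ih =>
      rw [pow_succ', Equiv.Perm.mul_apply]
      exact hc.apply_mem h0 hl (ih fun m' hm' => hm m' (by omega)) (hm m (by omega))
  · intro hi
    induction i using WellFoundedLT.induction with
    | _ i ih =>
      rcases eq_or_ne i 0 with rfl | hi0
      · exact ⟨0, rfl, by simp⟩
      · obtain ⟨j, hj, hji, rfl⟩ := hc.exists_pred h0 hi hi0
        obtain ⟨m, hm, hm'⟩ := ih j hji hj
        refine ⟨m + 1, by rw [pow_succ', Equiv.Perm.mul_apply, hm], fun m' hlt => ?_⟩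
        rcases Nat.lt_succ_iff_lt_or_eq.1 hlt with h | rfl
        · exact hm' m' h
        · rw [hm]
          exact (hji.trans_le (Fin.le_last _)).ne

theorem isSide_sideAt (a : Equiv.Perm (Fin n)) (hn : 0 < n) :
    IsSide a (sideAt (infiniteWord a hn) 0) := by
  refine ⟨Or.inl rfl, Or.inr (Or.inl rfl), fun k' k hk => ?_⟩
  have e : k.castSucc = k'.succ := Fin.ext (by simp [hk])
  rw [e, succ_mem_sideAt_iff hk]
  have hval : ∀ j : Fin n, infiniteWord a hn (a.symm j) = j := by
    intro j
    simp [infiniteWord, Nat.mod_eq_of_lt (a.symm j).is_lt]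
  have hle : ∀ m j, infiniteWord a hn m = j → ((a.symm j : Fin n) : ℕ) ≤ m := by
    rintro m j rfl
    simp only [infiniteWord, Equiv.symm_apply_apply]
    exact Nat.mod_le _ _
  constructor
  · rintro ⟨m, -, h1, h2⟩
    by_contra hc
    exact h2 _ (Nat.zero_le _) ((Fin.le_def.1 (not_lt.1 hc)).trans (hle m k' h1)) (hval k)
  · intro h
    refine ⟨a.symm k', Nat.zero_le _, hval k', fun m' _ h1 h2 => ?_⟩
    exact absurd (hle m' k h2) (by rw [Fin.lt_def] at h; omega)

/-! ### Polygons in the plane -/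

/-- The height of the label `i`. For `n = 0` the quotient has the junk value `0`, and the only label
is at the top. -/
def height (i : Fin (n + 1)) : ℝ := 1 - 2 * (i : ℝ) / n

theorem height_mem (i : Fin (n + 1)) : -1 ≤ height i ∧ height i ≤ 1 := by
  have h : (i : ℝ) ≤ n := by exact_mod_cast Nat.lt_succ_iff.1 i.is_lt
  have h0 : (0 : ℝ) ≤ i := Nat.cast_nonneg _
  have h1 : 2 * (i : ℝ) / n ≤ 2 := by
    rw [mul_div_assoc]
    have := div_le_one_of_le₀ h (h0.trans h)
    linarith
  have h2 : 0 ≤ 2 * (i : ℝ) / n := by positivity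
  constructor <;> unfold height <;> linarith

theorem height_lt {i j : Fin (n + 1)} (h : i < j) : height j < height i := by
  have hn : (0 : ℝ) < n := by
    have := j.is_lt
    have := Fin.lt_def.1 h
    exact_mod_cast (by omega : 0 < n)
  have h' : (i : ℝ) < j := by exact_mod_cast Fin.lt_def.1 h
  unfold height
  have : 2 * (i : ℝ) / n < 2 * (j : ℝ) / n := by gcongr
  linarith

theorem le_of_height_le {i j : Fin (n + 1)} (h : height j ≤ height i) : i ≤ j :=
  not_lt.1 fun h' => absurd (height_lt h') (not_lt.2 h)

open Classical in
/-- The angle, measured clockwise from the top of the circle, at which the label `i` is placed. -/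
def angle (R : Set (Fin (n + 1))) (i : Fin (n + 1)) : ℝ :=
  if i ∈ R then Real.arccos (height i) else 2 * Real.pi - Real.arccos (height i)

theorem point_eq (c : Equiv.Perm (Fin (n + 1))) (i : Fin (n + 1)) :
    point c i = (Real.sin (angle (rightLabels c) i), Real.cos (angle (rightLabels c) i)) := by
  obtain ⟨h1, h2⟩ := height_mem i
  unfold point angle
  simp only
  split_ifs
  · rw [Real.sin_arccos, Real.cos_arccos h1 h2]
    rfl
  · rw [Real.sin_two_pi_sub, Real.cos_two_pi_sub, Real.sin_arccos, Real.cos_arccos h1 h2]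
    rfl

theorem point_snd (c : Equiv.Perm (Fin (n + 1))) (i : Fin (n + 1)) :
    (point c i).2 = height i := rfl

theorem angle_cases {R : Set (Fin (n + 1))} (h0 : 0 ∈ R) (hl : Fin.last n ∈ R)
    (i : Fin (n + 1)) :
    (i ∈ R ∧ angle R i = Real.arccos (height i) ∧ 0 ≤ angle R i ∧ angle R i ≤ Real.pi) ∨
    (i ∉ R ∧ angle R i = 2 * Real.pi - Real.arccos (height i) ∧ Real.pi < angle R i ∧
      angle R i < 2 * Real.pi) := by
  by_cases h : i ∈ R
  · refine Or.inl ⟨h, ?_⟩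
    rw [angle, if_pos h]
    exact ⟨rfl, Real.arccos_nonneg _, Real.arccos_le_pi _⟩
  · refine Or.inr ⟨h, ?_⟩
    have hi0 : (0 : Fin (n + 1)) < i := by
      rw [Fin.pos_iff_ne_zero]; rintro rfl; exact h h0
    have hil : i < Fin.last n := lt_of_le_of_ne (Fin.le_last i) (by rintro rfl; exact h hl)
    have h1 : 0 < Real.arccos (height i) :=
      Real.arccos_pos.2 ((height_lt hi0).trans_le (height_mem _).2)
    have h2 : Real.arccos (height i) < Real.pi := by
      refine lt_of_le_of_ne (Real.arccos_le_pi _) fun h => ?_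
      rw [Real.arccos_eq_pi] at h
      have h3 := height_lt hil
      have h4 := (height_mem (Fin.last n)).1
      linarith
    rw [angle, if_neg h]
    exact ⟨rfl, by linarith, by linarith⟩

theorem angle_lt {R : Set (Fin (n + 1))} (h0 : 0 ∈ R) (hl : Fin.last n ∈ R)
    {i j : Fin (n + 1)} (h : key R i < key R j) : angle R i < angle R j := by
  have hi := key_cases h0 i
  have hj := key_cases h0 j
  have harc : ∀ {i j : Fin (n + 1)}, (i : ℕ) < j →
      Real.arccos (height i) < Real.arccos (height j) := fun {i j} hij =>
    Real.strictAntiOn_arccos ⟨(height_mem j).1, (height_mem j).2⟩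
      ⟨(height_mem i).1, (height_mem i).2⟩ (height_lt (Fin.lt_def.2 hij))
  rcases angle_cases h0 hl i with ⟨hiR, ei, -, ei'⟩ | ⟨hiR, ei, -, -⟩ <;>
  rcases angle_cases h0 hl j with ⟨hjR, ej, -, -⟩ | ⟨hjR, ej, ej', -⟩ <;>
  simp only [hiR, hjR, true_and, not_true, false_and, or_false, not_false_iff, false_or] at hi hj
  · rw [ei, ej]
    exact harc (by omega)
  · linarith
  · omega
  · have := harc (i := j) (j := i) (by omega)
    linarith

theorem angle_bounds {R : Set (Fin (n + 1))} (h0 : 0 ∈ R) (hl : Fin.last n ∈ R)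
    (i : Fin (n + 1)) : 0 ≤ angle R i ∧ angle R i < 2 * Real.pi := by
  have := Real.pi_pos
  rcases angle_cases h0 hl i with ⟨-, -, h1, h2⟩ | ⟨-, -, h1, h2⟩ <;> constructor <;> linarith

/-- An affine function of `z` which vanishes on the line through `p` and `q` and is positive on
its right when one walks from `q` up to `p`. -/
def sideOfLine (p q z : ℝ × ℝ) : ℝ := (z.1 - p.1) * (p.2 - q.2) - (q.1 - p.1) * (p.2 - z.2)

/-- Twice the signed area of a triangle inscribed in the unit circle. -/
theorem sideOfLine_circle (α β γ : ℝ) :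
    sideOfLine (Real.sin α, Real.cos α) (Real.sin β, Real.cos β) (Real.sin γ, Real.cos γ) =
      4 * Real.sin ((γ - α) / 2) * Real.sin ((β - γ) / 2) * Real.sin ((β - α) / 2) := by
  have h : Real.sin ((β - γ) / 2) = Real.sin ((α + β) / 2) * Real.cos ((γ + α) / 2) -
      Real.cos ((α + β) / 2) * Real.sin ((γ + α) / 2) := by
    rw [← Real.sin_sub]; congr 1; ring
  have h1 : Real.sin ((α - β) / 2) = - Real.sin ((β - α) / 2) := by
    rw [← Real.sin_neg]; congr 1; ring
  have h2 : Real.sin ((α - γ) / 2) = - Real.sin ((γ - α) / 2) := by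
    rw [← Real.sin_neg]; congr 1; ring
  simp only [sideOfLine]
  rw [Real.sin_sub_sin, Real.sin_sub_sin, Real.cos_sub_cos, Real.cos_sub_cos, h, h1, h2,
    add_comm β α, add_comm α γ]
  ring

theorem sideOfLine_swap (p q z : ℝ × ℝ) : sideOfLine q p z = - sideOfLine p q z := by
  unfold sideOfLine; ring

section

variable {c : Equiv.Perm (Fin (n + 1))} {R : Set (Fin (n + 1))}

/-- The labels inside the clockwise arc from `i` to `k` are on one side of the chord. -/
theorem sideOfLine_pos (h0 : 0 ∈ R) (hl : Fin.last n ∈ R) (hR : rightLabels c = R)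
    {i j k : Fin (n + 1)} (hik : i ≠ k) (h : Arc R i j k) :
    0 < sideOfLine (point c i) (point c k) (point c j) := by
  rw [point_eq, point_eq, point_eq, hR, sideOfLine_circle]
  have hi := angle_bounds h0 hl i
  have hj := angle_bounds h0 hl j
  have hk := angle_bounds h0 hl k
  have hpos : ∀ {a b : Fin (n + 1)}, key R a < key R b →
      0 < Real.sin ((angle R b - angle R a) / 2) := by
    intro a b hab
    have := angle_lt h0 hl hab
    have ha := angle_bounds h0 hl a
    have hb := angle_bounds h0 hl b
    refine Real.sin_pos_of_pos_of_lt_pi ?_ ?_ <;> linarith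
  have hneg : ∀ a b : ℝ, Real.sin ((a - b) / 2) = - Real.sin ((b - a) / 2) := by
    intro a b
    rw [← Real.sin_neg]; congr 1; ring
  have hne : key R k ≠ key R i := fun h => hik (key_injective h0 h).symm
  rcases h with ⟨h1, h2⟩ | ⟨h1, h2⟩ | ⟨h1, h2⟩
  · have := hpos h1
    have := hpos h2
    have := hpos (h1.trans h2)
    positivity
  · have h1 := lt_of_le_of_ne h1 hne
    rw [hneg (angle R k) (angle R j), hneg (angle R k) (angle R i)]
    have := hpos h1
    have := hpos h2
    have := hpos (h1.trans h2)
    simp only [mul_neg, neg_mul, neg_neg]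
    positivity
  · have h2 := lt_of_le_of_ne h2 hne
    rw [hneg (angle R j) (angle R i), hneg (angle R k) (angle R i)]
    have := hpos h1
    have := hpos h2
    have := hpos (h1.trans h2)
    simp only [mul_neg, neg_mul, neg_neg]
    positivity

theorem sideOfLine_nonpos (h0 : 0 ∈ R) (hl : Fin.last n ∈ R) (hR : rightLabels c = R)
    {i j k : Fin (n + 1)} (hik : i ≠ k) (h : ¬ Arc R i j k) :
    sideOfLine (point c i) (point c k) (point c j) ≤ 0 := by
  by_cases hji : j = i
  · rw [hji]; unfold sideOfLine; apply le_of_eq; ring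
  by_cases hjk : j = k
  · rw [hjk]; unfold sideOfLine; apply le_of_eq; ring
  have h1 : key R i ≠ key R k := fun h => hik (key_injective h0 h)
  have h2 : key R j ≠ key R i := fun h => hji (key_injective h0 h)
  have h3 : key R j ≠ key R k := fun h => hjk (key_injective h0 h)
  have h4 : Arc R k j i := by unfold Arc at *; omega
  have h5 := sideOfLine_pos h0 hl hR hik.symm h4
  rw [sideOfLine_swap] at h5
  linarith

theorem convex_sideOfLine_nonpos (p q : ℝ × ℝ) : Convex ℝ {z | sideOfLine p q z ≤ 0} := by
  have h : IsLinearMap ℝ fun z : ℝ × ℝ => z.1 * (p.2 - q.2) + (q.1 - p.1) * z.2 :=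
    ⟨fun x y => by simp only [Prod.fst_add, Prod.snd_add]; ring,
      fun r x => by simp only [Prod.smul_fst, Prod.smul_snd, smul_eq_mul]; ring⟩
  have e : {z | sideOfLine p q z ≤ 0} = {z : ℝ × ℝ | z.1 * (p.2 - q.2) + (q.1 - p.1) * z.2 ≤
      p.1 * (p.2 - q.2) + (q.1 - p.1) * p.2} := by
    apply Set.ext
    intro z
    simp only [Set.mem_ofPred_eq, sideOfLine]
    constructor <;> intro h <;> linarith
  rw [e]
  exact convex_halfSpace_le h _

theorem convex_sideOfLine_pos (p q : ℝ × ℝ) : Convex ℝ {z | 0 < sideOfLine p q z} := by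
  have h : IsLinearMap ℝ fun z : ℝ × ℝ => z.1 * (p.2 - q.2) + (q.1 - p.1) * z.2 :=
    ⟨fun x y => by simp only [Prod.fst_add, Prod.snd_add]; ring,
      fun r x => by simp only [Prod.smul_fst, Prod.smul_snd, smul_eq_mul]; ring⟩
  have e : {z | 0 < sideOfLine p q z} = {z : ℝ × ℝ | p.1 * (p.2 - q.2) + (q.1 - p.1) * p.2 <
      z.1 * (p.2 - q.2) + (q.1 - p.1) * z.2} := by
    apply Set.ext
    intro z
    simp only [Set.mem_ofPred_eq, sideOfLine]
    constructor <;> intro h <;> linarith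
  rw [e]
  exact convex_halfSpace_gt h _

theorem region_subset {P : Finset (Fin (n + 1))} {S : Set (ℝ × ℝ)} (hS : Convex ℝ S)
    (h : ∀ p ∈ P, point c p ∈ S) : region c P ⊆ S :=
  convexHull_min (by rintro _ ⟨p, hp, rfl⟩; exact h p hp) hS

theorem point_mem_region {P : Finset (Fin (n + 1))} {p : Fin (n + 1)} (hp : p ∈ P) :
    point c p ∈ region c P := subset_convexHull ℝ _ ⟨p, hp, rfl⟩

theorem exists_mem_region {P : Finset (Fin (n + 1))} {p q : Fin (n + 1)} (hp : p ∈ P) (hq : q ∈ P)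
    {h : ℝ} (h1 : height q ≤ h) (h2 : h ≤ height p) : ∃ u, (u, h) ∈ region c P := by
  have hconv : Convex ℝ (LinearMap.snd ℝ ℝ ℝ '' region c P) :=
    (convex_convexHull ℝ _).linear_image _
  have hmem : h ∈ LinearMap.snd ℝ ℝ ℝ '' region c P :=
    hconv.ordConnected.out ⟨_, point_mem_region hq, rfl⟩ ⟨_, point_mem_region hp, rfl⟩ ⟨h1, h2⟩
  obtain ⟨⟨u, v⟩, hz, rfl⟩ := hmem
  exact ⟨u, hz⟩

theorem exists_height_le {P : Finset (Fin (n + 1))} {u h : ℝ} (hu : (u, h) ∈ region c P) :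
    (∃ p ∈ P, height p ≤ h) ∧ ∃ p ∈ P, h ≤ height p := by
  have hlin : IsLinearMap ℝ fun z : ℝ × ℝ => z.2 := ⟨fun _ _ => rfl, fun _ _ => rfl⟩
  constructor
  · by_contra! hc
    exact lt_irrefl h (region_subset (convex_halfSpace_gt hlin h) (fun p hp => hc p hp) hu)
  · by_contra! hc
    exact lt_irrefl h (region_subset (convex_halfSpace_lt hlin h) (fun p hp => hc p hp) hu)

/-! ### Noncrossing polygons -/

/-- No two vertices of `P` separate two vertices of `Q` on the circle. -/
def NotCrossing (R : Set (Fin (n + 1))) (P Q : Finset (Fin (n + 1))) : Prop :=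
  ∀ p₁ ∈ P, ∀ p₂ ∈ P, ∀ q₁ ∈ Q, ∀ q₂ ∈ Q, p₁ ≠ p₂ → Arc R p₁ q₁ p₂ → ¬ Arc R p₂ q₂ p₁

theorem NotCrossing.symm (h0 : 0 ∈ R) {P Q : Finset (Fin (n + 1))} (h : NotCrossing R P Q) :
    NotCrossing R Q P := by
  intro q₁ hq₁ q₂ hq₂ p₁ hp₁ p₂ hp₂ hne h1 h2
  have hne' : key R q₁ ≠ key R q₂ := fun h => hne (key_injective h0 h)
  have hp : p₁ ≠ p₂ := by
    rintro rfl
    unfold Arc at h1 h2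
    omega
  refine h p₁ hp₁ p₂ hp₂ q₂ hq₂ q₁ hq₁ hp ?_ ?_ <;> unfold Arc at * <;> omega

/-- The vertices of `P` next to a point `q` of the circle. -/
theorem exists_neighbours (h0 : 0 ∈ R) {P : Finset (Fin (n + 1))} (hP : P.Nonempty)
    {q : Fin (n + 1)} (hq : q ∉ P) :
    ∃ i ∈ P, ∃ k ∈ P, Arc R i q k ∧ ∀ p ∈ P, ¬ Arc R i p k := by
  have hne : ∀ p ∈ P, key R p ≠ key R q := fun p hp h => hq (key_injective h0 h ▸ hp)
  have hle : ∀ p, key R p ≤ 2 * n := fun p => by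
    have := key_cases h0 p
    omega
  obtain ⟨i, hi, hi'⟩ := P.exists_min_image
    (fun p => if key R p < key R q then key R q - key R p else key R q + (2 * n + 1) - key R p) hP
  obtain ⟨k, hk, hk'⟩ := P.exists_min_image
    (fun p => if key R q < key R p then key R p - key R q else key R p + (2 * n + 1) - key R q) hP
  have ni := hne i hi
  have nk := hne k hk
  have li := hle i
  have lk := hle k
  have lq := hle q
  refine ⟨i, hi, k, hk, ?_, fun p hp => ?_⟩
  · have h1 := hi' k hk
    have h2 := hk' i hi
    unfold Arc
    split_ifs at h1 h2 <;> omega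
  · have h1 := hi' p hp
    have h2 := hk' p hp
    have np := hne p hp
    have lp := hle p
    unfold Arc
    split_ifs at h1 h2 <;> omega

/-- The combinatorial form of "`Q` lies strictly at the right of `P`": some vertex of `Q` on the
right side of the circle, or some vertex of `P` on the left side, lies between the heights of two
vertices of the other polygon. -/
def RightOf (R : Set (Fin (n + 1))) (Q P : Finset (Fin (n + 1))) : Prop :=
  (∃ q ∈ Q, q ∈ R ∧ ∃ p₁ ∈ P, ∃ p₂ ∈ P, p₁ < q ∧ q < p₂) ∨
    ∃ p ∈ P, p ∉ R ∧ ∃ q₁ ∈ Q, ∃ q₂ ∈ Q, q₁ < p ∧ p < q₂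

/-- The line through the vertices of `P` next to a vertex of `Q` on the right side separates the two
polygons, and likewise with `P` and `Q` exchanged. -/
theorem RightOf.lt (h0 : 0 ∈ R) (hl : Fin.last n ∈ R) (hR : rightLabels c = R)
    {P Q : Finset (Fin (n + 1))} (hd : Disjoint P Q) (hnc : NotCrossing R P Q)
    (h : RightOf R Q P) {t u v : ℝ} (hu : (u, t) ∈ region c P) (hv : (v, t) ∈ region c Q) :
    u < v := by
  rcases h with ⟨q, hq, hqR, p₁, hp₁, p₂, hp₂, h1, h2⟩ | ⟨p, hp, hpR, q₁, hq₁, q₂, hq₂, h1, h2⟩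
  · have hqP : q ∉ P := fun h => Finset.disjoint_left.1 hd h hq
    obtain ⟨i, hi, k, hk, hA, hP⟩ := exists_neighbours h0 ⟨p₁, hp₁⟩ hqP
    have hik : i < k := by
      have a1 := hP p₁ hp₁
      have a2 := hP p₂ hp₂
      have ki := key_cases h0 i
      have kk := key_cases h0 k
      have kq := key_cases h0 q
      have k1 := key_cases h0 p₁
      have k2 := key_cases h0 p₂
      have ni : (i : ℕ) ≠ q := fun h => hqP (Fin.ext h ▸ hi)
      have nk : (k : ℕ) ≠ q := fun h => hqP (Fin.ext h ▸ hk)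
      simp only [hqR, true_and, not_true, false_and, or_false] at kq
      rw [Fin.lt_def] at *
      unfold Arc at *
      have b1 : (i : ℕ) < q := by
        clear a2 k2 nk
        omega
      have b2 : (q : ℕ) < k := by
        clear a1 k1 ni
        omega
      omega
    have hQ : ∀ q' ∈ Q, Arc R i q' k := by
      intro q' hq'
      by_contra hc
      have n1 : key R q' ≠ key R i := fun h =>
        Finset.disjoint_left.1 hd hi (key_injective h0 h ▸ hq')
      have n2 : key R q' ≠ key R k := fun h =>
        Finset.disjoint_left.1 hd hk (key_injective h0 h ▸ hq')
      refine hnc i hi k hk q hq q' hq' hik.ne hA ?_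
      unfold Arc at *
      omega
    have e1 := region_subset (convex_sideOfLine_nonpos (point c i) (point c k))
      (fun p hp => sideOfLine_nonpos h0 hl hR hik.ne (hP p hp)) hu
    have e2 := region_subset (convex_sideOfLine_pos (point c i) (point c k))
      (fun p hp => sideOfLine_pos h0 hl hR hik.ne (hQ p hp)) hv
    have e3 := height_lt hik
    simp only [Set.mem_ofPred_eq, sideOfLine, point_snd] at e1 e2
    have e4 : 0 < (v - u) * (height i - height k) := by linarith
    linarith [(pos_iff_pos_of_mul_pos e4).2 (by linarith)]
  · have hpQ : p ∉ Q := fun h => Finset.disjoint_left.1 hd hp h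
    obtain ⟨i, hi, k, hk, hA, hQ⟩ := exists_neighbours h0 ⟨q₁, hq₁⟩ hpQ
    have hik : k < i := by
      have a1 := hQ q₁ hq₁
      have a2 := hQ q₂ hq₂
      have ki := key_cases h0 i
      have kk := key_cases h0 k
      have kq := key_cases h0 p
      have k1 := key_cases h0 q₁
      have k2 := key_cases h0 q₂
      have ni : (i : ℕ) ≠ p := fun h => hpQ (Fin.ext h ▸ hi)
      have nk : (k : ℕ) ≠ p := fun h => hpQ (Fin.ext h ▸ hk)
      simp only [hpR, false_and, not_false_iff, true_and, false_or] at kq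
      rw [Fin.lt_def] at *
      unfold Arc at *
      have b1 : (p : ℕ) < i := by
        clear a1 k1 nk
        omega
      have b2 : (k : ℕ) < p := by
        clear a2 k2 ni
        omega
      omega
    have hP : ∀ p' ∈ P, Arc R i p' k := by
      intro p' hp'
      by_contra hc
      have n1 : key R p' ≠ key R i := fun h =>
        Finset.disjoint_right.1 hd hi (key_injective h0 h ▸ hp')
      have n2 : key R p' ≠ key R k := fun h =>
        Finset.disjoint_right.1 hd hk (key_injective h0 h ▸ hp')
      refine hnc.symm h0 i hi k hk p hp p' hp' hik.ne' hA ?_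
      unfold Arc at *
      omega
    have e1 := region_subset (convex_sideOfLine_nonpos (point c i) (point c k))
      (fun p hp => sideOfLine_nonpos h0 hl hR hik.ne' (hQ p hp)) hv
    have e2 := region_subset (convex_sideOfLine_pos (point c i) (point c k))
      (fun p hp => sideOfLine_pos h0 hl hR hik.ne' (hP p hp)) hu
    have e3 := height_lt hik
    simp only [Set.mem_ofPred_eq, sideOfLine, point_snd] at e1 e2
    have e4 : 0 < (v - u) * (height k - height i) := by linarith
    linarith [(pos_iff_pos_of_mul_pos e4).2 (by linarith)]

theorem RightOf.strictlyRight (h0 : 0 ∈ R) (hl : Fin.last n ∈ R) (hR : rightLabels c = R)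
    {P Q : Finset (Fin (n + 1))} (hd : Disjoint P Q) (hnc : NotCrossing R P Q)
    (h : RightOf R Q P) : StrictlyRight c Q P := by
  have hlt := fun t u v => h.lt h0 hl hR hd hnc (t := t) (u := u) (v := v)
  rcases h with ⟨q, hq, hqR, p₁, hp₁, p₂, hp₂, h1, h2⟩ | ⟨p, hp, hpR, q₁, hq₁, q₂, hq₂, h1, h2⟩
  · exact ⟨height q, exists_mem_region hp₁ hp₂ (height_lt h2).le (height_lt h1).le,
      ⟨_, point_mem_region hq⟩, hlt _⟩
  · exact ⟨height p, ⟨_, point_mem_region hp⟩,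
      exists_mem_region hq₁ hq₂ (height_lt h2).le (height_lt h1).le, hlt _⟩

/-- Two disjoint polygons which meet a common horizontal line are comparable: a vertex of one of
them is between the heights of two vertices of the other one, and the side of this vertex decides.
-/
theorem rightOf_or_rightOf {P Q : Finset (Fin (n + 1))} (hd : Disjoint P Q)
    {p p' q q' : Fin (n + 1)} (hp : p ∈ P) (hp' : p' ∈ P) (hq : q ∈ Q) (hq' : q' ∈ Q)
    (h1 : p ≤ q) (h2 : q' ≤ p') : RightOf R Q P ∨ RightOf R P Q := by
  have ne : ∀ a ∈ P, ∀ b ∈ Q, a ≠ b := fun a ha b hb h =>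
    Finset.disjoint_left.1 hd ha (h ▸ hb)
  have l1 := lt_of_le_of_ne h1 (ne p hp q hq)
  have l2 := lt_of_le_of_ne h2 (ne p' hp' q' hq').symm
  rcases lt_or_gt_of_ne (ne p hp q' hq') with l3 | l3
  · by_cases hR : q' ∈ R
    · exact Or.inl (Or.inl ⟨q', hq', hR, p, hp, p', hp', l3, l2⟩)
    · exact Or.inr (Or.inr ⟨q', hq', hR, p, hp, p', hp', l3, l2⟩)
  · by_cases hR : p ∈ R
    · exact Or.inr (Or.inl ⟨p, hp, hR, q', hq', q, hq, l3, l1⟩)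
    · exact Or.inl (Or.inr ⟨p, hp, hR, q', hq', q, hq, l3, l1⟩)

/-- For noncrossing polygons, the geometric relation is the combinatorial one. -/
theorem strictlyRight_iff (h0 : 0 ∈ R) (hl : Fin.last n ∈ R) (hR : rightLabels c = R)
    {P Q : Finset (Fin (n + 1))} (hd : Disjoint P Q) (hnc : NotCrossing R P Q) :
    StrictlyRight c Q P ↔ RightOf R Q P := by
  refine ⟨?_, fun h => h.strictlyRight h0 hl hR hd hnc⟩
  rintro ⟨t, ⟨u, hu⟩, ⟨v, hv⟩, hlt⟩
  obtain ⟨⟨p, hp, hpt⟩, p', hp', hpt'⟩ := exists_height_le hu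
  obtain ⟨⟨q, hq, hqt⟩, q', hq', hqt'⟩ := exists_height_le hv
  rcases rightOf_or_rightOf (R := R) hd hp' hp hq hq' (le_of_height_le (hqt.trans hpt'))
    (le_of_height_le (hpt.trans hqt')) with h | h
  · exact h
  · exact absurd (hlt u v hu hv) (lt_asymm (h.lt h0 hl hR hd.symm (hnc.symm h0) hv hu))

end

/-! ### The order of the polygons -/

section

variable {c : Equiv.Perm (Fin (n + 1))} {R : Set (Fin (n + 1))}

/-- The members of `A` are nonempty, pairwise disjoint and pairwise noncrossing. -/
structure IsNoncrossingFamily (R : Set (Fin (n + 1))) (A : Finset (Finset (Fin (n + 1)))) :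
    Prop where
  nonempty : ∀ P ∈ A, P.Nonempty
  disjoint : ∀ P ∈ A, ∀ Q ∈ A, P ≠ Q → Disjoint P Q
  notCrossing : ∀ P ∈ A, ∀ Q ∈ A, P ≠ Q → NotCrossing R P Q

theorem IsNoncrossingFamily.mono {A B : Finset (Finset (Fin (n + 1)))}
    (hA : IsNoncrossingFamily R A) (h : B ⊆ A) : IsNoncrossingFamily R B :=
  ⟨fun P hP => hA.nonempty P (h hP), fun P hP Q hQ => hA.disjoint P (h hP) Q (h hQ),
    fun P hP Q hQ => hA.notCrossing P (h hP) Q (h hQ)⟩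

/-- If `Q` lies strictly at the right of `P`, the two polygons meet a common horizontal line. -/
theorem StrictlyRight.overlap {P Q : Finset (Fin (n + 1))} (h : StrictlyRight c Q P) :
    (∃ p ∈ P, ∃ q ∈ Q, p ≤ q) ∧ ∃ p ∈ P, ∃ q ∈ Q, q ≤ p := by
  obtain ⟨t, ⟨u, hu⟩, ⟨v, hv⟩, -⟩ := h
  obtain ⟨⟨p, hp, hpt⟩, p', hp', hpt'⟩ := exists_height_le hu
  obtain ⟨⟨q, hq, hqt⟩, q', hq', hqt'⟩ := exists_height_le hv
  exact ⟨⟨p', hp', q, hq, le_of_height_le (hqt.trans hpt')⟩,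
    ⟨p, hp, q', hq', le_of_height_le (hpt.trans hqt')⟩⟩

/-- Some polygon has no polygon strictly at its right. If `P` is the polygon whose smallest label
is biggest and `F` is free among the other polygons, then `F` or `P` is free: a polygon `Q` at the
right of `P`, which is at the right of `F`, would be at the right of `F`, since all three meet the
horizontal line through the smallest label of `P`. -/
theorem exists_free (h0 : 0 ∈ R) (hl : Fin.last n ∈ R) (hR : rightLabels c = R)
    {A : Finset (Finset (Fin (n + 1)))} (hA : IsNoncrossingFamily R A) (hne : A.Nonempty) :
    ∃ P, Free c A P := by
  induction A using Finset.strongInduction with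
  | H A ih =>
    obtain ⟨P, hP, hmax⟩ := A.exists_max_image (fun P => P.min) hne
    obtain ⟨p₀, hp₀⟩ := Finset.min_of_nonempty (hA.nonempty P hP)
    have hp₀P : p₀ ∈ P := Finset.mem_of_min hp₀
    have hlow : ∀ Q ∈ A, ∃ q ∈ Q, q ≤ p₀ := fun Q hQ => by
      obtain ⟨q, hq⟩ := Finset.min_of_nonempty (hA.nonempty Q hQ)
      refine ⟨q, Finset.mem_of_min hq, ?_⟩
      have := hmax Q hQ
      rw [hq, hp₀] at this
      exact WithTop.coe_le_coe.1 this
    by_cases hPf : Free c A P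
    · exact ⟨P, hPf⟩
    obtain ⟨Q, hQ, hQP, hQs⟩ : ∃ Q ∈ A, Q ≠ P ∧ StrictlyRight c Q P := by
      by_contra! hc
      exact hPf ⟨hP, hc⟩
    obtain ⟨F, hF, hFf⟩ := ih (A.erase P) (Finset.erase_ssubset hP)
      (hA.mono (Finset.erase_subset _ _)) ⟨Q, Finset.mem_erase.2 ⟨hQP, hQ⟩⟩
    obtain ⟨hFP, hFA⟩ := Finset.mem_erase.1 hF
    refine ⟨F, hFA, fun Q' hQ' hQF' hs => ?_⟩
    rcases eq_or_ne Q' P with rfl | hQP'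
    · have hup : ∀ S ∈ A, (∃ q ∈ Q', ∃ s ∈ S, q ≤ s) → ∃ u, (u, height p₀) ∈ region c S := by
        rintro S hS ⟨q, hq, s, hs, hqs⟩
        obtain ⟨s', hs', hs''⟩ := hlow S hS
        have hle : p₀ ≤ q := Finset.min_le_of_eq hq hp₀
        refine exists_mem_region hs' hs ?_ ?_
        · exact (hle.trans hqs).eq_or_lt.elim (fun h => h ▸ le_rfl) fun h => (height_lt h).le
        · exact hs''.eq_or_lt.elim (fun h => h ▸ le_rfl) fun h => (height_lt h).le
      have dF := hA.disjoint F hFA _ hP hFP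
      have cF := hA.notCrossing F hFA _ hP hFP
      have dQ := hA.disjoint _ hP Q hQ hQP.symm
      have cQ := hA.notCrossing _ hP Q hQ hQP.symm
      have hl₁ : ∀ u v, (u, height p₀) ∈ region c F → (v, height p₀) ∈ region c Q → u < v :=
        fun u v hu hv =>
          (((strictlyRight_iff h0 hl hR dF cF).1 hs).lt h0 hl hR dF cF hu
            (point_mem_region hp₀P)).trans
          (((strictlyRight_iff h0 hl hR dQ cQ).1 hQs).lt h0 hl hR dQ cQ (point_mem_region hp₀P) hv)
      obtain ⟨u, hu⟩ : ∃ u, (u, height p₀) ∈ region c F := by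
        refine hup F hFA ?_
        obtain ⟨-, f, hf, q, hq, hfq⟩ := hs.overlap
        exact ⟨q, hq, f, hf, hfq⟩
      have hv := hup Q hQ hQs.overlap.1
      refine hFf Q (Finset.mem_erase.2 ⟨hQP, hQ⟩) ?_ ⟨_, ⟨u, hu⟩, hv, hl₁⟩
      rintro rfl
      exact lt_irrefl _ (hl₁ u u hu hu)
    · exact hFf Q' (Finset.mem_erase.2 ⟨hQP', hQ'⟩) hQF' hs

theorem exists_isFirst (h0 : 0 ∈ R) (hl : Fin.last n ∈ R) (hR : rightLabels c = R)
    {A : Finset (Finset (Fin (n + 1)))} (hA : IsNoncrossingFamily R A) (hne : A.Nonempty) :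
    ∃ P, IsFirst c A P := by
  classical
  obtain ⟨P, hP⟩ := exists_free h0 hl hR hA hne
  obtain ⟨F, hF, hmin⟩ := (A.filter (Free c A)).exists_min_image (fun P => P.max)
    ⟨P, Finset.mem_filter.2 ⟨hP.1, hP⟩⟩
  exact ⟨F, (Finset.mem_filter.1 hF).2, fun Q hQ => hmin Q (Finset.mem_filter.2 ⟨hQ.1, hQ⟩)⟩

theorem IsFirst.eq {A : Finset (Finset (Fin (n + 1)))} (hA : IsNoncrossingFamily R A)
    {P Q : Finset (Fin (n + 1))} (hP : IsFirst c A P) (hQ : IsFirst c A Q) : P = Q := by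
  have hmax := le_antisymm (hP.2 Q hQ.1) (hQ.2 P hP.1)
  obtain ⟨p, hp⟩ := Finset.max_of_nonempty (hA.nonempty P hP.1.1)
  by_contra hne
  exact Finset.disjoint_left.1 (hA.disjoint P hP.1.1 Q hQ.1.1 hne) (Finset.mem_of_max hp)
    (Finset.mem_of_max (hmax ▸ hp))

theorem exists_isPolygonOrder (h0 : 0 ∈ R) (hl : Fin.last n ∈ R) (hR : rightLabels c = R)
    {A : Finset (Finset (Fin (n + 1)))} (hA : IsNoncrossingFamily R A) :
    ∃ l, IsPolygonOrder c A l := by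
  induction A using Finset.strongInduction with
  | H A ih =>
    rcases A.eq_empty_or_nonempty with rfl | hne
    · exact ⟨[], .nil⟩
    · obtain ⟨P, hP⟩ := exists_isFirst h0 hl hR hA hne
      obtain ⟨l, hl⟩ := ih _ (Finset.erase_ssubset hP.1.1) (hA.mono (Finset.erase_subset _ _))
      exact ⟨P :: l, .cons hP hl⟩

theorem IsPolygonOrder.eq {A : Finset (Finset (Fin (n + 1)))} (hA : IsNoncrossingFamily R A)
    {l l' : List (Finset (Fin (n + 1)))} (h : IsPolygonOrder c A l) (h' : IsPolygonOrder c A l') :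
    l = l' := by
  induction h generalizing l' with
  | nil =>
    cases h' with
    | nil => rfl
    | cons hP _ => exact absurd hP.1.1 (Finset.notMem_empty _)
  | cons hP _ ih =>
    cases h' with
    | nil => exact absurd hP.1.1 (Finset.notMem_empty _)
    | cons hP' h' =>
      obtain rfl := hP.eq hA hP'
      rw [ih (hA.mono (Finset.erase_subset _ _)) h']

theorem IsPolygonOrder.mem_iff {A : Finset (Finset (Fin (n + 1)))}
    {l : List (Finset (Fin (n + 1)))} (h : IsPolygonOrder c A l) (P : Finset (Fin (n + 1))) :
    P ∈ l ↔ P ∈ A := by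
  induction h with
  | nil => simp
  | @cons A Q l hQ _ ih =>
    rw [List.mem_cons, ih, Finset.mem_erase]
    rcases eq_or_ne P Q with rfl | hne
    · simp [hQ.1.1]
    · simp [hne]

theorem IsPolygonOrder.nodup {A : Finset (Finset (Fin (n + 1)))}
    {l : List (Finset (Fin (n + 1)))} (h : IsPolygonOrder c A l) : l.Nodup := by
  induction h with
  | nil => exact List.nodup_nil
  | cons hQ h ih => exact List.nodup_cons.2 ⟨by rw [h.mem_iff]; simp, ih⟩

theorem IsPolygonOrder.pairwise {A : Finset (Finset (Fin (n + 1)))}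
    {l : List (Finset (Fin (n + 1)))} (h : IsPolygonOrder c A l) :
    l.Pairwise fun P Q => ¬ StrictlyRight c Q P := by
  induction h with
  | nil => exact List.Pairwise.nil
  | cons hQ h ih =>
    refine List.pairwise_cons.2 ⟨fun Q hQl => ?_, ih⟩
    have := Finset.mem_erase.1 ((h.mem_iff Q).1 hQl)
    exact hQ.1.2 Q this.2 this.1

/-- The last label of a polygon is smaller than the first label of the next polygon: the next
polygon was not taken before, hence it has a bigger maximum or it was blocked by the first one. -/
theorem IsPolygonOrder.isChain {A : Finset (Finset (Fin (n + 1)))}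
    (hA : IsNoncrossingFamily R A) {l : List (Finset (Fin (n + 1)))} (h : IsPolygonOrder c A l) :
    l.IsChain fun P Q => ∃ p ∈ P, ∃ q ∈ Q, p < q := by
  induction h with
  | nil => exact List.IsChain.nil
  | @cons A P l hP h ih =>
    replace ih := ih (hA.mono (Finset.erase_subset _ _))
    generalize hB : A.erase P = B at h ih
    cases h with
    | nil => exact List.IsChain.singleton _
    | @cons _ Q _ hQ h' =>
      subst hB
      refine List.isChain_cons_cons.2 ⟨?_, ih⟩
      obtain ⟨hQP, hQA⟩ := Finset.mem_erase.1 hQ.1.1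
      have hd := hA.disjoint P hP.1.1 Q hQA hQP.symm
      obtain ⟨p, hp, q, hq, hpq⟩ : ∃ p ∈ P, ∃ q ∈ Q, p ≤ q := by
        by_cases hs : StrictlyRight c P Q
        · obtain ⟨-, q, hq, p, hp, hpq⟩ := hs.overlap
          exact ⟨p, hp, q, hq, hpq⟩
        · obtain ⟨p, hp⟩ := Finset.max_of_nonempty (hA.nonempty P hP.1.1)
          obtain ⟨q, hq⟩ := Finset.max_of_nonempty (hA.nonempty Q hQA)
          refine ⟨p, Finset.mem_of_max hp, q, Finset.mem_of_max hq, ?_⟩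
          have hle := hP.2 Q ⟨hQA, fun S hS hSQ => ?_⟩
          · rw [hp, hq] at hle
            exact WithBot.coe_le_coe.1 hle
          · rcases eq_or_ne S P with rfl | hSP
            · exact hs
            · exact hQ.1.2 S (Finset.mem_erase.2 ⟨hSP, hS⟩) hSQ
      exact ⟨p, hp, q, hq, lt_of_le_of_ne hpq fun h => Finset.disjoint_left.1 hd hp (h ▸ hq)⟩

end

/-! ### The line notation given by the polygons -/

section

variable {c x w : Equiv.Perm (Fin (n + 1))} {R : Set (Fin (n + 1))}

/-- The polygon of `x` which contains the label `i`. -/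
def polygon (x : Equiv.Perm (Fin (n + 1))) (i : Fin (n + 1)) : Finset (Fin (n + 1)) :=
  Finset.univ.filter fun j => x.SameCycle i j

theorem mem_polygon {i j : Fin (n + 1)} : j ∈ polygon x i ↔ x.SameCycle i j := by
  simp [polygon]

theorem polygon_eq_iff {i j : Fin (n + 1)} : polygon x i = polygon x j ↔ x.SameCycle i j := by
  constructor
  · intro h
    have : j ∈ polygon x i := by rw [h, mem_polygon]
    exact mem_polygon.1 this
  · intro h
    ext k
    rw [mem_polygon, mem_polygon]
    exact ⟨h.symm.trans, h.trans⟩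

theorem polygon_mem_Pol (i : Fin (n + 1)) : polygon x i ∈ Pol x :=
  Finset.mem_image.2 ⟨i, Finset.mem_univ _, rfl⟩

theorem eq_polygon {P : Finset (Fin (n + 1))} (hP : P ∈ Pol x) {i : Fin (n + 1)} (hi : i ∈ P) :
    P = polygon x i := by
  obtain ⟨j, -, rfl⟩ := Finset.mem_image.1 hP
  exact polygon_eq_iff.2 (mem_polygon.1 hi)

/-- If `i` and `k` are the vertices of a polygon next to `q`, the next vertex `x i` of this polygon
is `k` or is hidden behind it. -/
theorem arc_apply_of_neighbours {i k q : Fin (n + 1)} (h : Arc R i q k)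
    (hx : ¬ Arc R i (x i) k) : Arc R i q (x i) := by
  unfold Arc at *
  omega

theorem Noncrossing.isNoncrossingFamily (h0 : 0 ∈ R) (hx : Noncrossing R x) :
    IsNoncrossingFamily R (Pol x) where
  nonempty P hP := by
    obtain ⟨i, -, rfl⟩ := Finset.mem_image.1 hP
    exact ⟨i, mem_polygon.2 (Equiv.Perm.SameCycle.refl _ _)⟩
  disjoint P hP Q hQ hne := by
    rw [Finset.disjoint_left]
    intro i hi hi'
    exact hne ((eq_polygon hP hi).trans (eq_polygon hQ hi').symm)
  notCrossing P hP Q hQ hne := by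
    intro p₁ hp₁ p₂ hp₂ q₁ hq₁ q₂ hq₂ hp h1 h2
    have hqP : q₁ ∉ P := fun h => hne ((eq_polygon hP h).trans (eq_polygon hQ hq₁).symm)
    obtain ⟨i, hi, k, hk, hA, hPi⟩ := exists_neighbours h0 ⟨p₁, hp₁⟩ hqP
    obtain rfl := eq_polygon hP hi
    obtain rfl := eq_polygon hQ hq₁
    have hA' := arc_apply_of_neighbours hA
      (hPi (x i) (mem_polygon.2 ((Equiv.Perm.SameCycle.refl x i).apply_right)))
    have hq := hx.sameCycle hA' (mem_polygon.1 hq₂)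
    have n1 : ¬ Arc R i p₁ (x i) := fun h => hx.not_sameCycle h (mem_polygon.1 hp₁)
    have n2 : ¬ Arc R i p₂ (x i) := fun h => hx.not_sameCycle h (mem_polygon.1 hp₂)
    have hne' : key R p₁ ≠ key R p₂ := fun h => hp (key_injective h0 h)
    clear hA hPi
    unfold Arc at *
    omega

variable {l : List (Finset (Fin (n + 1)))}

/-- Two labels which stand in this order in the line notation are in decreasing order if they are
vertices of the same polygon, and otherwise the polygon of the first one precedes that of the
second one. -/
theorem pairwise_flatMap_sort (hl : IsPolygonOrder c (Pol x) l) :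
    (l.flatMap fun P => P.sort (· ≥ ·)).Pairwise fun i j =>
      (x.SameCycle i j ∧ j < i) ∨ (l.idxOf (polygon x i) < l.idxOf (polygon x j) ∧
        ¬ StrictlyRight c (polygon x j) (polygon x i)) := by
  refine List.pairwise_flatMap.2 ⟨fun P hP => ?_, ?_⟩
  · have hP' := (hl.mem_iff P).1 hP
    refine (Finset.sortedGT_sort P).pairwise.imp_of_mem fun {i j} hi hj hij => Or.inl ⟨?_, hij⟩
    rw [Finset.mem_sort] at hi hj
    exact polygon_eq_iff.1 ((eq_polygon hP' hi).symm.trans (eq_polygon hP' hj))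
  · have hidx : l.Pairwise fun P Q => l.idxOf P < l.idxOf Q := by
      rw [List.pairwise_iff_getElem]
      intro i j hi hj hij
      rwa [hl.nodup.idxOf_getElem, hl.nodup.idxOf_getElem]
    refine (hidx.and hl.pairwise).imp_of_mem fun {P Q} hP hQ hPQ i hi j hj => Or.inr ?_
    rw [Finset.mem_sort] at hi hj
    rwa [← eq_polygon ((hl.mem_iff P).1 hP) hi, ← eq_polygon ((hl.mem_iff Q).1 hQ) hj]

/-- A descent of the line notation stays in one polygon. -/
theorem isChain_flatMap_sort (h0 : 0 ∈ R) (hx : Noncrossing R x)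
    (hl : IsPolygonOrder c (Pol x) l) :
    (l.flatMap fun P => P.sort (· ≥ ·)).IsChain fun i j => j < i → x.SameCycle i j := by
  have hfam := hx.isNoncrossingFamily h0
  rw [List.flatMap_def, List.isChain_flatten]
  · refine ⟨?_, ?_⟩
    · intro s hs
      obtain ⟨P, hP, rfl⟩ := List.mem_map.1 hs
      have hP' := (hl.mem_iff P).1 hP
      refine ((Finset.sortedGT_sort P).pairwise.imp_of_mem fun {i j} hi hj _ _ => ?_).isChain
      rw [Finset.mem_sort] at hi hj
      exact polygon_eq_iff.1 ((eq_polygon hP' hi).symm.trans (eq_polygon hP' hj))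
    · rw [List.isChain_map]
      refine (hl.isChain hfam).imp ?_
      rintro P Q ⟨p, hp, q, hq, hpq⟩ i hi j hj hji
      exfalso
      obtain ⟨s, hs⟩ := List.getLast?_eq_some_iff.1 hi
      obtain ⟨t, ht⟩ := List.head?_eq_some_iff.1 hj
      have hip : i ≤ p := by
        have h := (Finset.sortedGT_sort P).pairwise
        have hp' := (Finset.mem_sort (· ≥ ·)).2 hp
        rw [hs] at h hp'
        rcases List.mem_append.1 hp' with hp' | hp'
        · exact ((List.pairwise_append.1 h).2.2 p hp' i (by simp)).le
        · exact (List.mem_singleton.1 hp').ge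
      have hqj : q ≤ j := by
        have h := (Finset.sortedGT_sort Q).pairwise
        have hq' := (Finset.mem_sort (· ≥ ·)).2 hq
        rw [ht] at h hq'
        rcases List.mem_cons.1 hq' with hq' | hq'
        · exact hq'.le
        · exact ((List.pairwise_cons.1 h).1 q hq').le
      exact absurd hji (not_lt.2 (hip.trans (hpq.le.trans hqj)))
  · intro h
    obtain ⟨P, hP, hP'⟩ := List.mem_map.1 h
    obtain ⟨p, hp⟩ := hfam.nonempty P ((hl.mem_iff P).1 hP)
    have := (Finset.mem_sort (· ≥ ·)).2 hp
    rw [hP'] at this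
    exact List.not_mem_nil this

/-- The labels of the polygons, written in a row, are the line notation of a permutation. -/
theorem exists_isSc (hl : IsPolygonOrder c (Pol x) l) : ∃ w, IsSc c x w := by
  set f := l.flatMap fun P => P.sort (· ≥ ·) with hf
  have hnd : f.Nodup := (pairwise_flatMap_sort hl).imp fun {i j} h hij => by
    subst hij
    rcases h with ⟨-, h⟩ | ⟨h, -⟩ <;> exact lt_irrefl _ h
  have hmem : ∀ i, i ∈ f := fun i => List.mem_flatMap.2 ⟨polygon x i,
    (hl.mem_iff _).2 (polygon_mem_Pol i), (Finset.mem_sort _).2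
      (mem_polygon.2 (Equiv.Perm.SameCycle.refl _ _))⟩
  have e := hnd.getEquivOfForallMemList f hmem
  have hlen : f.length = n + 1 := by
    simpa using Fintype.card_congr e
  refine ⟨(finCongr hlen.symm).trans (hnd.getEquivOfForallMemList f hmem), l, hl, ?_⟩
  apply List.ext_getElem
  · simp [← hf, hlen]
  · intro i h1 h2
    rw [List.getElem_ofFn]
    rfl

theorem isSc_Sc (h0 : 0 ∈ R) (hn : Fin.last n ∈ R) (hR : rightLabels c = R)
    (hx : Noncrossing R x) : IsSc c x (Sc c x) := by
  obtain ⟨l, hl⟩ := exists_isPolygonOrder h0 hn hR (hx.isNoncrossingFamily h0)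
  exact Classical.epsilon_spec (exists_isSc hl)

/-- The descending runs of `S_c(x)` are the polygons of `x`. -/
theorem IsSc.runRel_iff (h0 : 0 ∈ R) (hx : Noncrossing R x) (hw : IsSc c x w)
    (i j : Fin (n + 1)) : RunRel w i j ↔ x.SameCycle i j := by
  obtain ⟨l, hl, hw⟩ := hw
  have h1 := pairwise_flatMap_sort hl
  have h2 := isChain_flatMap_sort h0 hx hl
  rw [← hw] at h1 h2
  rw [List.pairwise_ofFn] at h1
  rw [List.isChain_ofFn] at h2
  have hdesc : ∀ k : Fin n, w k.succ < w k.castSucc → x.SameCycle (w k.castSucc) (w k.succ) :=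
    fun k => h2 k (by omega)
  have hle : ∀ {p q}, p ≤ q → l.idxOf (polygon x (w p)) ≤ l.idxOf (polygon x (w q)) := by
    intro p q hpq
    rcases hpq.eq_or_lt with rfl | hpq
    · rfl
    · rcases h1 hpq with ⟨h, -⟩ | ⟨h, -⟩
      · rw [polygon_eq_iff.2 h]
      · exact h.le
  have hto : ∀ p q : Fin (n + 1), p ≤ q → (∀ k : Fin n, p ≤ k.castSucc → k.succ ≤ q →
      w k.succ < w k.castSucc) → x.SameCycle (w p) (w q) := by
    intro p q hpq h
    induction q using Fin.induction with
    | zero => rw [Fin.le_zero_iff.1 hpq]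
    | succ q ih =>
      rcases hpq.eq_or_lt with rfl | hlt
      · exact Equiv.Perm.SameCycle.refl _ _
      · have hpq' := Fin.le_castSucc_iff.2 hlt
        exact (ih hpq' fun k h1 h2 => h k h1 (h2.trans q.castSucc_lt_succ.le)).trans
          (hdesc q (h q hpq' le_rfl))
  have hof : ∀ p q : Fin (n + 1), x.SameCycle (w p) (w q) → ∀ k : Fin n, p ≤ k.castSucc →
      k.succ ≤ q → w k.succ < w k.castSucc := by
    intro p q h k hk1 hk2
    have e := polygon_eq_iff.2 h
    have l1 := hle hk1
    have l2 := hle hk2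
    rw [e] at l1
    rcases h1 k.castSucc_lt_succ with ⟨-, h⟩ | ⟨h, -⟩
    · exact h
    · omega
  obtain ⟨p, rfl⟩ := w.surjective i
  obtain ⟨q, rfl⟩ := w.surjective j
  simp only [RunRel, perm_inv_apply_apply]
  constructor
  · intro h
    rcases le_total p q with hpq | hpq
    · exact hto p q hpq fun k h1 h2 => h k (Or.inl ⟨h1, h2⟩)
    · exact (hto q p hpq fun k h1 h2 => h k (Or.inr ⟨h1, h2⟩)).symm
  · rintro h k (⟨h1, h2⟩ | ⟨h1, h2⟩)
    · exact hof p q h k h1 h2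
    · exact hof q p h.symm k h1 h2

/-- A polygon written later is not at the right of a polygon written earlier. -/
theorem IsSc.not_rightOf (h0 : 0 ∈ R) (hn : Fin.last n ∈ R) (hR : rightLabels c = R)
    (hx : Noncrossing R x) (hw : IsSc c x w) {p q : Fin (n + 1)} (hpq : p < q)
    (h : ¬ x.SameCycle (w p) (w q)) : ¬ RightOf R (polygon x (w q)) (polygon x (w p)) := by
  have hfam := hx.isNoncrossingFamily h0
  have hne : polygon x (w p) ≠ polygon x (w q) := fun h' => h (polygon_eq_iff.1 h')
  rw [← strictlyRight_iff h0 hn hR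
    (hfam.disjoint _ (polygon_mem_Pol _) _ (polygon_mem_Pol _) hne)
    (hfam.notCrossing _ (polygon_mem_Pol _) _ (polygon_mem_Pol _) hne)]
  obtain ⟨l, hl, hw⟩ := hw
  have h1 := pairwise_flatMap_sort hl
  rw [← hw, List.pairwise_ofFn] at h1
  rcases h1 hpq with ⟨h', -⟩ | ⟨-, h'⟩
  · exact absurd h' h
  · exact h'

/-- Between a position at which `w` takes a value above `m` and a later one at which it does not,
there is a descent which jumps over `m`. -/
theorem exists_descent_over {p q m : Fin (n + 1)} (hpq : p < q) (hp : m < w p) (hq : w q ≤ m) :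
    ∃ k : Fin n, p ≤ k.castSucc ∧ k.succ ≤ q ∧ w k.succ ≤ m ∧ m < w k.castSucc := by
  induction q using Fin.induction with
  | zero => exact absurd hpq (Fin.not_lt_zero p)
  | succ q ih =>
    have hpq' := Fin.le_castSucc_iff.2 hpq
    rcases lt_or_ge m (w q.castSucc) with h | h
    · exact ⟨q, hpq', le_rfl, hq, h⟩
    · rcases hpq'.eq_or_lt with h' | h'
      · exact absurd hp (not_lt.2 (h' ▸ h))
      · obtain ⟨k, h1, h2, h3⟩ := ih h' h
        exact ⟨k, h1, h2.trans q.castSucc_lt_succ.le, h3⟩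

theorem runRel_succ {k : Fin n} (h : w k.succ < w k.castSucc) :
    RunRel w (w k.castSucc) (w k.succ) := by
  intro m hm
  have e : m = k := by
    simp only [perm_inv_apply_apply, Fin.le_def, Fin.val_castSucc, Fin.val_succ] at hm
    exact Fin.ext (by omega)
  rwa [e]

/-- A forbidden pattern in `S_c(x)` yields a descent which jumps over the `2` of the pattern. This
descent is in one polygon, to which the polygon of the `2` is then in the wrong relation. -/
theorem IsSc.aligned (h0 : 0 ∈ R) (hn : Fin.last n ∈ R) (hR : rightLabels c = R)
    (hx : Noncrossing R x) (hw : IsSc c x w) : Aligned R w := by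
  have hrun := hw.runRel_iff h0 hx
  intro p q r hpq hqr
  constructor
  · intro h1 h2 hmem
    obtain ⟨k, hk1, hk2, hk3, hk4⟩ := exists_descent_over hpq h2 h1.le
    replace hk3 := lt_of_le_of_ne hk3 fun h => (hk2.trans_lt hqr).ne (w.injective h)
    have hk := runRel_succ (hk3.trans hk4)
    have hlt : k.castSucc < r := k.castSucc_lt_succ.trans_le (hk2.trans hqr.le)
    have hns : ¬ x.SameCycle (w k.castSucc) (w r) := fun h => by
      have h' := (hk.symm.trans ((hrun _ _).2 h)).lt
        (by simpa only [perm_inv_apply_apply] using hk2.trans_lt hqr)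
      exact absurd hk3 (not_lt.2 h'.le)
    exact hw.not_rightOf h0 hn hR hx hlt hns (Or.inl ⟨w r,
      mem_polygon.2 (Equiv.Perm.SameCycle.refl _ _), hmem, w k.succ,
      mem_polygon.2 ((hrun _ _).1 hk), w k.castSucc,
      mem_polygon.2 (Equiv.Perm.SameCycle.refl _ _), hk3, hk4⟩)
  · intro h1 h2
    by_contra hmem
    obtain ⟨k, hk1, hk2, hk3, hk4⟩ := exists_descent_over hqr h2 h1.le
    replace hk3 := lt_of_le_of_ne hk3 fun h =>
      (hpq.trans_le (hk1.trans k.castSucc_lt_succ.le)).ne' (w.injective h)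
    have hk := runRel_succ (hk3.trans hk4)
    have hlt : p < k.castSucc := hpq.trans_le hk1
    have hns : ¬ x.SameCycle (w p) (w k.castSucc) := fun h => by
      have h' := ((hrun _ _).2 h).lt (by simpa only [perm_inv_apply_apply] using hlt)
      exact absurd hk4 (not_lt.2 h'.le)
    exact hw.not_rightOf h0 hn hR hx hlt hns (Or.inr ⟨w p,
      mem_polygon.2 (Equiv.Perm.SameCycle.refl _ _), hmem, w k.succ,
      mem_polygon.2 ((hrun _ _).1 hk), w k.castSucc,
      mem_polygon.2 (Equiv.Perm.SameCycle.refl _ _), hk3, hk4⟩)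

theorem IsSc.rotates (h0 : 0 ∈ R) (hx : Noncrossing R x) (hw : IsSc c x w) : Rotates R w x := by
  intro i
  refine ⟨(hw.runRel_iff h0 hx _ _).2 (Equiv.Perm.SameCycle.refl x i).apply_right, ?_⟩
  intro j hj h
  exact hx.not_sameCycle h ((hw.runRel_iff h0 hx _ _).1 hj)

end

/-! ### Aligned permutations and their descending runs -/

section

variable {x w w' : Equiv.Perm (Fin (n + 1))} {R : Set (Fin (n + 1))}

/-- A descending run occupies an interval of positions. -/
theorem RunRel.of_between {i j k : Fin (n + 1)} (h : RunRel w i k) (h1 : w⁻¹ i ≤ w⁻¹ j)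
    (h2 : w⁻¹ j ≤ w⁻¹ k) : RunRel w i j := by
  rintro m (⟨h3, h4⟩ | ⟨h3, h4⟩)
  · exact h m (Or.inl ⟨h3, h4.trans h2⟩)
  · exact absurd ((h4.trans h1).trans h3) (not_le.2 m.castSucc_lt_succ)

theorem inv_lt_inv_of_runRel {i i' j j' : Fin (n + 1)} (hi : RunRel w i i') (hj : RunRel w j j')
    (hij : ¬ RunRel w i j) (h : w⁻¹ i < w⁻¹ j) : w⁻¹ i' < w⁻¹ j' := by
  have h1 : w⁻¹ i' < w⁻¹ j := by
    by_contra hc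
    exact hij (hi.of_between h.le (not_lt.1 hc))
  by_contra hc
  exact hij (hi.trans (hj.symm.of_between (not_lt.1 hc) h1.le).symm |>.trans hj.symm)

/-- If the run of `i` precedes that of `j`, then a label of the second run between two labels of the
first one is on the left, as it ends a pattern `312`, and a label of the first run between two
labels of the second one is on the right, as it begins a pattern `231`. -/
theorem Aligned.not_crossing_of_lt (h0 : 0 ∈ R) (hw : Aligned R w) {i i' j j' : Fin (n + 1)}
    (hi : RunRel w i i') (hj : RunRel w j j') (hij : ¬ RunRel w i j) (h : w⁻¹ i < w⁻¹ j)
    (hne : i ≠ i') : ¬ (Arc R i j i' ∧ Arc R i' j' i) := by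
  have hbefore : ∀ a b, RunRel w i a → RunRel w j b → w⁻¹ a < w⁻¹ b := fun a b ha hb =>
    inv_lt_inv_of_runRel ha hb hij h
  have hpos : ∀ {a b}, RunRel w a b → a < b → w⁻¹ b < w⁻¹ a := by
    intro a b hab hlt
    refine lt_of_le_of_ne (not_lt.1 fun h => absurd (hab.lt h) (not_lt.2 hlt.le)) fun h => ?_
    exact hlt.ne' (w⁻¹.injective h)
  have hq : ∀ a a' b, RunRel w i a → RunRel w i a' → RunRel w j b → a < b → b < a' → b ∉ R := by
    intro a a' b ha ha' hb h1 h2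
    have := (hw (w⁻¹ a') (w⁻¹ a) (w⁻¹ b) (hpos (ha.symm.trans ha') (h1.trans h2))
      (hbefore a b ha hb)).1
    simp only [perm_apply_inv_apply] at this
    exact this h1 h2
  have hp : ∀ a b b', RunRel w i a → RunRel w j b → RunRel w j b' → b < a → a < b' → a ∈ R := by
    intro a b b' ha hb hb' h1 h2
    have := (hw (w⁻¹ a) (w⁻¹ b') (w⁻¹ b) (hbefore a b' ha hb')
      (hpos (hb.symm.trans hb') (h1.trans h2))).2
    simp only [perm_apply_inv_apply] at this
    exact this h1 h2
  have ri := RunRel.refl w i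
  have rj := RunRel.refl w j
  have q1 := hq i i' j ri hi rj
  have q2 := hq i' i j hi ri rj
  have q3 := hq i i' j' ri hi hj
  have q4 := hq i' i j' hi ri hj
  have p1 := hp i j j' ri rj hj
  have p2 := hp i j' j ri hj rj
  have p3 := hp i' j j' hi rj hj
  have p4 := hp i' j' j hi hj rj
  have hval : ∀ a b, RunRel w i a → RunRel w j b → (a : ℕ) ≠ b := fun a b ha hb hab =>
    (hbefore a b ha hb).ne (congrArg _ (Fin.ext hab))
  have e1 := hval i j ri rj
  have e2 := hval i j' ri hj
  have e3 := hval i' j hi rj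
  have e4 := hval i' j' hi hj
  have ki := key_cases h0 i
  have ki' := key_cases h0 i'
  have kj := key_cases h0 j
  have kj' := key_cases h0 j'
  clear hbefore hpos hq hp hval h
  rw [Ne, Fin.ext_iff] at hne
  simp only [Fin.lt_def] at q1 q2 q3 q4 p1 p2 p3 p4
  unfold Arc
  by_cases m1 : i ∈ R <;> by_cases m2 : i' ∈ R <;> by_cases m3 : j ∈ R <;> by_cases m4 : j' ∈ R <;>
  simp only [m1, m2, m3, m4, not_true, not_false_iff, true_and, false_and, or_false, false_or,
    imp_false, imp_true_iff, not_lt] at q1 q2 q3 q4 p1 p2 p3 p4 ki ki' kj kj' <;>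
  omega

/-- The descending runs of an aligned permutation do not cross on the circle. -/
theorem Aligned.not_crossing (h0 : 0 ∈ R) (hw : Aligned R w) {i i' j j' : Fin (n + 1)}
    (hi : RunRel w i i') (hj : RunRel w j j') (hij : ¬ RunRel w i j) (hne : i ≠ i') :
    ¬ (Arc R i j i' ∧ Arc R i' j' i) := by
  rcases lt_trichotomy (w⁻¹ i) (w⁻¹ j) with h | h | h
  · exact hw.not_crossing_of_lt h0 hi hj hij h hne
  · exact absurd (w⁻¹.injective h ▸ RunRel.refl w i) hij
  · rintro ⟨h1, h2⟩
    have hne' : key R i ≠ key R i' := fun h => hne (key_injective h0 h)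
    have hj' : j ≠ j' := by
      rintro rfl
      unfold Arc at h1 h2
      omega
    refine hw.not_crossing_of_lt h0 hj hi.symm (fun h => hij (hi.trans h.symm))
      (inv_lt_inv_of_runRel (RunRel.refl w j) hi (fun h => hij h.symm) h) hj' ?_
    unfold Arc at *
    omega

theorem Rotates.runRel_of_sameCycle (hx : Rotates R w x) {i j : Fin (n + 1)}
    (h : x.SameCycle i j) : RunRel w i j := by
  obtain ⟨m, -, rfl⟩ := h.exists_pow_eq'
  clear h
  induction m with
  | zero => exact RunRel.refl w i
  | succ m ih => rw [pow_succ', Equiv.Perm.mul_apply]; exact ih.trans (hx _).1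

/-- If `x` rotates the descending runs of `w`, these are the supports of the cycles of `x`. -/
theorem Rotates.runRel_iff (h0 : 0 ∈ R) (hx : Rotates R w x) (i j : Fin (n + 1)) :
    RunRel w i j ↔ x.SameCycle i j := by
  refine ⟨fun h => ?_, hx.runRel_of_sameCycle⟩
  by_contra hc
  have hj : j ∉ polygon x i := fun h => hc (mem_polygon.1 h)
  obtain ⟨p, hp, k, hk, hA, hP⟩ := exists_neighbours h0
    ⟨i, mem_polygon.2 (Equiv.Perm.SameCycle.refl x i)⟩ hj
  have hA' := arc_apply_of_neighbours hA (hP (x p) (mem_polygon.2 (mem_polygon.1 hp).apply_right))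
  exact (hx p).2 j ((hx.runRel_of_sameCycle (mem_polygon.1 hp)).symm.trans h) hA'

/-- The permutation which rotates the descending runs of an aligned permutation is noncrossing. -/
theorem Aligned.noncrossing (h0 : 0 ∈ R) (hw : Aligned R w) (hx : Rotates R w x) :
    Noncrossing R x := by
  intro i j h
  have hij : ¬ RunRel w i j := fun h' => (hx i).2 j h' h
  by_contra hc
  have hinj := @key_injective n R h0
  have n1 : key R (x j) ≠ key R i := fun h' => hij (hinj h' ▸ (hx j).1.symm)
  have n2 : key R (x j) ≠ key R (x i) := fun h' =>
    hij ((hx i).1.trans (hinj h' ▸ (hx j).1.symm))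
  by_cases hi : x i = i
  · rw [hi] at hc
    unfold Arc at hc
    omega
  · have n3 : key R (x i) ≠ key R i := fun h' => hi (hinj h')
    refine hw.not_crossing h0 (hx i).1 (hx j).1 hij (Ne.symm hi) ⟨h, ?_⟩
    unfold Arc at *
    omega

/-- At the first difference `p` of two aligned permutations with the same descending runs, suppose
`w' p < w p`. In `w` a descent before the place of `w' p` jumps over this label, which is therefore
on the left; in `w'` the labels of this descent come after `w' p`, which is therefore on the
right. -/
theorem Aligned.le_of_agree (hw : Aligned R w) (hw' : Aligned R w')
    (h : ∀ i j, RunRel w i j ↔ RunRel w' i j) {p : Fin (n + 1)} (hp : ∀ q < p, w q = w' q) :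
    w p ≤ w' p := by
  by_contra! hlt
  have hpos : ∀ i, p ≤ w'⁻¹ i → p ≤ w⁻¹ i := by
    intro i hi
    by_contra! hc
    have := hp _ hc
    rw [perm_apply_inv_apply] at this
    rw [this, perm_inv_apply_apply] at hi
    exact absurd hi (not_le.2 hc)
  have hpos' : ∀ i, p ≤ w⁻¹ i → p ≤ w'⁻¹ i := by
    intro i hi
    by_contra! hc
    have := hp _ hc
    rw [perm_apply_inv_apply] at this
    rw [← this, perm_inv_apply_apply] at hi
    exact absurd hi (not_le.2 hc)
  have hpq : p < w⁻¹ (w' p) := by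
    refine lt_of_le_of_ne (hpos _ (by rw [perm_inv_apply_apply])) fun h' => ?_
    have := congrArg w h'
    rw [perm_apply_inv_apply] at this
    exact hlt.ne this.symm
  -- `w' p` is the largest remaining label of its run
  have hmax : ∀ i, p ≤ w⁻¹ i → RunRel w i (w' p) → i ≤ w' p := by
    intro i hi hr
    by_contra! hc
    have h1 := ((h _ _).1 hr).symm
    rcases (hpos' i hi).eq_or_lt with h2 | h2
    · rw [h2, perm_apply_inv_apply] at hc
      exact lt_irrefl _ hc
    · exact absurd (h1.lt (by rwa [perm_inv_apply_apply])) (not_lt.2 hc.le)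
  obtain ⟨k, hk1, hk2, hk3, hk4⟩ := exists_descent_over hpq hlt (perm_apply_inv_apply w _).le
  have hr := runRel_succ (hk3.trans_lt hk4)
  have hne : w k.succ ≠ w' p := fun h' =>
    absurd hk4 (not_lt.2 (hmax _ (by rwa [perm_inv_apply_apply]) (h' ▸ hr)))
  replace hk3 := lt_of_le_of_ne hk3 hne
  replace hk2 : k.succ < w⁻¹ (w' p) := lt_of_le_of_ne hk2 fun h' =>
    hne (by rw [h', perm_apply_inv_apply])
  have hR : w' p ∉ R := by
    have := (hw k.castSucc k.succ (w⁻¹ (w' p)) k.castSucc_lt_succ hk2).1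
    rw [perm_apply_inv_apply] at this
    exact this hk3 hk4
  refine hR ?_
  have hr' := (h _ _).1 hr
  have h1 : w'⁻¹ (w k.castSucc) < w'⁻¹ (w k.succ) := by
    refine lt_of_le_of_ne (not_lt.1 fun h => ?_) fun h => ?_
    · exact absurd (hr'.symm.lt h) (not_lt.2 (hk3.trans hk4).le)
    · exact (hk3.trans hk4).ne (w'⁻¹.injective h).symm
  have h2 : p < w'⁻¹ (w k.castSucc) := by
    refine lt_of_le_of_ne (hpos' _ (by rwa [perm_inv_apply_apply])) fun h => ?_
    rw [h, perm_apply_inv_apply] at hk4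
    exact lt_irrefl _ hk4
  have := (hw' p _ _ h2 h1).2
  rw [perm_apply_inv_apply, perm_apply_inv_apply] at this
  exact this hk3 hk4

/-- An aligned permutation is determined by its descending runs. -/
theorem Aligned.eq (hw : Aligned R w) (hw' : Aligned R w')
    (h : ∀ i j, RunRel w i j ↔ RunRel w' i j) : w = w' := by
  ext p
  congr 1
  induction p using WellFoundedLT.induction with
  | _ p ih =>
    exact le_antisymm (hw.le_of_agree hw' h ih)
      (hw'.le_of_agree hw (fun i j => (h i j).symm) fun q hq => (ih q hq).symm)

end

/-! ### The two descriptions of sortable elements and noncrossing partitions -/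

/-- The set of labels on the right side of the circle controls both the sortable elements with the
map `Read` and, as `c` rotates the circle, the noncrossing partitions. -/
theorem exists_right_side (a : Equiv.Perm (Fin n)) :
    ∃ R : Set (Fin (n + 1)), 0 ∈ R ∧ Fin.last n ∈ R ∧
      IsRotation R (coxeterElement (simpleA n) a) ∧
      (∀ w, w ∈ SortableElements (simpleA n) a ↔ Aligned R w) ∧
      ∀ w, Aligned R w → Rotates R w (Read (simpleA n) a w) := by
  rcases Nat.eq_zero_or_pos n with rfl | hn
  · have : Subsingleton (Fin (0 + 1)) := inferInstanceAs (Subsingleton (Fin 1))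
    have hle : ∀ i j : Fin (0 + 1), ¬ i < j := by
      intro i j
      rw [Subsingleton.elim i j]
      exact lt_irrefl _
    have harc : ∀ (R : Set (Fin (0 + 1))) (i j k : Fin (0 + 1)), ¬ Arc R i j k := by
      intro R i j k
      rw [Subsingleton.elim i k, Subsingleton.elim j k]
      unfold Arc
      omega
    refine ⟨Set.univ, trivial, trivial, fun i j => harc _ _ _ _, fun w => ?_, fun w _ i =>
      ⟨fun k => k.elim0, fun j _ => harc _ _ _ _⟩⟩
    exact iff_of_true (fun k i => i.elim0) fun p q r h => absurd h (hle p q)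
  · have hs := isSide_sideAt a hn
    exact ⟨_, hs.zero, hs.last, hs.isRotation, mem_SortableElements_iff_aligned a hn,
      fun w hw => rotates_Read a hn hw⟩

end CoxeterSortable

end

theorem theorema (n : ℕ) (a : Equiv.Perm (Fin n)) (c : Equiv.Perm (Fin (n + 1)))
    (hc : c = CoxeterSortable.coxeterElement (CoxeterSortable.simpleA n) a) :
    (∀ x ∈ CoxeterSortable.NC (CoxeterSortable.simpleA n) c,
      (∃! l, CoxeterSortable.IsPolygonOrder c (CoxeterSortable.Pol x) l) ∧
      CoxeterSortable.IsSc c x (CoxeterSortable.Sc c x) ∧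
      CoxeterSortable.Sc c x ∈ CoxeterSortable.SortableElements (CoxeterSortable.simpleA n) a ∧
      CoxeterSortable.Read (CoxeterSortable.simpleA n) a (CoxeterSortable.Sc c x) = x) ∧
    Set.BijOn (CoxeterSortable.Read (CoxeterSortable.simpleA n) a)
      (CoxeterSortable.SortableElements (CoxeterSortable.simpleA n) a) (CoxeterSortable.NC (CoxeterSortable.simpleA n) c) ∧
    Set.InvOn (CoxeterSortable.Sc c) (CoxeterSortable.Read (CoxeterSortable.simpleA n) a)
      (CoxeterSortable.SortableElements (CoxeterSortable.simpleA n) a) (CoxeterSortable.NC (CoxeterSortable.simpleA n) c) := by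
  open CoxeterSortable in
  obtain ⟨R, h0, hl, hrot, hsort, hread⟩ := exists_right_side a
  rw [← hc] at hrot
  have hR : rightLabels c = R := hrot.rightLabels_eq h0 hl
  have hx : ∀ x ∈ NC (simpleA n) c, (∃! l, IsPolygonOrder c (Pol x) l) ∧ IsSc c x (Sc c x) ∧
      Sc c x ∈ SortableElements (simpleA n) a ∧ Read (simpleA n) a (Sc c x) = x := by
    intro x hx
    have hnc := noncrossing_of_mem_NC h0 hrot hx
    have hfam := hnc.isNoncrossingFamily h0
    obtain ⟨l, hlo⟩ := exists_isPolygonOrder h0 hl hR hfam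
    have hSc := isSc_Sc h0 hl hR hnc
    have hal := hSc.aligned h0 hl hR hnc
    exact ⟨⟨l, hlo, fun l' hl' => hl'.eq hfam hlo⟩, hSc, (hsort _).2 hal,
      (hread _ hal).eq h0 (fun _ _ => Iff.rfl) (hSc.rotates h0 hnc)⟩
  have hmaps : Set.MapsTo (Read (simpleA n) a) (SortableElements (simpleA n) a)
      (NC (simpleA n) c) := by
    intro w hw
    have hal := (hsort w).1 hw
    exact mem_NC_of_noncrossing h0 hrot (hal.noncrossing h0 (hread w hal))
  have hleft : Set.LeftInvOn (Sc c) (Read (simpleA n) a) (SortableElements (simpleA n) a) := by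
    intro w hw
    have hal := (hsort w).1 hw
    obtain ⟨-, -, hS, hRead⟩ := hx _ (hmaps hw)
    have hal' := (hsort _).1 hS
    -- both permutations have the cycles of `Read w` as descending runs
    refine hal'.eq hal fun i j => ?_
    rw [(hread _ hal').runRel_iff h0, (hread w hal).runRel_iff h0, hRead]
  have hinv : Set.InvOn (Sc c) (Read (simpleA n) a) (SortableElements (simpleA n) a)
      (NC (simpleA n) c) := ⟨hleft, fun x h => (hx x h).2.2.2⟩
  exact ⟨hx, hinv.bijOn hmaps fun x h => (hx x h).2.2.1, hinv⟩
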